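/- Let $M$ be a smooth $4$-manifold with a $\mathrm U(2)$-structure, given in local gauges by coframes $\Psi=(\alpha,\beta)^T$ of complex $1$-forms such that $e^1,\dots,e^4$ with $\alpha=e^1+ie^2$, $\beta=e^3+ie^4$ is a real coframe; on overlaps the $\Psi$'s differ by $\mathrm U(2)$-valued functions. Put $g=\alpha\odot\bar\alpha+\beta\odot\bar\beta=\sum_I (e^I)^2$, $\omega=\frac i2(\alpha\wedge\bar\alpha+\beta\wedge\bar\beta)=\frac1{2i}\Psi^\dagger\Psi$, $dV=e^1\wedge e^2\wedge e^3\wedge e^4$ (which fixes the orientation), and let $\Sigma=\Psi\Psi^\dagger+\frac12\mathbb I\,\Psi^\dagger\Psi$ be the trace-free part of $\Psi\wedge\Psi^\dagger$. Let $A$ and $a$ be the $\mathfrak{su}(2)$ (trace-free) part and the imaginary trace part of a $\mathrm U(2)$ connection, $F=dA+A\wedge A$, and let $\lambda,\mu,\nu\in\mathbb R$ satisfy $\lambda\ne0$ and $3\lambda-\mu+4\nu=0$; put $\tilde\mu=\mu/\lambda$. Consider $$S[A,a,\Psi]=\int_M \mathrm{Tr}\big(\lambda\,\Psi^\dagger F\Psi+\mu\,da\,\Psi^\dagger\Psi+\nu\,(\Psi^\dagger\Psi)^2\big).$$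 (i) For a smooth $\mathfrak{su}(2)$-valued variation $\delta A$ with compact support in a gauge patch, $\delta S=-\lambda\int \mathrm{Tr}\big(\delta A\wedge(d\Sigma+A\wedge\Sigma-\Sigma\wedge A)\big)$. Hence the Euler–Lagrange equation for $A$ is $d\Sigma+A\wedge\Sigma-\Sigma\wedge A=0$, an algebraic (pointwise linear) equation for $A$. Its unique solution at every point is $A=\mathbf w$, the anti-self-dual part of the Levi-Civita connection of $g$, acting on $\mathbb C^2$; the local forms $\mathbf w$ do define such a connection on $M$, and it is the only solution of the Euler–Lagrange equation. (ii) Let $s$ be the scalar curvature of $g$ in the normalisation $s\,dV=\frac14\epsilon_{IJKL}R^{IJ}\wedge e^K\wedge e^L$, that is, $s=\frac12 g^{\mu\nu}\mathrm{Ric}_{\mu\nu}$. Then $\Psi^\dagger F(\mathbf w)\Psi=-s\,dV$ and $(\Psi^\dagger\Psi)^2=-8\,dV$. Substituting $A=\mathbf w$ gives $$S[\mathbf w,a,\Psi]=-\lambda\int_M\Big(dV\,(s+2\tilde\mu-6)-2\tilde\mu\,\omega\wedge i\,da\Big),$$ also as an identity of integrands; the right-hand side depends only on $(g,\omega,a)$,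 where $M$ is oriented by $\omega\wedge\omega$. (iii) Here $g$ is a Riemannian metric and $\omega$ a $2$-form on $M$ subject to $\omega_{\mu\alpha}g^{\alpha\beta}\omega_{\beta\nu}=-g_{\mu\nu}$. Two coframes $\Psi$ give the same $(g,\omega)$ at a point exactly when they differ there by an element of $\mathrm U(2)$, and every smooth pair $(g,\omega)$ satisfying this condition arises locally from a smooth $\Psi$. -/

import Mathlib

open scoped Manifold ContDiff Matrix
open MeasureTheory

noncomputable section

namespace U2Gravity

/-! ### Differential forms in a coordinate domain, by components

A `k`-form with values in `X` on a domain of `ℝ⁴` is given by its components: a `1`-form is a map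
`α : E4 → Fin 4 → X`, where `α y μ` is the value of `α` at `y` on the coordinate vector `∂_μ`,
a `2`-form has components `σ y μ ν`, a `3`-form `θ y μ ν ρ`.  A `4`-form is given by its single
component on `(∂_0, ∂_1, ∂_2, ∂_3)`.  Values multiply by `*`, so the wedge products below apply to
real and complex forms and to matrices of forms (of any compatible sizes) alike. -/

/-- The coordinate space `ℝ⁴`. -/
abbrev E4 : Type := EuclideanSpace ℝ (Fin 4)

/-- The partial derivative `∂_μ f` at `y`. -/
def pd {V : Type*} [NormedAddCommGroup V] [NormedSpace ℝ V] (μ : Fin 4) (f : E4 → V) (y : E4) : V :=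
  fderiv ℝ f y (EuclideanSpace.single μ (1 : ℝ))

section Wedge

variable {X Y Z : Type*} [HMul X Y Z] [AddCommGroup Z]

/-- Wedge product of two `1`-forms (at a point). -/
def w11 (α : Fin 4 → X) (β : Fin 4 → Y) : Fin 4 → Fin 4 → Z :=
  fun μ ν => α μ * β ν - α ν * β μ

/-- Wedge product of a `1`-form and a `2`-form (at a point). -/
def w12 (α : Fin 4 → X) (σ : Fin 4 → Fin 4 → Y) : Fin 4 → Fin 4 → Fin 4 → Z :=
  fun μ ν ρ => α μ * σ ν ρ - α ν * σ μ ρ + α ρ * σ μ ν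

/-- Wedge product of a `2`-form and a `1`-form (at a point). -/
def w21 (σ : Fin 4 → Fin 4 → X) (α : Fin 4 → Y) : Fin 4 → Fin 4 → Fin 4 → Z :=
  fun μ ν ρ => σ μ ν * α ρ - σ μ ρ * α ν + σ ν ρ * α μ

/-- Wedge product of two `2`-forms (at a point), as the component on `(∂_0, ∂_1, ∂_2, ∂_3)`. -/
def w22 (σ : Fin 4 → Fin 4 → X) (τ : Fin 4 → Fin 4 → Y) : Z :=
  σ 0 1 * τ 2 3 - σ 0 2 * τ 1 3 + σ 0 3 * τ 1 2 + σ 1 2 * τ 0 3 - σ 1 3 * τ 0 2 + σ 2 3 * τ 0 1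

/-- Wedge product of a `1`-form and a `3`-form (at a point), on `(∂_0, ∂_1, ∂_2, ∂_3)`. -/
def w13 (α : Fin 4 → X) (θ : Fin 4 → Fin 4 → Fin 4 → Y) : Z :=
  α 0 * θ 1 2 3 - α 1 * θ 0 2 3 + α 2 * θ 0 1 3 - α 3 * θ 0 1 2

/-- Wedge product of a `3`-form and a `1`-form (at a point), on `(∂_0, ∂_1, ∂_2, ∂_3)`. -/
def w31 (θ : Fin 4 → Fin 4 → Fin 4 → X) (α : Fin 4 → Y) : Z :=
  θ 0 1 2 * α 3 - θ 0 1 3 * α 2 + θ 0 2 3 * α 1 - θ 1 2 3 * α 0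

end Wedge

/-- Exterior derivative of a scalar `1`-form. -/
def d1 {V : Type*} [NormedAddCommGroup V] [NormedSpace ℝ V] (α : E4 → Fin 4 → V) (y : E4) :
    Fin 4 → Fin 4 → V :=
  fun μ ν => pd μ (fun z => α z ν) y - pd ν (fun z => α z μ) y

/-- Exterior derivative of a scalar `2`-form. -/
def d2 {V : Type*} [NormedAddCommGroup V] [NormedSpace ℝ V] (σ : E4 → Fin 4 → Fin 4 → V) (y : E4) :
    Fin 4 → Fin 4 → Fin 4 → V :=
  fun μ ν ρ => pd μ (fun z => σ z ν ρ) y - pd ν (fun z => σ z μ ρ) y + pd ρ (fun z => σ z μ ν) y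

/-- Exterior derivative of a matrix of complex `1`-forms, entry by entry. -/
def d1M {p q : ℕ} (α : E4 → Fin 4 → Matrix (Fin p) (Fin q) ℂ) (y : E4) :
    Fin 4 → Fin 4 → Matrix (Fin p) (Fin q) ℂ :=
  fun μ ν => Matrix.of fun i j => d1 (fun z κ => α z κ i j) y μ ν

/-- Exterior derivative of a matrix of complex `2`-forms, entry by entry. -/
def d2M {p q : ℕ} (σ : E4 → Fin 4 → Fin 4 → Matrix (Fin p) (Fin q) ℂ) (y : E4) :
    Fin 4 → Fin 4 → Fin 4 → Matrix (Fin p) (Fin q) ℂ :=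
  fun μ ν ρ => Matrix.of fun i j => d2 (fun z κ ι => σ z κ ι i j) y μ ν ρ

/-- Pull-back of a `1`-form under `τ`. -/
def pull1 {X : Type*} [AddCommMonoid X] [Module ℝ X] (τ : E4 → E4) (α : E4 → Fin 4 → X) (y : E4) :
    Fin 4 → X :=
  fun μ => ∑ κ, pd μ (fun z => τ z κ) y • α (τ y) κ

/-- Pull-back of a covariant `2`-tensor under `τ`. -/
def pull2 {X : Type*} [AddCommMonoid X] [Module ℝ X] (τ : E4 → E4) (σ : E4 → Fin 4 → Fin 4 → X)
    (y : E4) : Fin 4 → Fin 4 → X :=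
  fun μ ν => ∑ κ, ∑ ι, (pd μ (fun z => τ z κ) y * pd ν (fun z => τ z ι) y) • σ (τ y) κ ι

/-! ### Riemannian geometry of a metric in coordinates -/

/-- Christoffel symbols `Γ^ρ_{μν}` of the metric `g`. -/
def christoffel (g : E4 → Matrix (Fin 4) (Fin 4) ℝ) (ρ μ ν : Fin 4) (y : E4) : ℝ :=
  (1 / 2) * ∑ σ, (g y)⁻¹ ρ σ *
    (pd μ (fun z => g z σ ν) y + pd ν (fun z => g z σ μ) y - pd σ (fun z => g z μ ν) y)

/-- Riemann curvature `R^ρ_{σμν}` of the metric `g`. -/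
def riemann (g : E4 → Matrix (Fin 4) (Fin 4) ℝ) (ρ σ μ ν : Fin 4) (y : E4) : ℝ :=
  pd μ (christoffel g ρ ν σ) y - pd ν (christoffel g ρ μ σ) y
    + ∑ κ, (christoffel g ρ μ κ y * christoffel g κ ν σ y
      - christoffel g ρ ν κ y * christoffel g κ μ σ y)

/-- Ricci tensor `Ric_{σν} = R^ρ_{σρν}` of the metric `g`. -/
def ricci (g : E4 → Matrix (Fin 4) (Fin 4) ℝ) (σ ν : Fin 4) (y : E4) : ℝ :=
  ∑ ρ, riemann g ρ σ ρ ν y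

/-- The trace `g^{σν} Ric_{σν}` of the Ricci tensor (`12` for the unit sphere `S⁴`). -/
def traceRicci (g : E4 → Matrix (Fin 4) (Fin 4) ℝ) (y : E4) : ℝ :=
  ∑ σ, ∑ ν, (g y)⁻¹ σ ν * ricci g σ ν y

/-- The scalar curvature in the normalisation `s dV = ¼ ε_{IJKL} R^{IJ} ∧ e^K ∧ e^L`, that is, half
of the trace of the Ricci tensor. -/
def scalarCurv (g : E4 → Matrix (Fin 4) (Fin 4) ℝ) (y : E4) : ℝ :=
  (1 / 2) * traceRicci g y

/-! ### The `ℂ²`-valued coframe `Ψ = (α, β)ᵀ` and its metric geometry -/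

/-- A `ℂ²`-valued `1`-form on `ℝ⁴`: `Ψ y μ` is the column `(α_μ(y), β_μ(y))ᵀ`. -/
abbrev C2Form : Type := E4 → Fin 4 → Matrix (Fin 2) (Fin 1) ℂ

/-- A `1`-form with values in complex `2 × 2` matrices. -/
abbrev M2Form : Type := E4 → Fin 4 → Matrix (Fin 2) (Fin 2) ℂ

/-- The real coframe `e^I` of `Ψ`: `α = e^1 + i e^2`, `β = e^3 + i e^4`.  Rows are the four
`1`-forms, columns their coordinate components. -/
def coframe (Ψ : C2Form) (y : E4) : Matrix (Fin 4) (Fin 4) ℝ :=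
  Matrix.of fun I μ => ![(Ψ y μ 0 0).re, (Ψ y μ 0 0).im, (Ψ y μ 1 0).re, (Ψ y μ 1 0).im] I

/-- `Ψ†`, as a row of `1`-forms. -/
def dag (Ψ : C2Form) : E4 → Fin 4 → Matrix (Fin 1) (Fin 2) ℂ := fun y μ => (Ψ y μ)ᴴ

/-- The `1 × 1` matrix `Ψ† ∧ Ψ` of `2`-forms. -/
def dagPsi (Ψ : C2Form) (y : E4) : Fin 4 → Fin 4 → Matrix (Fin 1) (Fin 1) ℂ :=
  w11 (dag Ψ y) (Ψ y)

/-- The trace-free part `Σ = Ψ ∧ Ψ† + ½ 𝕀 (Ψ† ∧ Ψ)` of `Ψ ∧ Ψ†`. -/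
def sigma (Ψ : C2Form) (y : E4) : Fin 4 → Fin 4 → Matrix (Fin 2) (Fin 2) ℂ :=
  fun μ ν => w11 (Ψ y) (dag Ψ y) μ ν
    + ((1 / 2 : ℂ) * dagPsi Ψ y μ ν 0 0) • (1 : Matrix (Fin 2) (Fin 2) ℂ)

/-- The metric `g = α ⊙ ᾱ + β ⊙ β̄` (with `α ⊙ ᾱ = ½ (α ⊗ ᾱ + ᾱ ⊗ α)`). -/
def metric (Ψ : C2Form) (y : E4) : Matrix (Fin 4) (Fin 4) ℝ :=
  Matrix.of fun μ ν => ∑ c, (Ψ y μ c 0 * star (Ψ y ν c 0)).re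

/-- The `2`-form `ω = (i/2) (α ∧ ᾱ + β ∧ β̄)`, which is real. -/
def omega (Ψ : C2Form) (y : E4) : Matrix (Fin 4) (Fin 4) ℝ :=
  Matrix.of fun μ ν =>
    ((Complex.I / 2) * ∑ c, (Ψ y μ c 0 * star (Ψ y ν c 0) - Ψ y ν c 0 * star (Ψ y μ c 0))).re

/-- The component of the volume form `dV = e^1 ∧ e^2 ∧ e^3 ∧ e^4`. -/
def volForm (Ψ : C2Form) (y : E4) : ℝ := (coframe Ψ y).det

/-- The orientation sign, relative to the coordinates, of the orientation in which
`e^1 ∧ e^2 ∧ e^3 ∧ e^4` (equivalently `ω ∧ ω`) is positive. -/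
def orient (Ψ : C2Form) (y : E4) : ℝ := Real.sign (volForm Ψ y)

/-- The Levi-Civita connection of `metric Ψ` in the orthonormal coframe `e^I`:
`w^I_J(∂_μ) = e^I(∇_μ E_J)`, where `E_J` is the frame dual to `e^I`. -/
def leviCivita (Ψ : C2Form) (y : E4) (μ : Fin 4) : Matrix (Fin 4) (Fin 4) ℝ :=
  Matrix.of fun I J => ∑ ν, coframe Ψ y I ν *
    (pd μ (fun z => (coframe Ψ z)⁻¹ ν J) y
      + ∑ ρ, christoffel (metric Ψ) ν μ ρ y * (coframe Ψ y)⁻¹ ρ J)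

/-- The curvature `R^{IJ} = dw^{IJ} + w^I_K ∧ w^{KJ}` of the Levi-Civita connection. -/
def lcCurv (Ψ : C2Form) (y : E4) (I J : Fin 4) : Fin 4 → Fin 4 → ℝ :=
  fun μ ν => d1 (fun z κ => leviCivita Ψ z κ I J) y μ ν
    + ∑ K, w11 (fun κ => leviCivita Ψ y κ I K) (fun κ => leviCivita Ψ y κ K J) μ ν

/-- The `2`-form `e^K ∧ e^L`. -/
def ee (Ψ : C2Form) (y : E4) (K L : Fin 4) : Fin 4 → Fin 4 → ℝ :=
  w11 (coframe Ψ y K) (coframe Ψ y L)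

/-- The Hodge star `½ ε_{IJKL} W_{KL}` of an antisymmetric matrix, in the orientation
`e^1 ∧ e^2 ∧ e^3 ∧ e^4`. -/
def hodge (W : Matrix (Fin 4) (Fin 4) ℝ) : Matrix (Fin 4) (Fin 4) ℝ :=
  !![0, W 2 3, -W 1 3, W 1 2;
     -W 2 3, 0, W 0 3, -W 0 2;
     W 1 3, -W 0 3, 0, W 0 1;
     -W 1 2, W 0 2, -W 0 1, 0]

/-- The complex `2 × 2` matrix of a complex-linear endomorphism of `ℝ⁴ ≅ ℂ²`,
`z¹ = x¹ + i x²`, `z² = x³ + i x⁴`. -/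
def toComplex (W : Matrix (Fin 4) (Fin 4) ℝ) : Matrix (Fin 2) (Fin 2) ℂ :=
  !![(W 0 0 : ℂ) + Complex.I * W 1 0, (W 0 2 : ℂ) + Complex.I * W 1 2;
     (W 2 0 : ℂ) + Complex.I * W 3 0, (W 2 2 : ℂ) + Complex.I * W 3 2]

/-- The anti-self-dual part `𝐰` of the Levi-Civita connection: the anti-self-dual part
`½ (w - ⋆w)` of the `𝔰𝔬(4)`-valued form `w` commutes with the complex structure and has no trace,
which makes it an `𝔰𝔲(2)`-valued form acting on `ℂ² ∋ (α, β)`. -/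
def asdLeviCivita (Ψ : C2Form) : M2Form := fun y μ =>
  toComplex ((1 / 2 : ℝ) • (leviCivita Ψ y μ - hodge (leviCivita Ψ y μ)))

/-! ### The Lagrangian and its variation -/

/-- `X ∈ 𝔰𝔲(2)`. -/
def IsSu2 (X : Matrix (Fin 2) (Fin 2) ℂ) : Prop := Xᴴ = -X ∧ X.trace = 0

/-- The curvature `F = dA + A ∧ A`. -/
def curv (A : M2Form) (y : E4) : Fin 4 → Fin 4 → Matrix (Fin 2) (Fin 2) ℂ :=
  fun μ ν => d1M A y μ ν + w11 (A y) (A y) μ ν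

/-- The `4`-form `Ψ† ∧ F ∧ Ψ` (a `1 × 1` matrix). -/
def psiFpsi (Ψ : C2Form) (A : M2Form) (y : E4) : Matrix (Fin 1) (Fin 1) ℂ :=
  w31 (w12 (dag Ψ y) (curv A y) : Fin 4 → Fin 4 → Fin 4 → Matrix (Fin 1) (Fin 2) ℂ) (Ψ y)

/-- The Lagrangian `4`-form `Tr(λ Ψ†FΨ + μ da Ψ†Ψ + ν (Ψ†Ψ)²)`, on `(∂_0, ∂_1, ∂_2, ∂_3)`. -/
def lagrangian (lam mu nu : ℝ) (Ψ : C2Form) (a : E4 → Fin 4 → ℂ) (A : M2Form) (y : E4) : ℂ :=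
  Matrix.trace ((lam : ℂ) • psiFpsi Ψ A y
    + (mu : ℂ) • (w22 (fun μ ν => !![d1 a y μ ν]) (dagPsi Ψ y) : Matrix (Fin 1) (Fin 1) ℂ)
    + (nu : ℂ) • (w22 (dagPsi Ψ y) (dagPsi Ψ y) : Matrix (Fin 1) (Fin 1) ℂ))

/-- The left hand side `dΣ + B ∧ Σ - Σ ∧ B` at the point `y`, where `B` is the value of an
`𝔰𝔲(2)`-connection at `y`; no derivative of the connection enters. -/
def elForm (Ψ : C2Form) (y : E4) (B : Fin 4 → Matrix (Fin 2) (Fin 2) ℂ) :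
    Fin 4 → Fin 4 → Fin 4 → Matrix (Fin 2) (Fin 2) ℂ :=
  fun μ ν ρ => d2M (sigma Ψ) y μ ν ρ + w12 B (sigma Ψ y) μ ν ρ - w21 (sigma Ψ y) B μ ν ρ

/-- `δ` is a variation of an `SU(2)` connection on the open set `V`: a smooth `𝔰𝔲(2)`-valued
`1`-form with compact support in `V`. -/
def IsVariation (V : Set E4) (δ : M2Form) : Prop :=
  (∀ μ c d, ContDiff ℝ ∞ fun y => δ y μ c d) ∧ (∀ y μ, IsSu2 (δ y μ)) ∧
    ∃ K : Set E4, IsCompact K ∧ K ⊆ V ∧ ∀ y, y ∉ K → ∀ μ, δ y μ = 0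

/-- The change `S[A + δ] - S[A]` of the action under a variation with support in `V`. -/
def actionChange (lam mu nu : ℝ) (V : Set E4) (Ψ : C2Form) (a : E4 → Fin 4 → ℂ) (A δ : M2Form) :
    ℂ :=
  ∫ y in V, (orient Ψ y : ℂ) *
    (lagrangian lam mu nu Ψ a (fun z μ => A z μ + δ z μ) y - lagrangian lam mu nu Ψ a A y)

/-! ### Global objects on a four-manifold -/

section Global

variable {M : Type*} [TopologicalSpace M]

/-- The transition function `φ_j ∘ φ_i⁻¹`. -/
def transition (chart : ℕ → OpenPartialHomeomorph M E4) (i j : ℕ) (y : E4) : E4 :=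
  chart j ((chart i).symm y)

/-- The image of `U_i ∩ U_j` under `φ_i`. -/
def overlap (chart : ℕ → OpenPartialHomeomorph M E4) (i j : ℕ) : Set E4 :=
  {y | y ∈ (chart i).target ∧ (chart i).symm y ∈ (chart j).source}

/-- The integral over `M` of a family of densities `f i` in the charts of a countable atlas: `M` is
cut into the disjoint measurable pieces `U_i \ (U_0 ∪ ⋯ ∪ U_{i-1})`.  When the `f i` are
`± (4-form on coordinate vectors)` with the sign of an orientation, this is the integral of the
`4`-form over the oriented manifold. -/
def atlasIntegral (chart : ℕ → OpenPartialHomeomorph M E4) (f : ℕ → E4 → ℂ) : ℂ :=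
  ∫ p in {p : ℕ × E4 | p.2 ∈ (chart p.1).target ∧
      ∀ m < p.1, (chart p.1).symm p.2 ∉ (chart m).source},
    f p.1 p.2 ∂((Measure.count : Measure ℕ).prod (volume : Measure E4))

/-- A `U(2)`-structure on the four-manifold `M`, in local gauges: a countable atlas by charts
`φ_i : U_i → ℝ⁴` of the smooth structure, on each of them a smooth `ℂ²`-valued coframe `Ψ_i`, and on
the overlaps smooth `U(2)`-valued functions with `Ψ_i = u_{ij} Ψ_j`. -/
structure U2Structure (M : Type*) [TopologicalSpace M] [ChartedSpace E4 M] where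
  chart : ℕ → OpenPartialHomeomorph M E4
  chart_mem : ∀ i, chart i ∈ IsManifold.maximalAtlas (𝓡 4) ∞ M
  cover : ∀ x, ∃ i, x ∈ (chart i).source
  Psi : ℕ → C2Form
  smooth : ∀ i μ c, ContDiffOn ℝ ∞ (fun y => Psi i y μ c 0) (chart i).target
  nondeg : ∀ i, ∀ y ∈ (chart i).target, (coframe (Psi i) y).det ≠ 0
  trans : ℕ → ℕ → E4 → Matrix (Fin 2) (Fin 2) ℂ
  trans_smooth : ∀ i j c d, ContDiffOn ℝ ∞ (fun y => trans i j y c d) (overlap chart i j)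
  trans_unitary : ∀ i j, ∀ y ∈ overlap chart i j, trans i j y ∈ Matrix.unitaryGroup (Fin 2) ℂ
  glue : ∀ i j, ∀ y ∈ overlap chart i j, ∀ μ,
    Psi i y μ = trans i j y * pull1 (transition chart i j) (Psi j) y μ

variable [ChartedSpace E4 M]

/-- The trace-free part of a `2 × 2` matrix. -/
def traceFree (X : Matrix (Fin 2) (Fin 2) ℂ) : Matrix (Fin 2) (Fin 2) ℂ :=
  X - (X.trace / 2) • (1 : Matrix (Fin 2) (Fin 2) ℂ)

/-- `A` is the `SU(2)` part of a smooth `U(2)` connection: in each gauge an `𝔰𝔲(2)`-valued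
`1`-form, and `A_i` is the trace-free part of `u A_j u⁻¹ - du u⁻¹`, `u = u_{ij}`, on overlaps. -/
def IsSU2Connection (P : U2Structure M) (A : ℕ → M2Form) : Prop :=
  (∀ i μ c d, ContDiffOn ℝ ∞ (fun y => A i y μ c d) (P.chart i).target) ∧
  (∀ i, ∀ y ∈ (P.chart i).target, ∀ μ, IsSu2 (A i y μ)) ∧
  ∀ i j, ∀ y ∈ overlap P.chart i j, ∀ μ,
    A i y μ = traceFree
      (P.trans i j y * pull1 (transition P.chart i j) (A j) y μ * (P.trans i j y)ᴴ
        - Matrix.of (fun c d => pd μ (fun z => P.trans i j z c d) y) * (P.trans i j y)ᴴ)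

/-- `a` is the `U(1)` part of a smooth `U(2)` connection, given by its local potentials: imaginary
`1`-forms that change by closed forms between gauges, so that the curvature `da` is a global
`2`-form. -/
def IsU1Connection (P : U2Structure M) (a : ℕ → E4 → Fin 4 → ℂ) : Prop :=
  (∀ i μ, ContDiffOn ℝ ∞ (fun y => a i y μ) (P.chart i).target) ∧
  (∀ i, ∀ y ∈ (P.chart i).target, ∀ μ, (a i y μ).re = 0) ∧
  ∀ i j, ∀ y ∈ overlap P.chart i j,
    d1 (a i) y = pull2 (transition P.chart i j) (d1 (a j)) y

/-- The action `S[A, a, Ψ] = ∫_M Tr(λ Ψ†FΨ + μ da Ψ†Ψ + ν (Ψ†Ψ)²)`. -/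
def action (lam mu nu : ℝ) (P : U2Structure M) (a : ℕ → E4 → Fin 4 → ℂ) (A : ℕ → M2Form) : ℂ :=
  atlasIntegral P.chart fun i y =>
    (orient (P.Psi i) y : ℂ) * lagrangian lam mu nu (P.Psi i) (a i) (A i) y

/-- `A` satisfies the Euler-Lagrange equation for variations of the `SU(2)` connection: the action
is stationary under every variation with compact support in one of the gauge patches. -/
def IsStationary (lam mu nu : ℝ) (P : U2Structure M) (a : ℕ → E4 → Fin 4 → ℂ) (A : ℕ → M2Form) :
    Prop :=
  ∀ i, ∀ δ, IsVariation (P.chart i).target δ →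
    HasDerivAt (fun t : ℝ => actionChange lam mu nu (P.chart i).target (P.Psi i) (a i) (A i)
      (fun y μ => (t : ℂ) • δ y μ)) 0 0

/-- The functional `S[g, ω, a] = -λ ∫_M (dV (s + 2 μ̃ - 6) - 2 μ̃ ω ∧ i da)` of a metric `g`, a
`2`-form `ω` and an imaginary `1`-form `a`, given by components in the charts of an atlas.  Here
`dV` is the Riemannian volume and `M` is oriented by `ω ∧ ω`. -/
def gwAction (chart : ℕ → OpenPartialHomeomorph M E4) (lam mt : ℝ)
    (g om : ℕ → E4 → Matrix (Fin 4) (Fin 4) ℝ) (a : ℕ → E4 → Fin 4 → ℂ) : ℂ :=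
  -(lam : ℂ) * atlasIntegral chart fun i y =>
    ((Real.sqrt (g i y).det * (scalarCurv (g i) y + 2 * mt - 6) : ℝ) : ℂ)
      - 2 * (mt : ℂ) * ((Real.sign (w22 (om i y) (om i y)) : ℝ) : ℂ)
        * w22 (fun μ ν => (om i y μ ν : ℂ)) (fun μ ν => Complex.I * d1 (a i) y μ ν)

end Global

/-- `(g, ω)` is a smooth compatible pair on `V`: `g` is a Riemannian metric and `ω` a `2`-form with
`ω_{μα} g^{αβ} ω_{βν} = -g_{μν}`. -/
structure IsCompatiblePair (V : Set E4) (g om : E4 → Matrix (Fin 4) (Fin 4) ℝ) : Prop where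
  smooth_g : ∀ μ ν, ContDiffOn ℝ ∞ (fun y => g y μ ν) V
  smooth_om : ∀ μ ν, ContDiffOn ℝ ∞ (fun y => om y μ ν) V
  posDef : ∀ y ∈ V, (g y).PosDef
  skew : ∀ y ∈ V, (om y)ᵀ = -om y
  compat : ∀ y ∈ V, om y * (g y)⁻¹ * om y = -g y

end U2Gravity

end

/-!
Identify `ℝ⁴` with `ℂ²`.  Then `𝔰𝔬(4)` acts by `v ↦ A v + b v + c ε v̄`, with `A ∈ 𝔰𝔲(2)` the
anti-self-dual part and `b ∈ iℝ`, `c ∈ ℂ` the self-dual part, and vanishing torsion of the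
Levi-Civita connection reads `dΨ = -𝐰 ∧ Ψ - b ∧ Ψ - c ∧ ε Ψ̄`.  The form `Σ` is the trace-free part
of `Ψ ∧ Ψ†`, so `b` and `c` cancel from `dΣ`, leaving `dΣ + 𝐰 ∧ Σ - Σ ∧ 𝐰 = 0`.  Uniqueness is
linear algebra in the standard coframe: `B ∧ Σ - Σ ∧ B = 0` forces `B = 0` for `B` with values in
`𝔰𝔲(2)`.

The first variation is `d` of the compactly supported `3`-form `Tr(δA ∧ Σ)` plus
`Tr(δA ∧ (dΣ + A ∧ Σ - Σ ∧ A))`, up to the factor `-λ`, and testing against bump functions turns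
stationarity into the pointwise equation.  The curvature of `𝐰` is the anti-self-dual part of the
Riemann curvature in its `𝔰𝔬(4)` indices; paired with the anti-self-dual `Σ` it gives the scalar
curvature, since the remaining contraction vanishes by the first Bianchi identity.

The Hermitian form `∑_c Ψ_μ^c conj(Ψ_ν^c)` is `g - i ω`, so the pair `(g, ω)` determines `Ψ` up to
`U(2)`; compatibility makes `g - i ω` positive semidefinite of rank two, and two steps of the
Cholesky algorithm produce a smooth `Ψ`.
-/

namespace U2Gravity

section PartialDerivatives

variable {V : Type*} [NormedAddCommGroup V] [NormedSpace ℝ V] {U : Set E4} {y : E4}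

theorem pd_congr_of_eqOn {f g : E4 → V} (hU : IsOpen U) (h : Set.EqOn f g U) (hy : y ∈ U)
    (μ : Fin 4) : pd μ f y = pd μ g y := by
  simp only [pd, (Filter.eventuallyEq_of_mem (hU.mem_nhds hy) h).fderiv_eq]

theorem pd_const (μ : Fin 4) (c : V) (y : E4) : pd μ (fun _ => c) y = 0 := by
  simp [pd]

theorem pd_add {f g : E4 → V} (hf : DifferentiableAt ℝ f y) (hg : DifferentiableAt ℝ g y)
    (μ : Fin 4) : pd μ (fun z => f z + g z) y = pd μ f y + pd μ g y := by
  simp only [pd, fderiv_fun_add hf hg, add_apply]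

theorem pd_sub {f g : E4 → V} (hf : DifferentiableAt ℝ f y) (hg : DifferentiableAt ℝ g y)
    (μ : Fin 4) : pd μ (fun z => f z - g z) y = pd μ f y - pd μ g y := by
  simp only [pd, fderiv_fun_sub hf hg, sub_apply]

theorem pd_neg (f : E4 → V) (y : E4) (μ : Fin 4) : pd μ (fun z => -f z) y = -pd μ f y := by
  simp only [pd, fderiv_fun_neg, neg_apply]

theorem pd_sum {ι : Type*} (s : Finset ι) {f : ι → E4 → V}
    (hf : ∀ i ∈ s, DifferentiableAt ℝ (f i) y) (μ : Fin 4) :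
    pd μ (fun z => ∑ i ∈ s, f i z) y = ∑ i ∈ s, pd μ (f i) y := by
  simp only [pd, fderiv_fun_sum hf, sum_apply]

theorem pd_mul {𝔸 : Type*} [NormedRing 𝔸] [NormedAlgebra ℝ 𝔸] {f g : E4 → 𝔸}
    (hf : DifferentiableAt ℝ f y) (hg : DifferentiableAt ℝ g y) (μ : Fin 4) :
    pd μ (fun z => f z * g z) y = pd μ f y * g y + f y * pd μ g y := by
  simp [pd, fderiv_fun_mul' hf hg, add_comm]

theorem pd_smul {f : E4 → ℝ} {g : E4 → V} (hf : DifferentiableAt ℝ f y)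
    (hg : DifferentiableAt ℝ g y) (μ : Fin 4) :
    pd μ (fun z => f z • g z) y = pd μ f y • g y + f y • pd μ g y := by
  simp [pd, fderiv_fun_smul hf hg, add_comm]

theorem pd_clm_apply {W : Type*} [NormedAddCommGroup W] [NormedSpace ℝ W] (L : V →L[ℝ] W)
    {f : E4 → V} (hf : DifferentiableAt ℝ f y) (μ : Fin 4) :
    pd μ (fun z => L (f z)) y = L (pd μ f y) :=
  congrArg (· (EuclideanSpace.single μ 1)) (L.hasFDerivAt.comp y hf.hasFDerivAt).fderiv

theorem pd_star [StarAddMonoid V] [StarModule ℝ V] [ContinuousStar V] {f : E4 → V}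
    (hf : DifferentiableAt ℝ f y) (μ : Fin 4) :
    pd μ (fun z => star (f z)) y = star (pd μ f y) :=
  pd_clm_apply ((starL' ℝ : V ≃L[ℝ] V) : V →L[ℝ] V) hf μ

theorem pd_re {f : E4 → ℂ} (hf : DifferentiableAt ℝ f y) (μ : Fin 4) :
    pd μ (fun z => (f z).re) y = (pd μ f y).re :=
  pd_clm_apply Complex.reCLM hf μ

theorem pd_im {f : E4 → ℂ} (hf : DifferentiableAt ℝ f y) (μ : Fin 4) :
    pd μ (fun z => (f z).im) y = (pd μ f y).im :=
  pd_clm_apply Complex.imCLM hf μ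

theorem fderiv_eq_sum_pd (f : E4 → V) (y v : E4) : fderiv ℝ f y v = ∑ κ, v κ • pd κ f y := by
  have hv : v = ∑ κ, v κ • EuclideanSpace.single κ (1 : ℝ) := by
    ext i
    simp [Finset.sum_apply, Pi.single_apply]
  conv_lhs => rw [hv, map_sum]
  simp only [map_smul, pd]

theorem pd_comp {f : E4 → V} {τ : E4 → E4} (hf : DifferentiableAt ℝ f (τ y))
    (hτ : DifferentiableAt ℝ τ y) (μ : Fin 4) :
    pd μ (fun z => f (τ z)) y = ∑ κ, pd μ (fun z => τ z κ) y • pd κ f (τ y) := by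
  have hproj (κ : Fin 4) : pd μ (fun z => τ z κ) y = pd μ τ y κ :=
    pd_clm_apply (EuclideanSpace.proj κ : E4 →L[ℝ] ℝ) hτ μ
  simp only [hproj, ← fderiv_eq_sum_pd]
  exact congrArg (· (EuclideanSpace.single μ 1)) (fderiv_comp y hf hτ)

theorem pd_comm {f : E4 → V} (hf : ContDiffAt ℝ ∞ f y) (μ ν : Fin 4) :
    pd μ (pd ν f) y = pd ν (pd μ f) y := by
  have two_le : (2 : WithTop ℕ∞) ≤ ∞ := WithTop.coe_le_coe.2 le_top
  have hsymm : IsSymmSndFDerivAt ℝ f y :=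
    hf.isSymmSndFDerivAt (minSmoothness_of_isRCLikeNormedField.trans_le two_le)
  have hdiff : DifferentiableAt ℝ (fderiv ℝ f) y :=
    (hf.fderiv_right (m := 1) two_le).differentiableAt one_ne_zero
  have hsnd (μ ν : Fin 4) : pd μ (pd ν f) y
      = fderiv ℝ (fderiv ℝ f) y (EuclideanSpace.single μ 1) (EuclideanSpace.single ν 1) :=
    pd_clm_apply (ContinuousLinearMap.apply ℝ V (EuclideanSpace.single ν (1 : ℝ))) hdiff μ
  rw [hsnd, hsnd, hsymm]

theorem contDiffOn_pd {f : E4 → V} (hf : ContDiffOn ℝ ∞ f U) (hU : IsOpen U) (μ : Fin 4) :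
    ContDiffOn ℝ ∞ (pd μ f) U :=
  (hf.fderiv_of_isOpen hU (by simp)).clm_apply contDiffOn_const

theorem differentiableAt_of_contDiffOn {f : E4 → V} (hf : ContDiffOn ℝ ∞ f U) (hU : IsOpen U)
    (hy : y ∈ U) : DifferentiableAt ℝ f y :=
  (hf.contDiffAt (hU.mem_nhds hy)).differentiableAt (by simp)

end PartialDerivatives

section MatrixCalculus

variable {V : Type*} [NormedAddCommGroup V] [NormedSpace ℝ V] {𝔸 : Type*} [NormedRing 𝔸]
  [NormedAlgebra ℝ 𝔸] {l m n : Type*} {U : Set E4} {y : E4}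

/-- The partial derivative `∂_μ F` of a matrix-valued function, entry by entry, so that no norm on
matrices has to be chosen. -/
noncomputable def pdM (μ : Fin 4) (F : E4 → Matrix l n V) (y : E4) : Matrix l n V :=
  Matrix.of fun i j => pd μ (fun z => F z i j) y

/-- Smoothness of a matrix-valued function on `U`, entry by entry. -/
def SmoothOnM (U : Set E4) (F : E4 → Matrix l n V) : Prop :=
  ∀ i j, ContDiffOn ℝ ∞ (fun y => F y i j) U

/-- Differentiability of a matrix-valued function at `y`, entry by entry. -/
def DiffAtM (y : E4) (F : E4 → Matrix l n V) : Prop :=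
  ∀ i j, DifferentiableAt ℝ (fun z => F z i j) y

namespace SmoothOnM

theorem diffAtM {F : E4 → Matrix l n V} (h : SmoothOnM U F) (hU : IsOpen U) (hy : y ∈ U) :
    DiffAtM y F := fun i j => differentiableAt_of_contDiffOn (h i j) hU hy

theorem pdM {F : E4 → Matrix l n V} (h : SmoothOnM U F) (hU : IsOpen U) (μ : Fin 4) :
    SmoothOnM U (pdM μ F) := fun i j => contDiffOn_pd (h i j) hU μ

theorem congr {F G : E4 → Matrix l n V} (hF : SmoothOnM U F) (hGF : ∀ y, G y = F y) :
    SmoothOnM U G := by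
  rwa [funext hGF]

theorem add {F G : E4 → Matrix l n V} (hF : SmoothOnM U F) (hG : SmoothOnM U G) :
    SmoothOnM U (fun y => F y + G y) := fun i j => (hF i j).add (hG i j)

theorem sub {F G : E4 → Matrix l n V} (hF : SmoothOnM U F) (hG : SmoothOnM U G) :
    SmoothOnM U (fun y => F y - G y) := fun i j => (hF i j).sub (hG i j)

theorem mul [Fintype m] {F : E4 → Matrix l m 𝔸} {G : E4 → Matrix m n 𝔸} (hF : SmoothOnM U F)
    (hG : SmoothOnM U G) : SmoothOnM U (fun y => F y * G y) := fun i j => by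
  simp only [Matrix.mul_apply]
  exact ContDiffOn.sum fun k _ => (hF i k).mul (hG k j)

theorem transpose {F : E4 → Matrix l n V} (hF : SmoothOnM U F) :
    SmoothOnM U (fun y => (F y)ᵀ) := fun i j => hF j i

theorem conjTranspose [StarAddMonoid V] [StarModule ℝ V] [ContinuousStar V]
    {F : E4 → Matrix l n V} (hF : SmoothOnM U F) : SmoothOnM U (fun y => (F y)ᴴ) := fun i j =>
  ((starL' ℝ : V ≃L[ℝ] V) : V →L[ℝ] V).contDiff.comp_contDiffOn (hF j i)

theorem linearMap {l' n' W : Type*} [Finite l] [Finite n] [FiniteDimensional ℝ V]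
    [NormedAddCommGroup W] [NormedSpace ℝ W] {F : E4 → Matrix l n V} (hF : SmoothOnM U F)
    (L : Matrix l n V →ₗ[ℝ] Matrix l' n' W) : SmoothOnM U (fun y => L (F y)) := fun i j => by
  have := Fintype.ofFinite l
  have := Fintype.ofFinite n
  exact (LinearMap.toContinuousLinearMap
    (Matrix.entryLinearMap ℝ W i j ∘ₗ L : (l → n → V) →ₗ[ℝ] W)).contDiff.comp_contDiffOn
    (contDiffOn_pi.2 fun k => contDiffOn_pi.2 (hF k))

theorem contDiffOn_trace [Fintype n] {F : E4 → Matrix n n V} (hF : SmoothOnM U F) :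
    ContDiffOn ℝ ∞ (fun y => (F y).trace) U :=
  ContDiffOn.sum fun i _ => hF i i

variable {𝕜 : Type*} [RCLike 𝕜] [Fintype n] [DecidableEq n] {F : E4 → Matrix n n 𝕜}

theorem contDiffOn_det (hF : SmoothOnM U F) : ContDiffOn ℝ ∞ (fun y => (F y).det) U := by
  simp only [Matrix.det_apply']
  exact ContDiffOn.sum fun σ _ => contDiffOn_const.mul (contDiffOn_prod fun i _ => hF _ _)

theorem adjugate (hF : SmoothOnM U F) : SmoothOnM U (fun y => (F y).adjugate) := fun i j => by
  simp only [Matrix.adjugate_apply]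
  refine contDiffOn_det fun k l => ?_
  by_cases hk : k = j
  · simpa only [hk, Matrix.updateRow_self] using contDiffOn_const
  · simpa only [Matrix.updateRow_ne hk] using hF k l

theorem inv (hF : SmoothOnM U F) (hdet : ∀ y ∈ U, (F y).det ≠ 0) :
    SmoothOnM U (fun y => (F y)⁻¹) := fun i j =>
  ((hF.contDiffOn_det.inv hdet).mul (hF.adjugate i j)).congr fun y _ => by
    simp only [Matrix.inv_def, Ring.inverse_eq_inv', Matrix.smul_apply, smul_eq_mul, Pi.inv_apply]

end SmoothOnM

namespace DiffAtM

theorem conjTranspose [StarAddMonoid V] [StarModule ℝ V] [ContinuousStar V]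
    {F : E4 → Matrix l n V} (hF : DiffAtM y F) : DiffAtM y (fun z => (F z)ᴴ) := fun i j =>
  (hF j i).star

theorem mul [Fintype m] {F : E4 → Matrix l m 𝔸} {G : E4 → Matrix m n 𝔸} (hF : DiffAtM y F)
    (hG : DiffAtM y G) : DiffAtM y (fun z => F z * G z) := fun i j => by
  simp only [Matrix.mul_apply]
  exact DifferentiableAt.fun_sum fun k _ => (hF i k).mul (hG k j)

end DiffAtM

theorem pdM_congr_of_eqOn {F G : E4 → Matrix l n V} (hU : IsOpen U) (h : Set.EqOn F G U)
    (hy : y ∈ U) (μ : Fin 4) : pdM μ F y = pdM μ G y := by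
  ext i j
  exact pd_congr_of_eqOn hU (fun z hz => congrFun₂ (h hz) i j) hy μ

theorem pdM_const (C : Matrix l n V) (y : E4) (μ : Fin 4) : pdM μ (fun _ => C) y = 0 := by
  ext i j
  exact pd_const μ _ y

theorem pdM_sub {F G : E4 → Matrix l n V} (hF : DiffAtM y F) (hG : DiffAtM y G) (μ : Fin 4) :
    pdM μ (fun z => F z - G z) y = pdM μ F y - pdM μ G y := by
  ext i j
  exact pd_sub (hF i j) (hG i j) μ

theorem pdM_neg (F : E4 → Matrix l n V) (y : E4) (μ : Fin 4) :
    pdM μ (fun z => -F z) y = -pdM μ F y := by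
  ext i j
  exact pd_neg _ y μ

theorem pdM_mul [Fintype m] {F : E4 → Matrix l m 𝔸} {G : E4 → Matrix m n 𝔸} (hF : DiffAtM y F)
    (hG : DiffAtM y G) (μ : Fin 4) :
    pdM μ (fun z => F z * G z) y = pdM μ F y * G y + F y * pdM μ G y := by
  ext i j
  simp only [pdM, Matrix.of_apply, Matrix.mul_apply, Matrix.add_apply]
  rw [pd_sum Finset.univ (f := fun k z => F z i k * G z k j)
    (fun k _ => (hF i k).mul (hG k j)), ← Finset.sum_add_distrib]
  exact Finset.sum_congr rfl fun k _ => pd_mul (hF i k) (hG k j) μ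

theorem pdM_linearMap {l' n' W : Type*} [Finite l] [Finite n] [FiniteDimensional ℝ V]
    [NormedAddCommGroup W] [NormedSpace ℝ W] (L : Matrix l n V →ₗ[ℝ] Matrix l' n' W)
    {F : E4 → Matrix l n V} (hF : DiffAtM y F) (μ : Fin 4) :
    pdM μ (fun z => L (F z)) y = L (pdM μ F y) := by
  have := Fintype.ofFinite l
  have := Fintype.ofFinite n
  ext i j
  let f : E4 → l → n → V := F
  have hrow (k : l) : DifferentiableAt ℝ (fun z => f z k) y := differentiableAt_pi.2 (hF k)
  have hf : DifferentiableAt ℝ f y := differentiableAt_pi.2 hrow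
  have hpd : pd μ f y = pdM μ F y := by
    funext k m
    exact (pd_clm_apply ((ContinuousLinearMap.proj (R := ℝ) (φ := fun _ : n => V) m).comp
      (ContinuousLinearMap.proj (R := ℝ) (φ := fun _ : l => n → V) k)) hf μ).symm
  rw [← hpd]
  exact pd_clm_apply (LinearMap.toContinuousLinearMap
    (Matrix.entryLinearMap ℝ W i j ∘ₗ L : (l → n → V) →ₗ[ℝ] W)) hf μ

theorem pdM_transpose (F : E4 → Matrix l n V) (y : E4) (μ : Fin 4) :
    pdM μ (fun z => (F z)ᵀ) y = (pdM μ F y)ᵀ := rfl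

theorem pdM_conjTranspose [StarAddMonoid V] [StarModule ℝ V] [ContinuousStar V]
    {F : E4 → Matrix l n V} (hF : DiffAtM y F) (μ : Fin 4) :
    pdM μ (fun z => (F z)ᴴ) y = (pdM μ F y)ᴴ := by
  ext i j
  exact pd_star (hF j i) μ

theorem pd_trace [Fintype n] {F : E4 → Matrix n n V} (hF : DiffAtM y F) (μ : Fin 4) :
    pd μ (fun z => (F z).trace) y = (pdM μ F y).trace :=
  pd_sum Finset.univ (fun i _ => hF i i) μ

theorem pdM_comm {F : E4 → Matrix l n V} (h : SmoothOnM U F) (hU : IsOpen U) (hy : y ∈ U)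
    (μ ν : Fin 4) : pdM μ (pdM ν F) y = pdM ν (pdM μ F) y := by
  ext i j
  exact pd_comm ((h i j).contDiffAt (hU.mem_nhds hy)) μ ν

end MatrixCalculus

section Christoffel

variable {U : Set E4} {g : E4 → Matrix (Fin 4) (Fin 4) ℝ} {y : E4}

/-- The Christoffel symbols as a matrix-valued `1`-form: `(Γ_μ)^ν_ρ = Γ^ν_{μρ}`. -/
noncomputable def christoffelMatrix (g : E4 → Matrix (Fin 4) (Fin 4) ℝ) (μ : Fin 4) (y : E4) :
    Matrix (Fin 4) (Fin 4) ℝ :=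
  Matrix.of fun ν ρ => christoffel g ν μ ρ y

/-- The Christoffel symbols of the first kind, `Γ_{σμν}`, as the `σν` entry of a matrix. -/
noncomputable def christoffelFirst (g : E4 → Matrix (Fin 4) (Fin 4) ℝ) (μ : Fin 4) (y : E4) :
    Matrix (Fin 4) (Fin 4) ℝ :=
  Matrix.of fun σ ν => (1 / 2) * (pd μ (fun z => g z σ ν) y + pd ν (fun z => g z σ μ) y
    - pd σ (fun z => g z μ ν) y)

theorem christoffelMatrix_eq_inv_mul (g : E4 → Matrix (Fin 4) (Fin 4) ℝ) (μ : Fin 4) (y : E4) :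
    christoffelMatrix g μ y = (g y)⁻¹ * christoffelFirst g μ y := by
  ext ν ρ
  simp only [christoffelMatrix, christoffelFirst, christoffel, Matrix.mul_apply, Matrix.of_apply,
    Finset.mul_sum]
  exact Finset.sum_congr rfl fun σ _ => by ring

theorem christoffel_symm (hg : ∀ z, (g z).IsSymm) (ρ μ ν : Fin 4) :
    christoffel g ρ μ ν = christoffel g ρ ν μ := by
  funext y
  have hswap : (fun z => g z μ ν) = fun z => g z ν μ := funext fun z => (hg z).apply ν μ
  simp only [christoffel, hswap]
  congr 1
  exact Finset.sum_congr rfl fun σ _ => by ring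

theorem pdM_eq_christoffelMatrix (hg : ∀ z, (g z).IsSymm) (hdet : (g y).det ≠ 0) (μ : Fin 4) :
    pdM μ g y = (christoffelMatrix g μ y)ᵀ * g y + g y * christoffelMatrix g μ y := by
  have hlower : g y * christoffelMatrix g μ y = christoffelFirst g μ y := by
    rw [christoffelMatrix_eq_inv_mul, Matrix.mul_nonsing_inv_cancel_left _ _ hdet.isUnit]
  have hlower' : (christoffelMatrix g μ y)ᵀ * g y = (christoffelFirst g μ y)ᵀ := by
    rw [← hlower, Matrix.transpose_mul, hg y]
  have hswap (i j : Fin 4) : (fun z => g z i j) = fun z => g z j i :=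
    funext fun z => (hg z).apply j i
  rw [hlower, hlower']
  ext i j
  simp only [pdM, christoffelFirst, Matrix.of_apply, Matrix.add_apply, Matrix.transpose_apply]
  rw [hswap j i, hswap j μ, hswap i μ]
  ring

theorem smoothOnM_christoffelMatrix (hg : SmoothOnM U g) (hdet : ∀ y ∈ U, (g y).det ≠ 0)
    (hU : IsOpen U) (μ : Fin 4) : SmoothOnM U (christoffelMatrix g μ) := by
  have hfirst : SmoothOnM U (christoffelFirst g μ) := fun i j =>
    contDiffOn_const.mul (((contDiffOn_pd (hg _ _) hU _).add (contDiffOn_pd (hg _ _) hU _)).sub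
      (contDiffOn_pd (hg _ _) hU _))
  exact ((hg.inv hdet).mul hfirst).congr (christoffelMatrix_eq_inv_mul g μ)

/-- The Riemann tensor as a matrix-valued `2`-form: `(R_{μν})^ρ_σ = R^ρ_{σμν}`. -/
noncomputable def riemannMatrix (g : E4 → Matrix (Fin 4) (Fin 4) ℝ) (μ ν : Fin 4) (y : E4) :
    Matrix (Fin 4) (Fin 4) ℝ :=
  Matrix.of fun ρ σ => riemann g ρ σ μ ν y

theorem riemannMatrix_eq (g : E4 → Matrix (Fin 4) (Fin 4) ℝ) (μ ν : Fin 4) (y : E4) :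
    riemannMatrix g μ ν y = pdM μ (christoffelMatrix g ν) y - pdM ν (christoffelMatrix g μ) y
      + (christoffelMatrix g μ y * christoffelMatrix g ν y
        - christoffelMatrix g ν y * christoffelMatrix g μ y) := by
  ext ρ σ
  simp only [riemannMatrix, riemann, Matrix.of_apply, Matrix.add_apply, Matrix.sub_apply,
    Matrix.mul_apply, ← Finset.sum_sub_distrib]
  rfl

theorem riemann_cyclic (hg : ∀ z, (g z).IsSymm) (ρ σ μ ν : Fin 4) (y : E4) :
    riemann g ρ σ μ ν y + riemann g ρ μ ν σ y + riemann g ρ ν σ μ y = 0 := by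
  have hsymm := christoffel_symm hg
  simp only [riemann, hsymm ρ ν σ, hsymm ρ μ σ, hsymm ρ ν μ, Finset.sum_sub_distrib,
    hsymm _ ν σ, hsymm _ μ σ, hsymm _ ν μ]
  ring

end Christoffel

section LeviCivita

/-- `Ψ` is a smooth `ℂ²`-valued coframe on the open set `U`: one gauge patch of a
`U(2)`-structure. -/
structure IsSmoothCoframe (U : Set E4) (Ψ : C2Form) : Prop where
  isOpen : IsOpen U
  smooth : ∀ μ c, ContDiffOn ℝ ∞ (fun y => Ψ y μ c 0) U
  nondeg : ∀ y ∈ U, (coframe Ψ y).det ≠ 0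

theorem metric_eq_transpose_mul (Ψ : C2Form) (y : E4) :
    metric Ψ y = (coframe Ψ y)ᵀ * coframe Ψ y := by
  ext μ ν
  simp [metric, coframe, Matrix.mul_apply, Fin.sum_univ_four]
  ring

theorem isSymm_metric (Ψ : C2Form) (y : E4) : (metric Ψ y).IsSymm := by
  rw [metric_eq_transpose_mul]
  exact Matrix.isSymm_transpose_mul_self _

theorem det_metric (Ψ : C2Form) (y : E4) : (metric Ψ y).det = (coframe Ψ y).det ^ 2 := by
  rw [metric_eq_transpose_mul, Matrix.det_mul, Matrix.det_transpose, sq]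

theorem leviCivita_eq_mul (Ψ : C2Form) (y : E4) (μ : Fin 4) :
    leviCivita Ψ y μ = coframe Ψ y * (pdM μ (fun z => (coframe Ψ z)⁻¹) y
      + christoffelMatrix (metric Ψ) μ y * (coframe Ψ y)⁻¹) := by
  ext I J
  simp only [leviCivita, Matrix.of_apply, Matrix.mul_apply, Matrix.add_apply]
  rfl

/-- The curvature of the Levi-Civita connection as a matrix-valued `2`-form. -/
noncomputable def lcCurvMatrix (Ψ : C2Form) (y : E4) (μ ν : Fin 4) : Matrix (Fin 4) (Fin 4) ℝ :=
  Matrix.of fun I J => lcCurv Ψ y I J μ ν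

theorem lcCurvMatrix_eq (Ψ : C2Form) (y : E4) (μ ν : Fin 4) :
    lcCurvMatrix Ψ y μ ν
      = pdM μ (fun z => leviCivita Ψ z ν) y - pdM ν (fun z => leviCivita Ψ z μ) y
        + (leviCivita Ψ y μ * leviCivita Ψ y ν - leviCivita Ψ y ν * leviCivita Ψ y μ) := by
  ext I J
  simp only [lcCurvMatrix, lcCurv, w11, d1, pdM, Matrix.of_apply, Matrix.add_apply,
    Matrix.sub_apply, Matrix.mul_apply, Finset.sum_sub_distrib]

theorem lcCurvMatrix_swap (Ψ : C2Form) (y : E4) (μ ν : Fin 4) :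
    lcCurvMatrix Ψ y μ ν = -lcCurvMatrix Ψ y ν μ := by
  rw [lcCurvMatrix_eq, lcCurvMatrix_eq]
  abel

namespace IsSmoothCoframe

variable {U : Set E4} {Ψ : C2Form} {y : E4} (h : IsSmoothCoframe U Ψ)
include h

theorem smoothOnM_coframe : SmoothOnM U (coframe Ψ) := by
  intro I μ
  have hre (c : Fin 2) : ContDiffOn ℝ ∞ (fun y => (Ψ y μ c 0).re) U :=
    Complex.reCLM.contDiff.comp_contDiffOn (h.smooth μ c)
  have him (c : Fin 2) : ContDiffOn ℝ ∞ (fun y => (Ψ y μ c 0).im) U :=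
    Complex.imCLM.contDiff.comp_contDiffOn (h.smooth μ c)
  fin_cases I
  exacts [hre 0, him 0, hre 1, him 1]

theorem smoothOnM_inv_coframe : SmoothOnM U (fun y => (coframe Ψ y)⁻¹) :=
  h.smoothOnM_coframe.inv h.nondeg

theorem smoothOnM_metric : SmoothOnM U (metric Ψ) :=
  (h.smoothOnM_coframe.transpose.mul h.smoothOnM_coframe).congr (metric_eq_transpose_mul Ψ)

theorem det_metric_ne_zero (hy : y ∈ U) : (metric Ψ y).det ≠ 0 := by
  rw [det_metric]
  exact pow_ne_zero _ (h.nondeg y hy)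

theorem smoothOnM_christoffelMatrix (μ : Fin 4) : SmoothOnM U (christoffelMatrix (metric Ψ) μ) :=
  U2Gravity.smoothOnM_christoffelMatrix h.smoothOnM_metric (fun _ => h.det_metric_ne_zero)
    h.isOpen μ

theorem smoothOnM_leviCivita (μ : Fin 4) : SmoothOnM U (fun y => leviCivita Ψ y μ) :=
  (h.smoothOnM_coframe.mul ((h.smoothOnM_inv_coframe.pdM h.isOpen μ).add
    ((h.smoothOnM_christoffelMatrix μ).mul h.smoothOnM_inv_coframe))).congr
      fun y => leviCivita_eq_mul Ψ y μ

theorem coframe_mul_inv (hy : y ∈ U) : coframe Ψ y * (coframe Ψ y)⁻¹ = 1 :=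
  Matrix.mul_nonsing_inv _ (h.nondeg y hy).isUnit

theorem inv_mul_coframe (hy : y ∈ U) : (coframe Ψ y)⁻¹ * coframe Ψ y = 1 :=
  Matrix.nonsing_inv_mul _ (h.nondeg y hy).isUnit

theorem isUnit_coframe (hy : y ∈ U) : IsUnit (coframe Ψ y) :=
  (Matrix.isUnit_iff_isUnit_det _).2 (h.nondeg y hy).isUnit

theorem coframe_mul_pdM_inv (hy : y ∈ U) (μ : Fin 4) :
    coframe Ψ y * pdM μ (fun z => (coframe Ψ z)⁻¹) y
      = -(pdM μ (coframe Ψ) y * (coframe Ψ y)⁻¹) := by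
  have hleibniz := pdM_mul (h.smoothOnM_coframe.diffAtM h.isOpen hy)
    (h.smoothOnM_inv_coframe.diffAtM h.isOpen hy) μ
  rw [pdM_congr_of_eqOn h.isOpen (fun z hz => h.coframe_mul_inv hz) hy, pdM_const] at hleibniz
  exact eq_neg_of_add_eq_zero_right hleibniz.symm

theorem leviCivita_mul_coframe (hy : y ∈ U) (μ : Fin 4) :
    leviCivita Ψ y μ * coframe Ψ y
      = coframe Ψ y * christoffelMatrix (metric Ψ) μ y - pdM μ (coframe Ψ) y := by
  rw [leviCivita_eq_mul, Matrix.mul_add, h.coframe_mul_pdM_inv hy, Matrix.add_mul, Matrix.neg_mul]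
  simp only [Matrix.mul_assoc, h.inv_mul_coframe hy, Matrix.mul_one]
  abel

theorem pdM_metric_eq_coframe (hy : y ∈ U) (μ : Fin 4) :
    pdM μ (metric Ψ) y
      = (pdM μ (coframe Ψ) y)ᵀ * coframe Ψ y + (coframe Ψ y)ᵀ * pdM μ (coframe Ψ) y := by
  rw [funext (metric_eq_transpose_mul Ψ),
    pdM_mul (h.smoothOnM_coframe.transpose.diffAtM h.isOpen hy)
      (h.smoothOnM_coframe.diffAtM h.isOpen hy), pdM_transpose]

theorem transpose_leviCivita (hy : y ∈ U) (μ : Fin 4) :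
    (leviCivita Ψ y μ)ᵀ = -leviCivita Ψ y μ := by
  have hcompat := pdM_eq_christoffelMatrix (isSymm_metric Ψ) (h.det_metric_ne_zero hy) μ
  rw [h.pdM_metric_eq_coframe hy, metric_eq_transpose_mul] at hcompat
  have hwe := h.leviCivita_mul_coframe hy μ
  have he := h.isUnit_coframe hy
  set e := coframe Ψ y
  set w := leviCivita Ψ y μ
  have hconj : eᵀ * ((wᵀ + w) * e) = 0 := calc
    eᵀ * ((wᵀ + w) * e) = (w * e)ᵀ * e + eᵀ * (w * e) := by
      rw [Matrix.add_mul, Matrix.mul_add, Matrix.transpose_mul, Matrix.mul_assoc]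
    _ = 0 := by
      rw [hwe, Matrix.transpose_sub, Matrix.transpose_mul, Matrix.sub_mul, Matrix.mul_sub,
        Matrix.mul_assoc, ← Matrix.mul_assoc eᵀ, sub_add_sub_comm, ← hcompat, sub_self]
  rw [((Matrix.isUnit_transpose _).2 he).mul_right_eq_zero, he.mul_left_eq_zero] at hconj
  exact eq_neg_of_add_eq_zero_left hconj

theorem d1_coframe (hy : y ∈ U) (I μ ν : Fin 4) :
    d1 (fun z => coframe Ψ z I) y μ ν
      = (leviCivita Ψ y ν * coframe Ψ y) I μ - (leviCivita Ψ y μ * coframe Ψ y) I ν := by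
  have hsymm : (coframe Ψ y * christoffelMatrix (metric Ψ) μ y) I ν
      = (coframe Ψ y * christoffelMatrix (metric Ψ) ν y) I μ := by
    simp only [Matrix.mul_apply, christoffelMatrix, Matrix.of_apply,
      christoffel_symm (isSymm_metric Ψ) _ μ ν]
  rw [h.leviCivita_mul_coframe hy, h.leviCivita_mul_coframe hy, Matrix.sub_apply,
    Matrix.sub_apply, hsymm, sub_sub_sub_cancel_left]
  rfl

theorem transpose_lcCurvMatrix (hy : y ∈ U) (μ ν : Fin 4) :
    (lcCurvMatrix Ψ y μ ν)ᵀ = -lcCurvMatrix Ψ y μ ν := by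
  have hpd (μ ν : Fin 4) :
      (pdM μ (fun z => leviCivita Ψ z ν) y)ᵀ = -pdM μ (fun z => leviCivita Ψ z ν) y := by
    rw [← pdM_transpose, pdM_congr_of_eqOn h.isOpen (fun z hz => h.transpose_leviCivita hz ν) hy,
      pdM_neg]
  simp only [lcCurvMatrix_eq, Matrix.transpose_add, Matrix.transpose_sub, Matrix.transpose_mul,
    hpd, h.transpose_leviCivita hy, Matrix.neg_mul, Matrix.mul_neg, neg_neg]
  abel

theorem pdM_leviCivita_mul_coframe (hy : y ∈ U) (μ ν : Fin 4) :
    pdM μ (fun z => leviCivita Ψ z ν) y * coframe Ψ y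
      = pdM μ (coframe Ψ) y * christoffelMatrix (metric Ψ) ν y
        + coframe Ψ y * pdM μ (christoffelMatrix (metric Ψ) ν) y
        - pdM μ (pdM ν (coframe Ψ)) y - leviCivita Ψ y ν * pdM μ (coframe Ψ) y := by
  have he := h.smoothOnM_coframe
  have hΓ := h.smoothOnM_christoffelMatrix ν
  have hleibniz := pdM_mul ((h.smoothOnM_leviCivita ν).diffAtM h.isOpen hy)
    (he.diffAtM h.isOpen hy) μ
  rw [pdM_congr_of_eqOn h.isOpen (fun z hz => h.leviCivita_mul_coframe hz ν) hy,
    pdM_sub ((he.mul hΓ).diffAtM h.isOpen hy) ((he.pdM h.isOpen ν).diffAtM h.isOpen hy),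
    pdM_mul (he.diffAtM h.isOpen hy) (hΓ.diffAtM h.isOpen hy)] at hleibniz
  exact eq_sub_of_add_eq hleibniz.symm

theorem lcCurvMatrix_mul_coframe (hy : y ∈ U) (μ ν : Fin 4) :
    lcCurvMatrix Ψ y μ ν * coframe Ψ y = coframe Ψ y * riemannMatrix (metric Ψ) μ ν y := by
  have hww (μ ν : Fin 4) : leviCivita Ψ y μ * leviCivita Ψ y ν * coframe Ψ y
      = coframe Ψ y * (christoffelMatrix (metric Ψ) μ y * christoffelMatrix (metric Ψ) ν y)
        - pdM μ (coframe Ψ) y * christoffelMatrix (metric Ψ) ν y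
        - leviCivita Ψ y μ * pdM ν (coframe Ψ) y := by
    rw [Matrix.mul_assoc, h.leviCivita_mul_coframe hy, Matrix.mul_sub, ← Matrix.mul_assoc,
      h.leviCivita_mul_coframe hy, Matrix.sub_mul, Matrix.mul_assoc]
  simp only [lcCurvMatrix_eq, riemannMatrix_eq, Matrix.add_mul, Matrix.sub_mul, hww,
    h.pdM_leviCivita_mul_coframe hy, pdM_comm h.smoothOnM_coframe h.isOpen hy μ ν, Matrix.mul_add,
    Matrix.mul_sub]
  abel

theorem lcCurvMatrix_bianchi (hy : y ∈ U) (I μ ν ρ : Fin 4) :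
    (lcCurvMatrix Ψ y μ ν * coframe Ψ y) I ρ + (lcCurvMatrix Ψ y ν ρ * coframe Ψ y) I μ
      + (lcCurvMatrix Ψ y ρ μ * coframe Ψ y) I ν = 0 := by
  rw [h.lcCurvMatrix_mul_coframe hy, h.lcCurvMatrix_mul_coframe hy, h.lcCurvMatrix_mul_coframe hy]
  simp only [Matrix.mul_apply, riemannMatrix, Matrix.of_apply, ← Finset.sum_add_distrib, ← mul_add]
  refine Finset.sum_eq_zero fun κ _ => mul_eq_zero_of_right _ ?_
  linear_combination riemann_cyclic (isSymm_metric Ψ) κ ρ μ ν y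

end IsSmoothCoframe

end LeviCivita

section TwoByTwo

theorem matrix_ext_two {R : Type*} {X Y : Matrix (Fin 2) (Fin 2) R} (h00 : X 0 0 = Y 0 0)
    (h01 : X 0 1 = Y 0 1) (h10 : X 1 0 = Y 1 0) (h11 : X 1 1 = Y 1 1) : X = Y := by
  ext i j
  fin_cases i <;> fin_cases j <;> assumption

theorem isSu2_iff_entries {X : Matrix (Fin 2) (Fin 2) ℂ} :
    IsSu2 X ↔ X 1 1 = -X 0 0 ∧ star (X 0 0) = -X 0 0 ∧ X 1 0 = -star (X 0 1) := by
  refine ⟨fun ⟨hskew, htrace⟩ => ?_, fun ⟨h11, h00, h10⟩ => ⟨matrix_ext_two ?_ ?_ ?_ ?_, ?_⟩⟩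
  · rw [Matrix.trace_fin_two] at htrace
    exact ⟨eq_neg_of_add_eq_zero_right htrace, congrFun₂ hskew 0 0,
      neg_eq_iff_eq_neg.1 (congrFun₂ hskew 1 0).symm⟩
  · exact h00
  · simp [h10]
  · simp [h10]
  · simpa [h11, neg_eq_iff_eq_neg] using h00
  · rw [Matrix.trace_fin_two, h11, add_neg_cancel]

/-- `𝔰𝔲(2)` as a real vector space of complex matrices, so that the predicate `IsSu2` inherits the
closure properties of a subspace. -/
def su2 : Submodule ℝ (Matrix (Fin 2) (Fin 2) ℂ) where
  carrier := {X | IsSu2 X}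
  zero_mem' := ⟨by simp, by simp⟩
  add_mem' hX hY := ⟨by rw [Matrix.conjTranspose_add, hX.1, hY.1, neg_add], by
    rw [Matrix.trace_add, hX.2, hY.2, add_zero]⟩
  smul_mem' r X hX := ⟨by rw [Matrix.conjTranspose_smul, hX.1, star_trivial, smul_neg], by
    rw [Matrix.trace_smul, hX.2, smul_zero]⟩

/-- The antilinear map `v ↦ ε v̄` of `ℂ²` that commutes with `SU(2)`. -/
def epsConj : Matrix (Fin 2) (Fin 1) ℂ →ₗ[ℝ] Matrix (Fin 2) (Fin 1) ℂ where
  toFun v := !![star (v 1 0); -star (v 0 0)]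
  map_add' v w := by ext i j; fin_cases i <;> fin_cases j <;> simp [add_comm]
  map_smul' r v := by ext i j; fin_cases i <;> fin_cases j <;> simp

/-- The action `v ↦ A v + b v + c ε v̄` on `ℂ² ≅ ℝ⁴`.  With `A ∈ 𝔰𝔲(2)` the anti-self-dual part, and
with the self-dual part given by an imaginary `b` and a complex `c`, this parametrises `𝔰𝔬(4)`. -/
noncomputable def so4Act : Matrix (Fin 2) (Fin 2) ℂ × ℂ × ℂ →ₗ[ℝ]
    Matrix (Fin 2) (Fin 1) ℂ →ₗ[ℝ] Matrix (Fin 2) (Fin 1) ℂ :=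
  LinearMap.mk₂ ℝ (fun p v => p.1 * v + p.2.1 • v + p.2.2 • epsConj v)
    (fun p q v => by simp only [Prod.fst_add, Prod.snd_add, Matrix.add_mul, add_smul]; abel)
    (fun r p v => by
      simp only [Prod.smul_fst, Prod.smul_snd, Matrix.smul_mul, smul_assoc, smul_add])
    (fun p v w => by simp only [Matrix.mul_add, smul_add, map_add]; abel)
    (fun r p v => by
      simp only [Matrix.mul_smul, map_smul, smul_add, smul_comm r])

theorem so4Act_apply (A : Matrix (Fin 2) (Fin 2) ℂ) (b c : ℂ) (v : Matrix (Fin 2) (Fin 1) ℂ) :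
    so4Act (A, b, c) v = A * v + b • v + c • epsConj v := rfl

/-- The real-bilinear map `(v, w) ↦ v w† - ½ (w† v) 𝕀` on `ℂ²`, whose antisymmetrisation on the
components of `Ψ` is the form `Σ`. -/
noncomputable def traceFreeOuter : Matrix (Fin 2) (Fin 1) ℂ →ₗ[ℝ] Matrix (Fin 2) (Fin 1) ℂ →ₗ[ℝ]
    Matrix (Fin 2) (Fin 2) ℂ :=
  LinearMap.mk₂ ℝ (fun v w => traceFree (v * wᴴ))
    (fun v v' w => by
      simp only [traceFree, Matrix.add_mul, Matrix.trace_add, add_div, add_smul]; abel)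
    (fun r v w => by
      simp only [traceFree, Matrix.smul_mul, Matrix.trace_smul, smul_sub, smul_assoc,
        smul_div_assoc])
    (fun v w w' => by
      simp only [traceFree, Matrix.conjTranspose_add, Matrix.mul_add, Matrix.trace_add, add_div,
        add_smul]
      abel)
    (fun r v w => by
      simp only [traceFree, Matrix.conjTranspose_smul, star_trivial, Matrix.mul_smul,
        Matrix.trace_smul, smul_sub, smul_assoc, smul_div_assoc])

theorem traceFreeOuter_apply (v w : Matrix (Fin 2) (Fin 1) ℂ) :
    traceFreeOuter v w = traceFree (v * wᴴ) := rfl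

theorem traceFreeOuter_smul_left (c : ℂ) (v w : Matrix (Fin 2) (Fin 1) ℂ) :
    traceFreeOuter (c • v) w = c • traceFreeOuter v w := by
  simp only [traceFreeOuter_apply, traceFree, Matrix.smul_mul, Matrix.trace_smul, smul_sub,
    smul_assoc, smul_div_assoc]

theorem traceFreeOuter_smul_right (c : ℂ) (v w : Matrix (Fin 2) (Fin 1) ℂ) :
    traceFreeOuter v (c • w) = star c • traceFreeOuter v w := by
  simp only [traceFreeOuter_apply, traceFree, Matrix.conjTranspose_smul, Matrix.mul_smul,
    Matrix.trace_smul, smul_sub, smul_assoc, smul_div_assoc]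

theorem commutator_traceFreeOuter {A : Matrix (Fin 2) (Fin 2) ℂ} (hA : Aᴴ = -A)
    (v w : Matrix (Fin 2) (Fin 1) ℂ) :
    A * traceFreeOuter v w - traceFreeOuter v w * A
      = traceFreeOuter (A * v) w + traceFreeOuter v (A * w) := by
  have htrace : (v * (wᴴ * A)).trace = (A * (v * wᴴ)).trace := by
    rw [← Matrix.mul_assoc, Matrix.trace_mul_comm]
  simp only [traceFreeOuter_apply, traceFree, Matrix.conjTranspose_mul, hA,
    Matrix.mul_neg, Matrix.trace_neg, Matrix.mul_assoc, htrace, Matrix.mul_sub, Matrix.sub_mul,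
    Matrix.mul_smul, Matrix.smul_mul, Matrix.mul_one, Matrix.one_mul, neg_div, neg_smul]
  abel

theorem traceFreeOuter_epsConj_comm (v w : Matrix (Fin 2) (Fin 1) ℂ) :
    traceFreeOuter (epsConj v) w = traceFreeOuter (epsConj w) v := by
  apply matrix_ext_two <;>
    simp [traceFreeOuter_apply, traceFree, epsConj, Matrix.vecMul, dotProduct,
      Matrix.trace_fin_two] <;>
    ring

theorem traceFreeOuter_conjTranspose (v w : Matrix (Fin 2) (Fin 1) ℂ) :
    (traceFreeOuter v w)ᴴ = traceFreeOuter w v := by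
  have htrace : star ((v * wᴴ).trace / 2) = (w * vᴴ).trace / 2 := by
    rw [star_div₀, ← Matrix.trace_conjTranspose, Matrix.conjTranspose_mul,
      Matrix.conjTranspose_conjTranspose, star_ofNat]
  simp only [traceFreeOuter_apply, traceFree, Matrix.conjTranspose_sub, Matrix.conjTranspose_smul,
    htrace, Matrix.conjTranspose_mul, Matrix.conjTranspose_conjTranspose, Matrix.conjTranspose_one]

theorem traceFreeOuter_epsConj_comm' (v w : Matrix (Fin 2) (Fin 1) ℂ) :
    traceFreeOuter v (epsConj w) = traceFreeOuter w (epsConj v) := by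
  rw [← traceFreeOuter_conjTranspose, traceFreeOuter_epsConj_comm, traceFreeOuter_conjTranspose]

theorem trace_traceFree (X : Matrix (Fin 2) (Fin 2) ℂ) : (traceFree X).trace = 0 := by
  simp [traceFree]

end TwoByTwo

section EulerLagrangeForm

variable {Ψ : C2Form} {y : E4}

theorem sigma_eq (Ψ : C2Form) (y : E4) (μ ν : Fin 4) :
    sigma Ψ y μ ν = traceFreeOuter (Ψ y μ) (Ψ y ν) - traceFreeOuter (Ψ y ν) (Ψ y μ) := by
  have htrace (v w : Matrix (Fin 2) (Fin 1) ℂ) : (v * wᴴ).trace = (wᴴ * v) 0 0 := by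
    rw [Matrix.trace_mul_comm, Matrix.trace_fin_one]
  simp only [sigma, dagPsi, w11, dag, traceFreeOuter_apply, traceFree, htrace, Matrix.sub_apply]
  module

theorem sigma_swap (Ψ : C2Form) (y : E4) (μ ν : Fin 4) : sigma Ψ y μ ν = -sigma Ψ y ν μ := by
  rw [sigma_eq, sigma_eq, neg_sub]

theorem isSu2_sigma (Ψ : C2Form) (y : E4) (μ ν : Fin 4) : IsSu2 (sigma Ψ y μ ν) := by
  rw [sigma_eq]
  refine ⟨?_, ?_⟩
  · rw [Matrix.conjTranspose_sub, traceFreeOuter_conjTranspose, traceFreeOuter_conjTranspose,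
      neg_sub]
  · simp only [traceFreeOuter_apply, Matrix.trace_sub, trace_traceFree, sub_self]

theorem pdM_traceFree {F : E4 → Matrix (Fin 2) (Fin 2) ℂ} (hF : DiffAtM y F) (κ : Fin 4) :
    pdM κ (fun z => traceFree (F z)) y = traceFree (pdM κ F y) := by
  have htrace : DifferentiableAt ℝ (fun z => (F z).trace) y :=
    DifferentiableAt.fun_sum fun i _ => hF i i
  ext i j
  simp only [traceFree, div_eq_mul_inv, Matrix.sub_apply, Matrix.smul_apply, smul_eq_mul, mul_assoc,
    pdM, Matrix.of_apply]
  rw [pd_sub (hF i j) (htrace.mul_const _), pd_mul htrace (differentiableAt_const _), pd_const,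
    mul_zero, add_zero, pd_trace hF]
  rfl

theorem DiffAtM.traceFreeOuter {v w : E4 → Matrix (Fin 2) (Fin 1) ℂ} (hv : DiffAtM y v)
    (hw : DiffAtM y w) : DiffAtM y fun z => U2Gravity.traceFreeOuter (v z) (w z) := fun i j => by
  have hmul := hv.mul hw.conjTranspose
  have htrace : DifferentiableAt ℝ (fun z => (v z * (w z)ᴴ).trace) y :=
    DifferentiableAt.fun_sum fun i _ => hmul i i
  simp only [traceFreeOuter_apply, traceFree, div_eq_mul_inv, Matrix.sub_apply, Matrix.smul_apply,
    smul_eq_mul]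
  exact (hmul i j).sub ((htrace.mul_const _).mul_const _)

theorem pdM_traceFreeOuter {v w : E4 → Matrix (Fin 2) (Fin 1) ℂ} (hv : DiffAtM y v)
    (hw : DiffAtM y w) (κ : Fin 4) :
    pdM κ (fun z => traceFreeOuter (v z) (w z)) y
      = traceFreeOuter (pdM κ v y) (w y) + traceFreeOuter (v y) (pdM κ w y) := by
  have hmul := hv.mul hw.conjTranspose
  simp only [traceFreeOuter_apply]
  rw [pdM_traceFree hmul, pdM_mul hv hw.conjTranspose, pdM_conjTranspose hw]
  simp only [traceFree, Matrix.trace_add, add_div, add_smul]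
  abel

theorem d1M_eq_pdM {p q : ℕ} (α : E4 → Fin 4 → Matrix (Fin p) (Fin q) ℂ) (y : E4) (μ ν : Fin 4) :
    d1M α y μ ν = pdM μ (fun z => α z ν) y - pdM ν (fun z => α z μ) y := rfl

theorem d2M_eq_pdM {p q : ℕ} (σ : E4 → Fin 4 → Fin 4 → Matrix (Fin p) (Fin q) ℂ) (y : E4)
    (μ ν ρ : Fin 4) : d2M σ y μ ν ρ = pdM μ (fun z => σ z ν ρ) y - pdM ν (fun z => σ z μ ρ) y
      + pdM ρ (fun z => σ z μ ν) y := rfl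

theorem pdM_sigma (hΨ : ∀ μ, DiffAtM y fun z => Ψ z μ) (κ μ ν : Fin 4) :
    pdM κ (fun z => sigma Ψ z μ ν) y
      = traceFreeOuter (pdM κ (fun z => Ψ z μ) y) (Ψ y ν)
        + traceFreeOuter (Ψ y μ) (pdM κ (fun z => Ψ z ν) y)
        - (traceFreeOuter (pdM κ (fun z => Ψ z ν) y) (Ψ y μ)
          + traceFreeOuter (Ψ y ν) (pdM κ (fun z => Ψ z μ) y)) := by
  simp only [sigma_eq]
  rw [pdM_sub ((hΨ μ).traceFreeOuter (hΨ ν)) ((hΨ ν).traceFreeOuter (hΨ μ)),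
    pdM_traceFreeOuter (hΨ μ) (hΨ ν), pdM_traceFreeOuter (hΨ ν) (hΨ μ)]

theorem d2M_sigma (hΨ : ∀ μ, DiffAtM y fun z => Ψ z μ) (μ ν ρ : Fin 4) :
    d2M (sigma Ψ) y μ ν ρ
      = (traceFreeOuter (d1M Ψ y μ ν) (Ψ y ρ) - traceFreeOuter (d1M Ψ y μ ρ) (Ψ y ν)
          + traceFreeOuter (d1M Ψ y ν ρ) (Ψ y μ))
        - (traceFreeOuter (Ψ y μ) (d1M Ψ y ν ρ) - traceFreeOuter (Ψ y ν) (d1M Ψ y μ ρ)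
          + traceFreeOuter (Ψ y ρ) (d1M Ψ y μ ν)) := by
  simp only [d2M_eq_pdM, d1M_eq_pdM, pdM_sigma hΨ, map_sub, LinearMap.sub_apply]
  abel

/-- The equation `dΨ = -L ∧ Ψ` at the point `y`: the connection with value `L` at `y`, acting on
`ℂ²` by real-linear maps, has no torsion. -/
def TorsionFree (Ψ : C2Form) (y : E4)
    (L : Fin 4 → Matrix (Fin 2) (Fin 1) ℂ →ₗ[ℝ] Matrix (Fin 2) (Fin 1) ℂ) : Prop :=
  ∀ μ ν, d1M Ψ y μ ν = -(L μ (Ψ y ν) - L ν (Ψ y μ))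

/-- The part `B ∧ S - S ∧ B` of the Euler-Lagrange expression that is linear in the connection. -/
def elLin (S : Fin 4 → Fin 4 → Matrix (Fin 2) (Fin 2) ℂ) (B : Fin 4 → Matrix (Fin 2) (Fin 2) ℂ)
    (μ ν ρ : Fin 4) : Matrix (Fin 2) (Fin 2) ℂ :=
  w12 B S μ ν ρ - w21 S B μ ν ρ

theorem elLin_eq (S : Fin 4 → Fin 4 → Matrix (Fin 2) (Fin 2) ℂ)
    (B : Fin 4 → Matrix (Fin 2) (Fin 2) ℂ) (μ ν ρ : Fin 4) :
    elLin S B μ ν ρ = (B μ * S ν ρ - S ν ρ * B μ) - (B ν * S μ ρ - S μ ρ * B ν)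
      + (B ρ * S μ ν - S μ ν * B ρ) := by
  simp only [elLin, w12, w21]
  abel

theorem elForm_eq (Ψ : C2Form) (y : E4) (B : Fin 4 → Matrix (Fin 2) (Fin 2) ℂ) (μ ν ρ : Fin 4) :
    elForm Ψ y B μ ν ρ = d2M (sigma Ψ) y μ ν ρ + elLin (sigma Ψ y) B μ ν ρ := by
  rw [elForm, elLin, add_sub_assoc]

theorem commutator_sigma {A : Matrix (Fin 2) (Fin 2) ℂ} (hA : Aᴴ = -A) (μ ν : Fin 4) :
    A * sigma Ψ y μ ν - sigma Ψ y μ ν * A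
      = traceFreeOuter (A * Ψ y μ) (Ψ y ν) + traceFreeOuter (Ψ y μ) (A * Ψ y ν)
        - (traceFreeOuter (A * Ψ y ν) (Ψ y μ) + traceFreeOuter (Ψ y ν) (A * Ψ y μ)) := by
  rw [← commutator_traceFreeOuter hA, ← commutator_traceFreeOuter hA, sigma_eq, Matrix.mul_sub,
    Matrix.sub_mul]
  abel

theorem TorsionFree.elForm_eq_zero {A : Fin 4 → Matrix (Fin 2) (Fin 2) ℂ} {b c : Fin 4 → ℂ}
    (hT : TorsionFree Ψ y fun μ => so4Act (A μ, b μ, c μ))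
    (hΨ : ∀ μ, DiffAtM y fun z => Ψ z μ) (hA : ∀ μ, (A μ)ᴴ = -A μ)
    (hb : ∀ μ, star (b μ) = -b μ) : elForm Ψ y A = 0 := by
  funext μ ν ρ
  simp only [elForm_eq, elLin_eq, d2M_sigma hΨ, hT _ _, so4Act_apply, commutator_sigma (hA _),
    map_neg, map_sub, map_add, LinearMap.neg_apply, LinearMap.sub_apply, LinearMap.add_apply,
    traceFreeOuter_smul_left, traceFreeOuter_smul_right, hb]
  rw [traceFreeOuter_epsConj_comm (Ψ y ν) (Ψ y μ), traceFreeOuter_epsConj_comm (Ψ y ρ) (Ψ y μ),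
    traceFreeOuter_epsConj_comm (Ψ y ρ) (Ψ y ν), traceFreeOuter_epsConj_comm' (Ψ y ν) (Ψ y μ),
    traceFreeOuter_epsConj_comm' (Ψ y ρ) (Ψ y μ), traceFreeOuter_epsConj_comm' (Ψ y ρ) (Ψ y ν)]
  simp only [Pi.zero_apply]
  module

end EulerLagrangeForm

section Uniqueness

variable {Ψ : C2Form} {y : E4}

theorem elLin_contract (S : Fin 4 → Fin 4 → Matrix (Fin 2) (Fin 2) ℂ)
    (B : Fin 4 → Matrix (Fin 2) (Fin 2) ℂ) (E : Matrix (Fin 4) (Fin 4) ℝ) (I J K : Fin 4) :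
    elLin (fun J K => ∑ ν, ∑ ρ, (E ν J * E ρ K) • S ν ρ) (fun I => ∑ μ, E μ I • B μ) I J K
      = ∑ μ, ∑ ν, ∑ ρ, (E μ I * E ν J * E ρ K) • elLin S B μ ν ρ := by
  have hcomm (I J K : Fin 4) :
      (∑ μ, E μ I • B μ) * (∑ ν, ∑ ρ, (E ν J * E ρ K) • S ν ρ)
        - (∑ ν, ∑ ρ, (E ν J * E ρ K) • S ν ρ) * (∑ μ, E μ I • B μ)
      = ∑ μ, ∑ ν, ∑ ρ, (E μ I * (E ν J * E ρ K)) • (B μ * S ν ρ - S ν ρ * B μ) := by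
    rw [Finset.sum_mul, Finset.mul_sum, ← Finset.sum_sub_distrib]
    refine Finset.sum_congr rfl fun μ _ => ?_
    simp only [Finset.sum_mul, Finset.mul_sum, smul_mul_smul_comm, smul_sub,
      Finset.sum_sub_distrib, mul_comm (E μ I)]
  have hreorder (C : Fin 4 → Fin 4 → Fin 4 → Matrix (Fin 2) (Fin 2) ℂ) :
      ∑ μ, ∑ ν, ∑ ρ, (E μ I * (E ν J * E ρ K)) • C μ ν ρ
        - ∑ μ, ∑ ν, ∑ ρ, (E μ J * (E ν I * E ρ K)) • C μ ν ρ
        + ∑ μ, ∑ ν, ∑ ρ, (E μ K * (E ν I * E ρ J)) • C μ ν ρ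
      = ∑ μ, ∑ ν, ∑ ρ, (E μ I * E ν J * E ρ K) • (C μ ν ρ - C ν μ ρ + C ρ μ ν) := by
    simp only [smul_add, smul_sub, Finset.sum_add_distrib, Finset.sum_sub_distrib]
    congr 1
    · congr 1
      · simp only [mul_assoc]
      · rw [Finset.sum_comm]
        simp only [mul_left_comm, mul_assoc]
    · rw [Finset.sum_comm]
      refine Finset.sum_congr rfl fun μ _ => ?_
      rw [Finset.sum_comm]
      simp only [mul_comm (E _ K)]
  rw [elLin_eq, hcomm, hcomm, hcomm, hreorder fun μ ν ρ => B μ * S ν ρ - S ν ρ * B μ]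
  simp only [elLin_eq]

/-- The identification `ℝ⁴ ≅ ℂ²`, `z¹ = x¹ + i x²`, `z² = x³ + i x⁴`, with columns as the model of
`ℂ²`; it turns the real coframe `e^I` into `Ψ`. -/
noncomputable def toC2 : (Fin 4 → ℝ) →ₗ[ℝ] Matrix (Fin 2) (Fin 1) ℂ where
  toFun x := !![(x 0 : ℂ) + Complex.I * x 1; (x 2 : ℂ) + Complex.I * x 3]
  map_add' x x' := by
    ext c j
    fin_cases j
    fin_cases c <;> simp <;> ring
  map_smul' r x := by
    ext c j
    fin_cases j
    fin_cases c <;> simp <;> ring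

theorem toC2_coframe (Ψ : C2Form) (y : E4) (μ : Fin 4) :
    toC2 ((coframe Ψ y)ᵀ μ) = Ψ y μ := by
  ext c j
  fin_cases j
  fin_cases c <;> apply Complex.ext <;> simp [toC2, coframe]

theorem sum_inv_coframe_smul (hdet : (coframe Ψ y).det ≠ 0) (I : Fin 4) :
    ∑ μ, (coframe Ψ y)⁻¹ μ I • Ψ y μ = toC2 (Pi.single I 1) := by
  have hinv : coframe Ψ y * (coframe Ψ y)⁻¹ = 1 := Matrix.mul_nonsing_inv _ hdet.isUnit
  have hcol : Pi.single I 1 = ∑ μ, (coframe Ψ y)⁻¹ μ I • (coframe Ψ y)ᵀ μ := by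
    ext J
    have hJI := congrFun₂ hinv J I
    rw [Matrix.mul_apply, Matrix.one_apply] at hJI
    simp only [Pi.single_apply, ← hJI, Finset.sum_apply, Pi.smul_apply, Matrix.transpose_apply,
      smul_eq_mul, mul_comm]
  rw [hcol, map_sum]
  simp only [map_smul, toC2_coframe]

/-- The form `Σ` in the frame dual to the coframe `e^I`. -/
noncomputable def stdSigma (J K : Fin 4) : Matrix (Fin 2) (Fin 2) ℂ :=
  traceFreeOuter (toC2 (Pi.single J 1)) (toC2 (Pi.single K 1))
    - traceFreeOuter (toC2 (Pi.single K 1)) (toC2 (Pi.single J 1))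

theorem sum_inv_coframe_smul_sigma (hdet : (coframe Ψ y).det ≠ 0) (J K : Fin 4) :
    ∑ ν, ∑ ρ, ((coframe Ψ y)⁻¹ ν J * (coframe Ψ y)⁻¹ ρ K) • sigma Ψ y ν ρ = stdSigma J K := by
  simp only [stdSigma, ← sum_inv_coframe_smul hdet, map_sum, LinearMap.sum_apply, map_smul,
    LinearMap.smul_apply, Finset.smul_sum, smul_smul, sigma_eq, smul_sub, Finset.sum_sub_distrib]
  rw [sub_left_inj, Finset.sum_comm]
  simp only [mul_comm]

theorem stdSigma_values :
    (stdSigma 0 1 = !![-Complex.I, 0; 0, Complex.I]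
      ∧ stdSigma 2 3 = !![Complex.I, 0; 0, -Complex.I])
    ∧ (stdSigma 0 2 = !![0, 1; -1, 0] ∧ stdSigma 1 3 = !![0, 1; -1, 0])
    ∧ stdSigma 0 3 = !![0, -Complex.I; -Complex.I, 0]
      ∧ stdSigma 1 2 = !![0, Complex.I; Complex.I, 0] := by
  refine ⟨⟨?_, ?_⟩, ⟨?_, ?_⟩, ?_, ?_⟩ <;> apply matrix_ext_two <;>
    simp [stdSigma, traceFreeOuter_apply, traceFree, toC2, Matrix.trace_fin_two,
      Matrix.vecMul, dotProduct] <;> ring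

theorem eq_zero_of_elLin_stdSigma {D : Fin 4 → Matrix (Fin 2) (Fin 2) ℂ}
    (hD : ∀ I, IsSu2 (D I)) (h : ∀ I J K, elLin stdSigma D I J K = 0) (I : Fin 4) : D I = 0 := by
  have h11 := fun μ => (isSu2_iff_entries.1 (hD μ)).1
  have h00 := fun μ => (isSu2_iff_entries.1 (hD μ)).2.1
  have h10 := fun μ => (isSu2_iff_entries.1 (hD μ)).2.2
  have hre (μ : Fin 4) : (D μ 0 0).re = 0 := by
    have := congrArg Complex.re (h00 μ)
    simp only [Complex.star_def, Complex.conj_re, Complex.neg_re] at this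
    linarith
  have e (J K L i j) : elLin stdSigma D J K L i j = 0 := by rw [h]; rfl
  obtain ⟨⟨s01, s23⟩, ⟨s02, s13⟩, s03, s12⟩ := stdSigma_values
  -- twelve real equations, on the four triples `J < K < L`, for the twelve real unknowns
  have a1 := e 0 1 2 0 0
  have a2 := e 0 1 2 0 1
  have b1 := e 0 1 3 0 0
  have b2 := e 0 1 3 0 1
  have c1 := e 0 2 3 0 0
  have c2 := e 0 2 3 0 1
  have d1 := e 1 2 3 0 0
  have d2 := e 1 2 3 0 1
  simp [elLin_eq, s01, s23, s02, s13, s03, s12, Matrix.mul_apply, Matrix.vecMul,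
    dotProduct, Fin.sum_univ_two, h11, h10, Complex.ext_iff, hre]
    at a1 a2 b1 b2 c1 c2 d1 d2
  have him : (D I 0 0).im = 0 := by fin_cases I <;> simp only [Fin.reduceFinMk] <;> linarith
  have hre' : (D I 0 1).re = 0 := by fin_cases I <;> simp only [Fin.reduceFinMk] <;> linarith
  have him' : (D I 0 1).im = 0 := by fin_cases I <;> simp only [Fin.reduceFinMk] <;> linarith
  have hdiag : D I 0 0 = 0 := Complex.ext (hre I) him
  have hoff : D I 0 1 = 0 := Complex.ext hre' him'
  apply matrix_ext_two <;> simp [h11, h10, hdiag, hoff]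

theorem eq_zero_of_elLin (hdet : (coframe Ψ y).det ≠ 0) {D : Fin 4 → Matrix (Fin 2) (Fin 2) ℂ}
    (hD : ∀ μ, IsSu2 (D μ)) (h : ∀ μ ν ρ, elLin (sigma Ψ y) D μ ν ρ = 0) : D = 0 := by
  have hframe (I : Fin 4) : ∑ μ, (coframe Ψ y)⁻¹ μ I • D μ = 0 := by
    refine eq_zero_of_elLin_stdSigma (D := fun I => ∑ μ, (coframe Ψ y)⁻¹ μ I • D μ)
      (fun I => su2.sum_mem fun μ _ => su2.smul_mem _ (hD μ)) (fun I J K => ?_) I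
    have hcontract := elLin_contract (sigma Ψ y) D (coframe Ψ y)⁻¹ I J K
    simpa only [h, smul_zero, Finset.sum_const_zero, sum_inv_coframe_smul_sigma hdet]
      using hcontract
  funext μ
  calc D μ = ∑ ν, ((coframe Ψ y)⁻¹ * coframe Ψ y) ν μ • D ν := by
        simp [Matrix.nonsing_inv_mul _ hdet.isUnit, Matrix.one_apply]
    _ = ∑ I, coframe Ψ y I μ • ∑ ν, (coframe Ψ y)⁻¹ ν I • D ν := by
        simp only [Matrix.mul_apply, Finset.sum_smul, Finset.smul_sum, smul_smul]
        rw [Finset.sum_comm]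
        simp only [mul_comm]
    _ = 0 := by simp only [hframe, smul_zero, Finset.sum_const_zero]

theorem elForm_unique (hdet : (coframe Ψ y).det ≠ 0) {A B : Fin 4 → Matrix (Fin 2) (Fin 2) ℂ}
    (hA : ∀ μ, IsSu2 (A μ)) (hB : ∀ μ, IsSu2 (B μ)) (eA : elForm Ψ y A = 0)
    (eB : elForm Ψ y B = 0) : B = A := by
  refine sub_eq_zero.1 (eq_zero_of_elLin hdet (fun μ => su2.sub_mem (hB μ) (hA μ)) fun μ ν ρ => ?_)
  have hsub : elForm Ψ y B μ ν ρ - elForm Ψ y A μ ν ρ = 0 := by rw [eA, eB, sub_self]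
  rw [elForm_eq, elForm_eq, add_sub_add_left_eq_sub] at hsub
  rw [← hsub]
  simp only [elLin_eq, Pi.sub_apply, sub_mul, mul_sub]
  abel

end Uniqueness

/-! ### The anti-self-dual part of the Levi-Civita connection -/

section AntiSelfDual

/-- The anti-self-dual part `½ (W - ⋆W)` of an antisymmetric matrix, as an endomorphism of `ℂ²`. -/
noncomputable def asd : Matrix (Fin 4) (Fin 4) ℝ →ₗ[ℝ] Matrix (Fin 2) (Fin 2) ℂ where
  toFun W := toComplex ((1 / 2 : ℝ) • (W - hodge W))
  map_add' X Y := by apply matrix_ext_two <;> simp [toComplex, hodge] <;> ring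
  map_smul' r X := by apply matrix_ext_two <;> simp [toComplex, hodge] <;> ring

variable {W : Matrix (Fin 4) (Fin 4) ℝ}

theorem skew_apply (hW : Wᵀ = -W) (i j : Fin 4) : W i j = -W j i := by
  rw [← Matrix.neg_apply, ← hW, Matrix.transpose_apply]

theorem skew_diag (hW : Wᵀ = -W) (i : Fin 4) : W i i = 0 := by
  have := skew_apply hW i i
  linarith

theorem asd_eq (hW : Wᵀ = -W) : asd W =
    !![Complex.I * ((W 2 3 - W 0 1) / 2), ((W 0 2 + W 1 3) + Complex.I * (W 1 2 - W 0 3)) / 2;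
      (-(W 0 2 + W 1 3) + Complex.I * (W 1 2 - W 0 3)) / 2,
      -(Complex.I * ((W 2 3 - W 0 1) / 2))] := by
  have s := skew_apply hW
  have d := skew_diag hW
  apply matrix_ext_two <;> simp [asd, toComplex, hodge, d, s 1 0, s 2 0, s 3 0, s 3 2] <;> ring

theorem isSu2_asd (hW : Wᵀ = -W) : IsSu2 (asd W) := by
  rw [asd_eq hW, isSu2_iff_entries]
  refine ⟨by simp, by simp, ?_⟩
  simp
  ring

theorem toC2_mulVec (hW : Wᵀ = -W) (x : Fin 4 → ℝ) :
    toC2 (W *ᵥ x) = so4Act (asd W, -(Complex.I * ((W 0 1 + W 2 3) / 2)),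
      ((W 0 2 - W 1 3) + Complex.I * (W 1 2 + W 0 3)) / 2) (toC2 x) := by
  have s := skew_apply hW
  have d := skew_diag hW
  rw [asd_eq hW, so4Act_apply]
  ext i j
  fin_cases j
  fin_cases i <;> apply Complex.ext <;>
    simp [toC2, epsConj, Matrix.mulVec, Matrix.vecHead, Matrix.vecTail, dotProduct,
      Fin.sum_univ_four, d, s 1 0, s 2 0, s 3 0, s 3 2, s 3 1, s 2 1] <;> ring

end AntiSelfDual

theorem asdLeviCivita_eq (Ψ : C2Form) (y : E4) (μ : Fin 4) :
    asdLeviCivita Ψ y μ = asd (leviCivita Ψ y μ) := rfl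

theorem d1M_eq_toC2 {Ψ : C2Form} {y : E4} (hΨ : ∀ μ, DiffAtM y fun z => Ψ z μ) (μ ν : Fin 4) :
    d1M Ψ y μ ν = toC2 fun I => d1 (fun z => coframe Ψ z I) y μ ν := by
  have hre (κ ι : Fin 4) (c : Fin 2) := pd_re (hΨ ι c 0) κ
  have him (κ ι : Fin 4) (c : Fin 2) := pd_im (hΨ ι c 0) κ
  ext c j
  fin_cases j
  fin_cases c <;> apply Complex.ext <;> simp [d1M, d1, toC2, coframe, hre, him]

namespace IsSmoothCoframe

variable {U : Set E4} {Ψ : C2Form} {y : E4} (h : IsSmoothCoframe U Ψ)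
include h

theorem smoothOnM (μ : Fin 4) : SmoothOnM U fun z => Ψ z μ := fun c j => by
  rw [Subsingleton.elim j 0]
  exact h.smooth μ c

theorem diffAtM (hy : y ∈ U) (μ : Fin 4) : DiffAtM y fun z => Ψ z μ :=
  (h.smoothOnM μ).diffAtM h.isOpen hy

theorem isSu2_asdLeviCivita (hy : y ∈ U) (μ : Fin 4) : IsSu2 (asdLeviCivita Ψ y μ) :=
  isSu2_asd (h.transpose_leviCivita hy μ)

theorem exists_torsionFree (hy : y ∈ U) :
    ∃ b c : Fin 4 → ℂ, (∀ μ, star (b μ) = -b μ) ∧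
      TorsionFree Ψ y fun μ => so4Act (asdLeviCivita Ψ y μ, b μ, c μ) := by
  refine ⟨fun μ => -(Complex.I * ((leviCivita Ψ y μ 0 1 + leviCivita Ψ y μ 2 3) / 2)),
    fun μ => ((leviCivita Ψ y μ 0 2 - leviCivita Ψ y μ 1 3)
      + Complex.I * (leviCivita Ψ y μ 1 2 + leviCivita Ψ y μ 0 3)) / 2, fun μ => ?_, fun μ ν => ?_⟩
  · simp
  · have hd1 : (fun I => d1 (fun z => coframe Ψ z I) y μ ν)
        = -(leviCivita Ψ y μ *ᵥ (coframe Ψ y)ᵀ ν - leviCivita Ψ y ν *ᵥ (coframe Ψ y)ᵀ μ) :=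
      funext fun I => (h.d1_coframe hy I μ ν).trans (neg_sub _ _).symm
    simp only [d1M_eq_toC2 (h.diffAtM hy), hd1, map_neg, map_sub, asdLeviCivita_eq,
      toC2_mulVec (h.transpose_leviCivita hy _), toC2_coframe]

theorem elForm_asdLeviCivita (hy : y ∈ U) : elForm Ψ y (asdLeviCivita Ψ y) = 0 := by
  obtain ⟨b, c, hb, hT⟩ := h.exists_torsionFree hy
  exact hT.elForm_eq_zero (h.diffAtM hy) (fun μ => (h.isSu2_asdLeviCivita hy μ).1) hb

theorem elForm_eq_zero_iff (hy : y ∈ U) {B : Fin 4 → Matrix (Fin 2) (Fin 2) ℂ}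
    (hB : ∀ μ, IsSu2 (B μ)) : elForm Ψ y B = 0 ↔ B = asdLeviCivita Ψ y :=
  ⟨fun e => elForm_unique (h.nondeg y hy) (h.isSu2_asdLeviCivita hy) hB
      (h.elForm_asdLeviCivita hy) e,
    fun e => e ▸ h.elForm_asdLeviCivita hy⟩

end IsSmoothCoframe

/-! ### Naturality and gauge covariance of the torsion-free condition -/

section PullBack

variable {p q : ℕ} {Φ : E4 → Fin 4 → Matrix (Fin p) (Fin q) ℂ} {τ : E4 → E4} {y : E4} {U V : Set E4}

theorem contDiffAt_component (hτ : ContDiffAt ℝ ∞ τ y) (κ : Fin 4) :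
    ContDiffAt ℝ ∞ (fun z => τ z κ) y :=
  (EuclideanSpace.proj κ : E4 →L[ℝ] ℝ).contDiff.contDiffAt.comp y hτ

theorem pull1_apply (τ : E4 → E4) (Φ : E4 → Fin 4 → Matrix (Fin p) (Fin q) ℂ) (y : E4) (μ : Fin 4)
    (i : Fin p) (j : Fin q) :
    pull1 τ Φ y μ i j = ∑ κ, pd μ (fun z => τ z κ) y • Φ (τ y) κ i j := by
  simp only [pull1, Matrix.sum_apply, Matrix.smul_apply]

theorem SmoothOnM.pull1 (hΦ : ∀ κ, SmoothOnM V fun z => Φ z κ) (hτ : ContDiffOn ℝ ∞ τ U)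
    (hU : IsOpen U) (hUV : Set.MapsTo τ U V) (μ : Fin 4) :
    SmoothOnM U fun z => pull1 τ Φ z μ := fun i j => by
  simp only [pull1_apply]
  exact ContDiffOn.sum fun κ _ => (contDiffOn_pd
    ((EuclideanSpace.proj κ : E4 →L[ℝ] ℝ).contDiff.comp_contDiffOn hτ) hU μ).smul
    ((hΦ κ i j).comp hτ hUV)

theorem pdM_pull1 (hτ : ContDiffAt ℝ ∞ τ y) (hΦ : ∀ κ, DiffAtM (τ y) fun z => Φ z κ)
    (μ ν : Fin 4) :
    pdM μ (fun z => pull1 τ Φ z ν) y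
      = ∑ κ, pd μ (pd ν (fun z => τ z κ)) y • Φ (τ y) κ
        + ∑ κ, ∑ ι, (pd μ (fun z => τ z κ) y * pd ν (fun z => τ z ι) y)
          • pdM κ (fun z => Φ z ι) (τ y) := by
  have hd : DifferentiableAt ℝ τ y := hτ.differentiableAt (by simp)
  have hJ (κ : Fin 4) : DifferentiableAt ℝ (pd ν (fun z => τ z κ)) y :=
    (((contDiffAt_component hτ κ).fderiv_right (m := 1)
      (WithTop.coe_le_coe.2 (le_top : (2 : ℕ∞) ≤ ⊤))).clm_apply
      contDiffAt_const).differentiableAt one_ne_zero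
  ext i j
  have hc (κ : Fin 4) : DifferentiableAt ℝ (fun z => Φ (τ z) κ i j) y :=
    DifferentiableAt.comp y (hΦ κ i j) hd
  rw [Finset.sum_comm (f := fun κ ι => (pd μ (fun z => τ z κ) y * pd ν (fun z => τ z ι) y)
    • pdM κ (fun z => Φ z ι) (τ y)), ← Finset.sum_add_distrib]
  simp only [pdM, Matrix.of_apply, Matrix.add_apply, Matrix.sum_apply, Matrix.smul_apply,
    pull1_apply]
  rw [pd_sum Finset.univ (f := fun κ z => pd ν (fun z => τ z κ) z • Φ (τ z) κ i j)
    fun κ _ => (hJ κ).smul (hc κ)]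
  refine Finset.sum_congr rfl fun κ _ => ?_
  rw [pd_smul (hJ κ) (hc κ), pd_comp (f := fun z => Φ z κ i j) (hΦ κ i j) hd, Finset.smul_sum]
  congr 1
  exact Finset.sum_congr rfl fun ι _ => by rw [smul_smul, mul_comm]

theorem d1M_pull1 (hτ : ContDiffAt ℝ ∞ τ y) (hΦ : ∀ κ, DiffAtM (τ y) fun z => Φ z κ) :
    d1M (pull1 τ Φ) y = pull2 τ (d1M Φ) y := by
  funext μ ν
  simp only [d1M_eq_pdM, pdM_pull1 hτ hΦ, fun κ => pd_comm (contDiffAt_component hτ κ) μ ν,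
    add_sub_add_left_eq_sub, pull2, smul_sub, Finset.sum_sub_distrib]
  congr 1
  rw [Finset.sum_comm]
  exact Finset.sum_congr rfl fun κ _ => Finset.sum_congr rfl fun ι _ => by rw [mul_comm]

theorem TorsionFree.pull {Ψ : C2Form}
    {L : Fin 4 → Matrix (Fin 2) (Fin 1) ℂ →ₗ[ℝ] Matrix (Fin 2) (Fin 1) ℂ}
    (hT : TorsionFree Ψ (τ y) L) (hτ : ContDiffAt ℝ ∞ τ y)
    (hΨ : ∀ μ, DiffAtM (τ y) fun z => Ψ z μ) :
    TorsionFree (pull1 τ Ψ) y fun μ => ∑ κ, pd μ (fun z => τ z κ) y • L κ := by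
  intro μ ν
  have hswap : ∑ κ, ∑ ι, (pd ν (fun z => τ z κ) y * pd μ (fun z => τ z ι) y) • L ι (Ψ (τ y) κ)
      = ∑ κ, ∑ ι, (pd μ (fun z => τ z κ) y * pd ν (fun z => τ z ι) y) • L κ (Ψ (τ y) ι) := by
    rw [Finset.sum_comm]
    simp only [mul_comm (pd μ _ y)]
  simp only [pull1, LinearMap.sum_apply, LinearMap.smul_apply, map_sum, map_smul, Finset.smul_sum,
    smul_smul, hswap, d1M_pull1 hτ hΨ, pull2, hT _ _, smul_neg, smul_sub, Finset.sum_neg_distrib,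
    Finset.sum_sub_distrib]

end PullBack

section Gauge

variable {u : Matrix (Fin 2) (Fin 2) ℂ}

theorem mul_epsConj (hu : u * uᴴ = 1) (v : Matrix (Fin 2) (Fin 1) ℂ) :
    u * epsConj v = u.det • epsConj (u * v) := by
  have hadj : u.det • uᴴ = u.adjugate := by
    rw [← Matrix.mul_one u.adjugate, ← hu, ← Matrix.mul_assoc, Matrix.adjugate_mul,
      Matrix.smul_mul, Matrix.one_mul]
  have hentry (i j : Fin 2) : u.det * star (u j i) = u.adjugate i j := congrFun₂ hadj i j
  have h00 := hentry 0 0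
  have h01 := hentry 0 1
  have h10 := hentry 1 0
  have h11 := hentry 1 1
  simp only [Matrix.adjugate_fin_two, Matrix.of_apply, Matrix.cons_val', Matrix.cons_val_zero,
    Matrix.cons_val_one, Matrix.cons_val_fin_one] at h00 h01 h10 h11
  ext i j
  fin_cases j
  fin_cases i <;> simp only [epsConj, LinearMap.coe_mk, AddHom.coe_mk, Matrix.mul_apply,
    Fin.sum_univ_two, Matrix.smul_apply, smul_eq_mul, star_add, star_mul', Fin.zero_eta,
    Fin.mk_one, Matrix.of_apply, Matrix.cons_val', Matrix.cons_val_zero, Matrix.cons_val_one,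
    Matrix.cons_val_fin_one]
  · linear_combination -star (v 0 0) * h01 - star (v 1 0) * h11
  · linear_combination star (v 0 0) * h00 + star (v 1 0) * h10

theorem isSu2_traceFree {X : Matrix (Fin 2) (Fin 2) ℂ} (hX : Xᴴ = -X) : IsSu2 (traceFree X) := by
  refine ⟨?_, trace_traceFree X⟩
  have htrace : star (X.trace / 2) = -(X.trace / 2) := by
    rw [star_div₀, ← Matrix.trace_conjTranspose, hX, Matrix.trace_neg, star_ofNat, neg_div]
  rw [traceFree, Matrix.conjTranspose_sub, Matrix.conjTranspose_smul, hX, htrace,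
    Matrix.conjTranspose_one, neg_smul, neg_sub']

/-- The gauge transform `u A u⁻¹ - du u⁻¹` of a connection component, where `u` is unitary and `D`
is the derivative of `u`. -/
def gaugeTransform (u D A : Matrix (Fin 2) (Fin 2) ℂ) : Matrix (Fin 2) (Fin 2) ℂ :=
  u * A * uᴴ - D * uᴴ

theorem so4Act_gaugeTransform (hu : u * uᴴ = 1) (D A : Matrix (Fin 2) (Fin 2) ℂ) (b c : ℂ)
    (v : Matrix (Fin 2) (Fin 1) ℂ) :
    so4Act (traceFree (gaugeTransform u D A), b + (gaugeTransform u D A).trace / 2, c * u.det)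
      (u * v) = u * so4Act (A, b, c) v - D * v := by
  have hcancel (X : Matrix (Fin 2) (Fin 2) ℂ) : X * uᴴ * (u * v) = X * v := by
    rw [Matrix.mul_assoc, ← Matrix.mul_assoc uᴴ, mul_eq_one_comm.1 hu, Matrix.one_mul]
  have hgauge : gaugeTransform u D A * (u * v) = u * (A * v) - D * v := by
    rw [gaugeTransform, Matrix.sub_mul, hcancel, hcancel, Matrix.mul_assoc]
  simp only [so4Act_apply, traceFree, Matrix.sub_mul, hgauge, Matrix.smul_mul, Matrix.one_mul,
    mul_smul, ← mul_epsConj hu, Matrix.mul_add, Matrix.mul_smul, add_smul]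
  abel

theorem TorsionFree.gauge {Ψ Φ : C2Form} {u : E4 → Matrix (Fin 2) (Fin 2) ℂ} {U : Set E4} {y : E4}
    {L L' : Fin 4 → Matrix (Fin 2) (Fin 1) ℂ →ₗ[ℝ] Matrix (Fin 2) (Fin 1) ℂ}
    (hT : TorsionFree Φ y L) (hU : IsOpen U) (hy : y ∈ U) (hΦ : ∀ μ, DiffAtM y fun z => Φ z μ)
    (hu : DiffAtM y u) (hglue : ∀ z ∈ U, ∀ μ, Ψ z μ = u z * Φ z μ)
    (hL : ∀ μ v, L' μ (u y * v) = u y * L μ v - pdM μ u y * v) : TorsionFree Ψ y L' := by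
  have hpd (μ ν : Fin 4) : pdM μ (fun z => Ψ z ν) y
      = pdM μ u y * Φ y ν + u y * pdM μ (fun z => Φ z ν) y :=
    (pdM_congr_of_eqOn hU (fun z hz => hglue z hz ν) hy μ).trans (pdM_mul hu (hΦ ν) μ)
  intro μ ν
  have hrotated : u y * pdM μ (fun z => Φ z ν) y - u y * pdM ν (fun z => Φ z μ) y
      = -(u y * L μ (Φ y ν) - u y * L ν (Φ y μ)) := by
    rw [← Matrix.mul_sub, ← d1M_eq_pdM, hT, Matrix.mul_neg, Matrix.mul_sub]
  rw [d1M_eq_pdM, hpd, hpd, hglue y hy, hglue y hy, hL, hL, add_sub_add_comm, hrotated]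
  abel

theorem gaugeTransform_conjTranspose {u : E4 → Matrix (Fin 2) (Fin 2) ℂ} {U : Set E4} {y : E4}
    (hU : IsOpen U) (hs : SmoothOnM U u) (hu : ∀ z ∈ U, u z * (u z)ᴴ = 1) (hy : y ∈ U) (μ : Fin 4)
    {A : Matrix (Fin 2) (Fin 2) ℂ} (hA : Aᴴ = -A) :
    (gaugeTransform (u y) (pdM μ u y) A)ᴴ = -gaugeTransform (u y) (pdM μ u y) A := by
  have hd := hs.diffAtM hU hy
  have hdiff : u y * (pdM μ u y)ᴴ = -(pdM μ u y * (u y)ᴴ) := by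
    have := pdM_mul hd (hs.conjTranspose.diffAtM hU hy) μ
    rw [pdM_congr_of_eqOn hU hu hy, pdM_const, pdM_conjTranspose hd] at this
    exact eq_neg_of_add_eq_zero_right this.symm
  simp only [gaugeTransform, Matrix.conjTranspose_sub, Matrix.conjTranspose_mul,
    Matrix.conjTranspose_conjTranspose, hA, hdiff, Matrix.mul_assoc, Matrix.neg_mul, Matrix.mul_neg]
  abel

end Gauge

/-! ### The Hermitian form of a coframe -/

/-- The Hermitian form `∑_c Ψ_μ^c conj(Ψ_ν^c) = g_{μν} - i ω_{μν}`. -/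
def herm (Ψ : C2Form) (y : E4) : Matrix (Fin 4) (Fin 4) ℂ :=
  Matrix.of fun μ ν => ((Ψ y ν)ᴴ * Ψ y μ) 0 0

theorem metric_eq_re (Ψ : C2Form) (y : E4) (μ ν : Fin 4) :
    metric Ψ y μ ν = (herm Ψ y μ ν).re := by
  simp only [metric, herm, Matrix.of_apply, Matrix.mul_apply, Matrix.conjTranspose_apply, mul_comm,
    Complex.re_sum]

theorem omega_eq_im (Ψ : C2Form) (y : E4) (μ ν : Fin 4) :
    omega Ψ y μ ν = -(herm Ψ y μ ν).im := by
  simp [omega, herm, Matrix.mul_apply]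
  ring

theorem herm_eq (Ψ : C2Form) (y : E4) (μ ν : Fin 4) :
    herm Ψ y μ ν = metric Ψ y μ ν - Complex.I * omega Ψ y μ ν := by
  rw [metric_eq_re, omega_eq_im]
  apply Complex.ext <;> simp

theorem herm_eq_iff (Ψ Φ : C2Form) (y : E4) :
    herm Ψ y = herm Φ y ↔ metric Ψ y = metric Φ y ∧ omega Ψ y = omega Φ y := by
  refine ⟨fun h => ⟨?_, ?_⟩, fun ⟨hmetric, homega⟩ => ?_⟩
  · ext μ ν
    rw [metric_eq_re, metric_eq_re, h]
  · ext μ ν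
    rw [omega_eq_im, omega_eq_im, h]
  · ext μ ν
    rw [herm_eq, herm_eq, hmetric, homega]

theorem herm_eq_of_unitary {Ψ Φ : C2Form} {y : E4} {u : Matrix (Fin 2) (Fin 2) ℂ}
    (hu : uᴴ * u = 1) (h : ∀ μ, Ψ y μ = u * Φ y μ) : herm Ψ y = herm Φ y := by
  ext μ ν
  simp only [herm, Matrix.of_apply]
  rw [h, h, Matrix.conjTranspose_mul, Matrix.mul_assoc, ← Matrix.mul_assoc uᴴ, hu, Matrix.one_mul]

theorem herm_pull1 (τ : E4 → E4) (Ψ : C2Form) (y : E4) :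
    herm (pull1 τ Ψ) y = Matrix.of (pull2 τ (herm Ψ) y) := by
  ext μ ν
  simp only [herm, pull1, pull2, Matrix.of_apply, Matrix.conjTranspose_sum, Matrix.sum_mul,
    Matrix.mul_sum, Matrix.conjTranspose_smul, star_trivial, Matrix.sum_apply]
  exact Finset.sum_congr rfl fun κ _ => Finset.sum_congr rfl fun ι _ => by
    rw [Matrix.smul_mul, Matrix.mul_smul, smul_smul, mul_comm (pd ν _ _), Matrix.smul_apply]

theorem metric_pull1 (τ : E4 → E4) (Ψ : C2Form) (y : E4) :
    metric (pull1 τ Ψ) y = Matrix.of (pull2 τ (fun z => metric Ψ z) y) := by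
  ext μ ν
  simp only [metric_eq_re, herm_pull1, pull2, Matrix.of_apply, Complex.re_sum, Complex.smul_re]

theorem omega_pull1 (τ : E4 → E4) (Ψ : C2Form) (y : E4) :
    omega (pull1 τ Ψ) y = Matrix.of (pull2 τ (fun z => omega Ψ z) y) := by
  ext μ ν
  simp only [omega_eq_im, herm_pull1, pull2, Matrix.of_apply, Complex.im_sum, Complex.smul_im,
    smul_neg, Finset.sum_neg_distrib]

/-! ### `U(2)`-structures on a manifold -/

section Global

variable {M : Type*} [TopologicalSpace M]

theorem isOpen_overlap (chart : ℕ → OpenPartialHomeomorph M E4) (i j : ℕ) :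
    IsOpen (overlap chart i j) :=
  ((chart i).symm.trans (chart j)).open_source

variable [ChartedSpace E4 M] (P : U2Structure M)

namespace U2Structure

theorem isSmoothCoframe (i : ℕ) : IsSmoothCoframe (P.chart i).target (P.Psi i) :=
  ⟨(P.chart i).open_target, P.smooth i, P.nondeg i⟩

theorem contDiffOn_transition (i j : ℕ) :
    ContDiffOn ℝ ∞ (transition P.chart i j) (overlap P.chart i j) := by
  have h := StructureGroupoid.compatible_of_mem_maximalAtlas (P.chart_mem i) (P.chart_mem j)
  rw [contDiffGroupoid, mem_groupoid_of_pregroupoid] at h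
  have hsmooth := h.1
  simp only [contDiffPregroupoid, modelWithCornersSelf_coe, modelWithCornersSelf_coe_symm,
    Set.preimage_id, Set.range_id, Set.inter_univ, Function.comp_id, Function.id_comp] at hsmooth
  exact hsmooth

theorem mapsTo_transition (i j : ℕ) :
    Set.MapsTo (transition P.chart i j) (overlap P.chart i j) (P.chart j).target :=
  fun _ hy => (P.chart j).map_source hy.2

theorem trans_mul_conjTranspose (i j : ℕ) :
    ∀ y ∈ overlap P.chart i j, P.trans i j y * (P.trans i j y)ᴴ = 1 :=
  fun y hy => Matrix.mem_unitaryGroup_iff.1 (P.trans_unitary i j y hy)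

theorem herm_overlap {i j : ℕ} {y : E4} (hy : y ∈ overlap P.chart i j) :
    herm (P.Psi i) y = herm (pull1 (transition P.chart i j) (P.Psi j)) y :=
  herm_eq_of_unitary (mul_eq_one_comm.1 (P.trans_mul_conjTranspose i j y hy)) (P.glue i j y hy)

theorem metric_omega_overlap {i j : ℕ} {y : E4} (hy : y ∈ overlap P.chart i j) :
    metric (P.Psi i) y
        = Matrix.of (pull2 (transition P.chart i j) (fun z => metric (P.Psi j) z) y) ∧
      omega (P.Psi i) y
        = Matrix.of (pull2 (transition P.chart i j) (fun z => omega (P.Psi j) z) y) := by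
  rw [← metric_pull1, ← omega_pull1, ← herm_eq_iff, P.herm_overlap hy]

theorem traceFree_gaugeTransform_asdLeviCivita {i j : ℕ} {y : E4} (hy : y ∈ overlap P.chart i j)
    (μ : Fin 4) :
    traceFree (gaugeTransform (P.trans i j y) (pdM μ (P.trans i j) y)
      (pull1 (transition P.chart i j) (asdLeviCivita (P.Psi j)) y μ))
        = asdLeviCivita (P.Psi i) y μ := by
  have hO := isOpen_overlap P.chart i j
  have hi := P.isSmoothCoframe i
  have hj := P.isSmoothCoframe j
  have hτ := P.contDiffOn_transition i j
  have hτy := P.mapsTo_transition i j hy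
  have hu := P.trans_mul_conjTranspose i j
  have hus : SmoothOnM (overlap P.chart i j) (P.trans i j) := P.trans_smooth i j
  have hτAt := hτ.contDiffAt (hO.mem_nhds hy)
  set τ := transition P.chart i j
  obtain ⟨b, c, hb, hT⟩ := hj.exists_torsionFree hτy
  have hpulled := hT.pull hτAt (hj.diffAtM hτy)
  simp only [← map_smul, ← map_sum, Prod.smul_mk, ← prod_mk_sum] at hpulled
  have hX (μ : Fin 4) := gaugeTransform_conjTranspose hO hus hu hy μ
    (su2.sum_mem (t := Finset.univ) fun κ _ => su2.smul_mem (pd μ (fun z => τ z κ) y)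
      (hj.isSu2_asdLeviCivita hτy κ)).1
  have hglued := hpulled.gauge hO hy
    (fun μ => (SmoothOnM.pull1 hj.smoothOnM hτ hO (P.mapsTo_transition i j) μ).diffAtM hO hy)
    (hus.diffAtM hO hy) (P.glue i j)
    fun μ v => so4Act_gaugeTransform (hu y hy) (pdM μ (P.trans i j) y) _ _ _ v
  have helForm := hglued.elForm_eq_zero (hi.diffAtM hy.1) (fun μ => (isSu2_traceFree (hX μ)).1)
    fun μ => by
      simp only [star_add, star_sum, star_smul, star_trivial, hb, smul_neg, Finset.sum_neg_distrib,
        star_div₀, star_ofNat, ← Matrix.trace_conjTranspose, hX, Matrix.trace_neg, neg_add, neg_div]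
  exact congrFun ((hi.elForm_eq_zero_iff hy.1 fun μ => isSu2_traceFree (hX μ)).1 helForm) μ

theorem isSU2Connection_asdLeviCivita : IsSU2Connection P fun i => asdLeviCivita (P.Psi i) :=
  ⟨fun i μ => ((P.isSmoothCoframe i).smoothOnM_leviCivita μ).linearMap asd,
    fun i _ hy μ => (P.isSmoothCoframe i).isSu2_asdLeviCivita hy μ,
    fun _ _ _ hy μ => (P.traceFree_gaugeTransform_asdLeviCivita hy μ).symm⟩

end U2Structure

end Global

/-! ### The first variation of the action -/

section Su2Forms

variable {U : Set E4} {Ψ : C2Form} {y : E4}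

theorem IsSu2.commutator {X Y : Matrix (Fin 2) (Fin 2) ℂ} (hX : IsSu2 X) (hY : IsSu2 Y) :
    IsSu2 (X * Y - Y * X) :=
  ⟨by simp only [Matrix.conjTranspose_sub, Matrix.conjTranspose_mul, hX.1, hY.1, neg_mul_neg,
      neg_sub], by rw [Matrix.trace_sub, Matrix.trace_mul_comm, sub_self]⟩

open scoped ComplexOrder in
theorem IsSu2.eq_zero_of_trace_mul_self {X : Matrix (Fin 2) (Fin 2) ℂ} (hX : IsSu2 X)
    (h : (X * X).trace = 0) : X = 0 :=
  Matrix.trace_conjTranspose_mul_self_eq_zero_iff.1 <| by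
    rw [hX.1, Matrix.neg_mul, Matrix.trace_neg, h, neg_zero]

theorem isSu2_pdM {F : E4 → Matrix (Fin 2) (Fin 2) ℂ} (hU : IsOpen U) (hF : ∀ z ∈ U, IsSu2 (F z))
    (hd : DiffAtM y F) (hy : y ∈ U) (μ : Fin 4) : IsSu2 (pdM μ F y) := by
  constructor
  · rw [← pdM_conjTranspose hd, pdM_congr_of_eqOn hU (fun z hz => (hF z hz).1) hy, pdM_neg]
  · rw [← pd_trace hd, pd_congr_of_eqOn hU (fun z hz => (hF z hz).2) hy, pd_const]

theorem isSu2_elLin {S : Fin 4 → Fin 4 → Matrix (Fin 2) (Fin 2) ℂ}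
    {B : Fin 4 → Matrix (Fin 2) (Fin 2) ℂ} (hS : ∀ μ ν, IsSu2 (S μ ν)) (hB : ∀ μ, IsSu2 (B μ))
    (μ ν ρ : Fin 4) : IsSu2 (elLin S B μ ν ρ) := by
  have hcomm (μ ν ρ : Fin 4) := (hB μ).commutator (hS ν ρ)
  rw [elLin_eq]
  exact su2.add_mem (su2.sub_mem (hcomm _ _ _) (hcomm _ _ _)) (hcomm _ _ _)

theorem IsSmoothCoframe.smoothOnM_sigma (h : IsSmoothCoframe U Ψ) (μ ν : Fin 4) :
    SmoothOnM U fun y => sigma Ψ y μ ν := by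
  have hmul (μ ν : Fin 4) := (h.smoothOnM μ).mul (h.smoothOnM ν).conjTranspose
  have houter (μ ν : Fin 4) : SmoothOnM U fun y => traceFreeOuter (Ψ y μ) (Ψ y ν) := fun i j =>
    (hmul μ ν i j).sub (((hmul μ ν).contDiffOn_trace.div_const 2).mul contDiffOn_const)
  simp only [sigma_eq]
  exact (houter μ ν).sub (houter ν μ)

theorem IsSmoothCoframe.isSu2_elForm (h : IsSmoothCoframe U Ψ) (hy : y ∈ U)
    {B : Fin 4 → Matrix (Fin 2) (Fin 2) ℂ} (hB : ∀ μ, IsSu2 (B μ)) (μ ν ρ : Fin 4) :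
    IsSu2 (elForm Ψ y B μ ν ρ) := by
  have hd (κ μ ν : Fin 4) : IsSu2 (pdM κ (fun z => sigma Ψ z μ ν) y) :=
    isSu2_pdM h.isOpen (fun z _ => isSu2_sigma Ψ z μ ν)
      ((h.smoothOnM_sigma μ ν).diffAtM h.isOpen hy) hy κ
  rw [elForm_eq, d2M_eq_pdM]
  exact su2.add_mem (su2.add_mem (su2.sub_mem (hd _ _ _) (hd _ _ _)) (hd _ _ _))
    (isSu2_elLin (isSu2_sigma Ψ y) hB _ _ _)

theorem eq_zero_of_antisymm {X : Type*} [AddCommGroup X] [IsAddTorsionFree X]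
    {θ : Fin 4 → Fin 4 → Fin 4 → X} (hleft : ∀ μ ν ρ, θ μ ν ρ = -θ ν μ ρ)
    (hright : ∀ μ ν ρ, θ μ ν ρ = -θ μ ρ ν) (h012 : θ 0 1 2 = 0) (h013 : θ 0 1 3 = 0)
    (h023 : θ 0 2 3 = 0) (h123 : θ 1 2 3 = 0) : θ = 0 := by
  have swapl (μ ν ρ : Fin 4) (h : θ μ ν ρ = 0) : θ ν μ ρ = 0 := by rw [hleft, h, neg_zero]
  have swapr (μ ν ρ : Fin 4) (h : θ μ ν ρ = 0) : θ μ ρ ν = 0 := by rw [hright, h, neg_zero]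
  have diagl (μ ρ : Fin 4) : θ μ μ ρ = 0 := self_eq_neg.1 (hleft μ μ ρ)
  have diag (μ ρ : Fin 4) : θ μ ρ μ = 0 := swapr _ _ _ (diagl μ ρ)
  funext μ ν ρ
  change θ μ ν ρ = 0
  fin_cases μ <;> fin_cases ν <;> fin_cases ρ <;> grind

theorem pdM_sigma_swap (Ψ : C2Form) (y : E4) (κ μ ν : Fin 4) :
    pdM κ (fun z => sigma Ψ z μ ν) y = -pdM κ (fun z => sigma Ψ z ν μ) y := by
  simp only [sigma_swap Ψ _ μ ν, pdM_neg]

theorem elForm_swap_left (Ψ : C2Form) (y : E4) (B : Fin 4 → Matrix (Fin 2) (Fin 2) ℂ)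
    (μ ν ρ : Fin 4) : elForm Ψ y B μ ν ρ = -elForm Ψ y B ν μ ρ := by
  simp only [elForm_eq, d2M_eq_pdM, elLin_eq, pdM_sigma_swap Ψ y ρ ν μ, sigma_swap Ψ y ν μ,
    Matrix.mul_neg, Matrix.neg_mul]
  abel

theorem elForm_swap_right (Ψ : C2Form) (y : E4) (B : Fin 4 → Matrix (Fin 2) (Fin 2) ℂ)
    (μ ν ρ : Fin 4) : elForm Ψ y B μ ν ρ = -elForm Ψ y B μ ρ ν := by
  simp only [elForm_eq, d2M_eq_pdM, elLin_eq, pdM_sigma_swap Ψ y μ ρ ν, sigma_swap Ψ y ρ ν,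
    Matrix.mul_neg, Matrix.neg_mul]
  abel

end Su2Forms

section TraceIdentities

variable {p q : ℕ}

theorem trace_w31_dag (Ψ : C2Form) (y : E4) {F : Fin 4 → Fin 4 → Matrix (Fin 2) (Fin 2) ℂ}
    (hF : ∀ μ ν, (F μ ν).trace = 0) :
    Matrix.trace (w31 (w12 (dag Ψ y) F : Fin 4 → Fin 4 → Fin 4 → Matrix (Fin 1) (Fin 2) ℂ) (Ψ y)
        : Matrix (Fin 1) (Fin 1) ℂ)
      = -Matrix.trace (w22 F (sigma Ψ y) : Matrix (Fin 2) (Fin 2) ℂ) := by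
  have hcycle (μ ν ρ κ : Fin 4) : (dag Ψ y μ * F ν ρ * Ψ y κ).trace
      = (F ν ρ * (Ψ y κ * dag Ψ y μ)).trace := by
    rw [Matrix.mul_assoc, Matrix.trace_mul_comm, Matrix.mul_assoc]
  simp only [w31, w12, w22, sigma, w11, Matrix.sub_mul, Matrix.add_mul, Matrix.mul_add,
    Matrix.mul_sub, Matrix.mul_smul, Matrix.mul_one, Matrix.trace_add, Matrix.trace_sub,
    Matrix.trace_smul, hcycle, hF, smul_zero]
  ring

theorem trace_w22_w11 (A δ : Fin 4 → Matrix (Fin 2) (Fin 2) ℂ)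
    (S : Fin 4 → Fin 4 → Matrix (Fin 2) (Fin 2) ℂ) :
    Matrix.trace (w22 (fun μ ν => (w11 A δ μ ν + w11 δ A μ ν : Matrix (Fin 2) (Fin 2) ℂ)) S
        : Matrix (Fin 2) (Fin 2) ℂ)
      = Matrix.trace (w13 δ (elLin S A) : Matrix (Fin 2) (Fin 2) ℂ) := by
  have hcycle (μ ν ρ κ : Fin 4) : (A μ * (δ ν * S ρ κ)).trace = (δ ν * (S ρ κ * A μ)).trace := by
    rw [Matrix.trace_mul_comm, Matrix.mul_assoc]
  simp only [w22, w11, w13, elLin_eq, Matrix.sub_mul, Matrix.add_mul, Matrix.mul_add,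
    Matrix.mul_sub, Matrix.trace_add, Matrix.trace_sub, hcycle, Matrix.mul_assoc]
  ring

/-- The `3`-form `Tr(α ∧ σ)` of a matrix-valued `1`-form and a matrix-valued `2`-form. -/
noncomputable def traceW12 (α : E4 → Fin 4 → Matrix (Fin p) (Fin q) ℂ)
    (σ : E4 → Fin 4 → Fin 4 → Matrix (Fin q) (Fin p) ℂ) (y : E4) (μ ν ρ : Fin 4) : ℂ :=
  Matrix.trace (w12 (α y) (σ y) μ ν ρ : Matrix (Fin p) (Fin p) ℂ)

/-- Exterior derivative of a complex `3`-form, as the component on `(∂_0, ∂_1, ∂_2, ∂_3)`. -/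
noncomputable def d3 (θ : E4 → Fin 4 → Fin 4 → Fin 4 → ℂ) (y : E4) : ℂ :=
  pd 0 (fun z => θ z 1 2 3) y - pd 1 (fun z => θ z 0 2 3) y + pd 2 (fun z => θ z 0 1 3) y
    - pd 3 (fun z => θ z 0 1 2) y

variable {α : E4 → Fin 4 → Matrix (Fin p) (Fin q) ℂ}
  {σ : E4 → Fin 4 → Fin 4 → Matrix (Fin q) (Fin p) ℂ} {y : E4}

theorem pd_traceW12 (hα : ∀ μ, DiffAtM y fun z => α z μ)
    (hσ : ∀ μ ν, DiffAtM y fun z => σ z μ ν) (κ μ ν ρ : Fin 4) :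
    pd κ (fun z => traceW12 α σ z μ ν ρ) y
      = (pdM κ (fun z => α z μ) y * σ y ν ρ + α y μ * pdM κ (fun z => σ z ν ρ) y).trace
        - (pdM κ (fun z => α z ν) y * σ y μ ρ + α y ν * pdM κ (fun z => σ z μ ρ) y).trace
        + (pdM κ (fun z => α z ρ) y * σ y μ ν + α y ρ * pdM κ (fun z => σ z μ ν) y).trace := by
  have hmul (μ ν ρ : Fin 4) : DiffAtM y fun z => α z μ * σ z ν ρ := (hα μ).mul (hσ ν ρ)
  have htrace (μ ν ρ : Fin 4) : DifferentiableAt ℝ (fun z => (α z μ * σ z ν ρ).trace) y :=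
    DifferentiableAt.fun_sum fun i _ => hmul μ ν ρ i i
  simp only [traceW12, w12, Matrix.trace_add, Matrix.trace_sub]
  rw [pd_add ((htrace _ _ _).fun_sub (htrace _ _ _)) (htrace _ _ _),
    pd_sub (htrace _ _ _) (htrace _ _ _)]
  simp only [pd_trace (hmul _ _ _), pdM_mul (hα _) (hσ _ _), Matrix.trace_add]

theorem trace_w22_d1M (hα : ∀ μ, DiffAtM y fun z => α z μ)
    (hσ : ∀ μ ν, DiffAtM y fun z => σ z μ ν) :
    Matrix.trace (w22 (d1M α y) (σ y) : Matrix (Fin p) (Fin p) ℂ)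
      = d3 (traceW12 α σ) y + Matrix.trace (w13 (α y) (d2M σ y) : Matrix (Fin p) (Fin p) ℂ) := by
  simp only [d3, pd_traceW12 hα hσ, w22, w13, d1M_eq_pdM, d2M_eq_pdM, Matrix.trace_add,
    Matrix.trace_sub, Matrix.mul_add, Matrix.mul_sub, Matrix.sub_mul]
  ring

end TraceIdentities

section Integration

variable {V : Set E4} {Ψ : C2Form} {f : E4 → ℂ}

theorem IsSmoothCoframe.orient_ne_zero (h : IsSmoothCoframe V Ψ) {y : E4} (hy : y ∈ V) :
    orient Ψ y ≠ 0 :=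
  mt Real.sign_eq_zero_iff.1 (h.nondeg y hy)

theorem IsSmoothCoframe.eventually_orient_eq (h : IsSmoothCoframe V Ψ) {y : E4} (hy : y ∈ V) :
    ∀ᶠ z in nhds y, orient Ψ z = orient Ψ y := by
  have hc : ContinuousAt (volForm Ψ) y :=
    h.smoothOnM_coframe.contDiffOn_det.continuousOn.continuousAt (h.isOpen.mem_nhds hy)
  rcases lt_or_gt_of_ne (show volForm Ψ y ≠ 0 from h.nondeg y hy) with hneg | hpos
  · filter_upwards [hc.eventually_lt continuousAt_const hneg] with z hz
    rw [orient, orient, Real.sign_of_neg hz, Real.sign_of_neg hneg]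
  · filter_upwards [continuousAt_const.eventually_lt hc hpos] with z hz
    rw [orient, orient, Real.sign_of_pos hz, Real.sign_of_pos hpos]

theorem IsSmoothCoframe.continuousOn_orient (h : IsSmoothCoframe V Ψ) :
    ContinuousOn (fun y => (orient Ψ y : ℂ)) V := fun _ hz =>
  (continuousAt_const.congr ((h.eventually_orient_eq hz).mono fun _ hw =>
    congrArg Complex.ofReal hw.symm)).continuousWithinAt

/-- `f` is smooth on `V` and vanishes off a compact subset of `V`; its values outside `V` are
irrelevant. -/
structure IsTestFunction (V : Set E4) (f : E4 → ℂ) : Prop where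
  contDiffOn : ContDiffOn ℝ ∞ f V
  exists_compact : ∃ K ⊆ V, IsCompact K ∧ ∀ y ∈ V, y ∉ K → f y = 0

namespace IsTestFunction

theorem const_mul (hf : IsTestFunction V f) (c : ℂ) : IsTestFunction V fun y => c * f y := by
  obtain ⟨K, hKV, hK, hzero⟩ := hf.exists_compact
  exact ⟨contDiffOn_const.mul hf.contDiffOn, K, hKV, hK, fun y hy hyK => by
    rw [hzero y hy hyK, mul_zero]⟩

theorem pd (hf : IsTestFunction V f) (hV : IsOpen V) (μ : Fin 4) :
    IsTestFunction V (pd μ f) := by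
  obtain ⟨K, hKV, hK, hzero⟩ := hf.exists_compact
  refine ⟨contDiffOn_pd hf.contDiffOn hV μ, K, hKV, hK, fun y hy hyK => ?_⟩
  rw [pd_congr_of_eqOn (hV.inter hK.isClosed.isOpen_compl) (fun z hz => hzero z hz.1 hz.2)
    ⟨hy, hyK⟩, pd_const]

end IsTestFunction

/-- The extension by zero of `± f`, with the sign of the orientation. -/
noncomputable def orientExt (V : Set E4) (Ψ : C2Form) (f : E4 → ℂ) : E4 → ℂ :=
  V.indicator fun y => (orient Ψ y : ℂ) * f y

theorem orientExt_eventuallyEq (h : IsSmoothCoframe V Ψ) (f : E4 → ℂ) {y : E4} (hy : y ∈ V) :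
    orientExt V Ψ f =ᶠ[nhds y] fun z => (orient Ψ y : ℂ) * f z := by
  filter_upwards [h.isOpen.mem_nhds hy, h.eventually_orient_eq hy] with z hz horient
  rw [orientExt, Set.indicator_of_mem hz, horient]

theorem orientExt_eventuallyEq_zero (Ψ : C2Form) (hf : IsTestFunction V f) {y : E4} (hy : y ∉ V) :
    orientExt V Ψ f =ᶠ[nhds y] fun _ => 0 := by
  obtain ⟨K, hKV, hK, hzero⟩ := hf.exists_compact
  filter_upwards [hK.isClosed.isOpen_compl.mem_nhds fun hk => hy (hKV hk)] with z hz
  refine Set.indicator_apply_eq_zero.2 fun hzV => ?_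
  rw [hzero z hzV hz, mul_zero]

theorem contDiff_orientExt (h : IsSmoothCoframe V Ψ) (hf : IsTestFunction V f) :
    ContDiff ℝ ∞ (orientExt V Ψ f) := by
  refine contDiff_iff_contDiffAt.2 fun y => ?_
  by_cases hy : y ∈ V
  · exact (contDiffAt_const.mul (hf.contDiffOn.contDiffAt (h.isOpen.mem_nhds hy)))
      |>.congr_of_eventuallyEq (orientExt_eventuallyEq h f hy)
  · exact contDiffAt_const.congr_of_eventuallyEq (orientExt_eventuallyEq_zero Ψ hf hy)

theorem hasCompactSupport_orientExt (Ψ : C2Form) (hf : IsTestFunction V f) :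
    HasCompactSupport (orientExt V Ψ f) := by
  obtain ⟨K, -, hK, hzero⟩ := hf.exists_compact
  refine HasCompactSupport.intro hK fun y hy => Set.indicator_apply_eq_zero.2 fun hyV => ?_
  rw [hzero y hyV hy, mul_zero]

theorem pd_orientExt (h : IsSmoothCoframe V Ψ) (hf : IsTestFunction V f) (μ : Fin 4) :
    pd μ (orientExt V Ψ f) = orientExt V Ψ (pd μ f) := by
  funext y
  by_cases hy : y ∈ V
  · have hfd := differentiableAt_of_contDiffOn hf.contDiffOn h.isOpen hy
    rw [pd, (orientExt_eventuallyEq h f hy).fderiv_eq, orientExt, Set.indicator_of_mem hy]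
    exact pd_clm_apply (ContinuousLinearMap.mul ℝ ℂ (orient Ψ y)) hfd μ
  · rw [pd, (orientExt_eventuallyEq_zero Ψ hf hy).fderiv_eq, orientExt,
      Set.indicator_of_notMem hy]
    exact pd_const μ (0 : ℂ) y

theorem integrableOn_orient_mul (h : IsSmoothCoframe V Ψ) (hf : IsTestFunction V f) :
    IntegrableOn (fun y => (orient Ψ y : ℂ) * f y) V :=
  (integrable_indicator_iff h.isOpen.measurableSet).1
    ((contDiff_orientExt h hf).continuous.integrable_of_hasCompactSupport
      (hasCompactSupport_orientExt Ψ hf))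

theorem integral_pd_eq_zero {g : E4 → ℂ} (hg : ContDiff ℝ ∞ g) (hc : HasCompactSupport g)
    (μ : Fin 4) : ∫ y, pd μ g y = 0 := by
  have hpd : Continuous (pd μ g) :=
    ((hg.fderiv_right (m := ∞) (by simp)).clm_apply contDiff_const).continuous
  have hparts := integral_mul_fderiv_eq_neg_fderiv_mul_of_integrable (𝕜 := ℂ)
    (μ := (volume : Measure E4)) (f := fun _ => (1 : ℂ)) (g := g)
    (v := EuclideanSpace.single μ 1) (by simp)
    (by simp only [one_mul]; exact hpd.integrable_of_hasCompactSupport (hc.fderiv_apply ℝ _))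
    (by simpa only [one_mul] using hg.continuous.integrable_of_hasCompactSupport hc)
    (fun _ _ => differentiableAt_const _) (fun _ _ => hg.differentiable (by simp) _)
  simpa [pd] using hparts

theorem setIntegral_orient_mul_pd (h : IsSmoothCoframe V Ψ) (hf : IsTestFunction V f)
    (μ : Fin 4) : ∫ y in V, (orient Ψ y : ℂ) * pd μ f y = 0 := by
  rw [← integral_pd_eq_zero (contDiff_orientExt h hf) (hasCompactSupport_orientExt Ψ hf) μ,
    pd_orientExt h hf, orientExt, integral_indicator h.isOpen.measurableSet]

variable {θ : E4 → Fin 4 → Fin 4 → Fin 4 → ℂ}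

theorem orient_mul_d3 (Ψ : C2Form) (θ : E4 → Fin 4 → Fin 4 → Fin 4 → ℂ) (y : E4) :
    (orient Ψ y : ℂ) * d3 θ y
      = (orient Ψ y : ℂ) * pd 0 (fun z => θ z 1 2 3) y
        - (orient Ψ y : ℂ) * pd 1 (fun z => θ z 0 2 3) y
        + (orient Ψ y : ℂ) * pd 2 (fun z => θ z 0 1 3) y
        - (orient Ψ y : ℂ) * pd 3 (fun z => θ z 0 1 2) y := by
  simp only [d3, mul_sub, mul_add]

theorem integrableOn_orient_mul_d3 (h : IsSmoothCoframe V Ψ)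
    (hθ : ∀ μ ν ρ, IsTestFunction V fun y => θ y μ ν ρ) :
    IntegrableOn (fun y => (orient Ψ y : ℂ) * d3 θ y) V := by
  have hi (κ μ ν ρ : Fin 4) := integrableOn_orient_mul h ((hθ μ ν ρ).pd h.isOpen κ)
  simp only [orient_mul_d3]
  exact (((hi _ _ _ _).sub (hi _ _ _ _)).add (hi _ _ _ _)).sub (hi _ _ _ _)

theorem setIntegral_orient_mul_d3 (h : IsSmoothCoframe V Ψ)
    (hθ : ∀ μ ν ρ, IsTestFunction V fun y => θ y μ ν ρ) :
    ∫ y in V, (orient Ψ y : ℂ) * d3 θ y = 0 := by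
  have hi (κ μ ν ρ : Fin 4) := integrableOn_orient_mul h ((hθ μ ν ρ).pd h.isOpen κ)
  have hzero (κ μ ν ρ : Fin 4) := setIntegral_orient_mul_pd h (hθ μ ν ρ) κ
  simp only [orient_mul_d3]
  rw [integral_sub (((hi _ _ _ _).fun_sub (hi _ _ _ _)).fun_add (hi _ _ _ _))
      (hi _ _ _ _), integral_add ((hi _ _ _ _).fun_sub (hi _ _ _ _)) (hi _ _ _ _),
    integral_sub (hi _ _ _ _) (hi _ _ _ _)]
  simp only [hzero, sub_zero, add_zero]

theorem eq_zero_of_setIntegral_orient_mul (h : IsSmoothCoframe V Ψ) (hf : ContinuousOn f V)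
    (hintegral : ∀ φ : E4 → ℝ, ContDiff ℝ ∞ φ → HasCompactSupport φ → tsupport φ ⊆ V →
      ∫ y in V, (orient Ψ y : ℂ) * (φ y * f y) = 0) {y : E4} (hy : y ∈ V) : f y = 0 := by
  have hcont : ContinuousOn (fun y => (orient Ψ y : ℂ) * f y) V := h.continuousOn_orient.mul hf
  have hae := h.isOpen.ae_eq_zero_of_integral_contDiff_smul_eq_zero (μ := (volume : Measure E4))
    (hcont.locallyIntegrableOn h.isOpen.measurableSet) fun φ hφ hc hs => ?_
  · have heq : (orient Ψ y : ℂ) * f y = 0 := Measure.eqOn_open_of_ae_eq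
      ((ae_restrict_iff' h.isOpen.measurableSet).2 hae) h.isOpen hcont continuousOn_const hy
    exact (mul_eq_zero.1 heq).resolve_left (Complex.ofReal_ne_zero.2 (h.orient_ne_zero hy))
  · rw [← hintegral φ hφ hc hs, ← setIntegral_eq_integral_of_forall_compl_eq_zero (s := V)
      fun z hz => by rw [image_eq_zero_of_notMem_tsupport fun hz' => hz (hs hz'), zero_smul]]
    simp only [Complex.real_smul, mul_left_comm]

end Integration

section Variation

variable {V : Set E4} {Ψ : C2Form} {A δ : M2Form} {y : E4}

/-- The covariant derivative `dδ + A ∧ δ + δ ∧ A`. -/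
noncomputable def covD (A δ : M2Form) (y : E4) (μ ν : Fin 4) : Matrix (Fin 2) (Fin 2) ℂ :=
  d1M δ y μ ν + (w11 (A y) (δ y) μ ν + w11 (δ y) (A y) μ ν)

theorem curv_add_smul (hA : ∀ μ, DiffAtM y fun z => A z μ) (hδ : ∀ μ, DiffAtM y fun z => δ z μ)
    (t : ℂ) : curv (fun z μ => A z μ + t • δ z μ) y
      = fun μ ν => curv A y μ ν + t • covD A δ y μ ν + t ^ 2 • w11 (δ y) (δ y) μ ν := by
  have hpd (μ ν : Fin 4) : pdM μ (fun z => A z ν + t • δ z ν) y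
      = pdM μ (fun z => A z ν) y + t • pdM μ (fun z => δ z ν) y := by
    ext i j
    exact (pd_add (hA ν i j) ((hδ ν i j).const_mul t) μ).trans
      (congrArg _ (pd_clm_apply (ContinuousLinearMap.mul ℝ ℂ t) (hδ ν i j) μ))
  funext μ ν
  simp only [curv, covD, d1M_eq_pdM, hpd, w11, Matrix.add_mul, Matrix.mul_add, Matrix.smul_mul,
    Matrix.mul_smul, smul_add, smul_sub, smul_smul, sq]
  abel

theorem trace_w22_add_smul (F G H S : Fin 4 → Fin 4 → Matrix (Fin 2) (Fin 2) ℂ) (t : ℂ) :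
    Matrix.trace (w22 (fun μ ν => F μ ν + t • G μ ν + t ^ 2 • H μ ν) S : Matrix (Fin 2) (Fin 2) ℂ)
      = Matrix.trace (w22 F S : Matrix (Fin 2) (Fin 2) ℂ)
        + t * Matrix.trace (w22 G S : Matrix (Fin 2) (Fin 2) ℂ)
        + t ^ 2 * Matrix.trace (w22 H S : Matrix (Fin 2) (Fin 2) ℂ) := by
  simp only [w22, Matrix.add_mul, Matrix.smul_mul, Matrix.trace_add, Matrix.trace_sub,
    Matrix.trace_smul, smul_eq_mul]
  ring

/-- `A` is a smooth `𝔰𝔲(2)`-valued `1`-form on `V`. -/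
structure IsSmoothSu2 (V : Set E4) (A : M2Form) : Prop where
  smooth : ∀ μ, SmoothOnM V fun y => A y μ
  isSu2 : ∀ y ∈ V, ∀ μ, IsSu2 (A y μ)

theorem IsVariation.isSmoothSu2 (hδ : IsVariation V δ) : IsSmoothSu2 V δ :=
  ⟨fun μ c d => (hδ.1 μ c d).contDiffOn, fun y _ μ => hδ.2.1 y μ⟩

theorem IsVariation.isTestFunction (hδ : IsVariation V δ) {f : E4 → ℂ} (hf : ContDiffOn ℝ ∞ f V)
    (hzero : ∀ y, δ y = 0 → f y = 0) : IsTestFunction V f := by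
  obtain ⟨K, hK, hKV, hδK⟩ := hδ.2.2
  exact ⟨hf, K, hKV, hK, fun y _ hyK => hzero y (funext (hδK y hyK))⟩

theorem IsSmoothSu2.diffAtM (hA : IsSmoothSu2 V A) (hV : IsOpen V) (hy : y ∈ V) (μ : Fin 4) :
    DiffAtM y fun z => A z μ :=
  (hA.smooth μ).diffAtM hV hy

theorem IsSmoothSu2.add_real_smul (hA : IsSmoothSu2 V A) (hδ : IsSmoothSu2 V δ) (t : ℝ) :
    IsSmoothSu2 V fun y μ => A y μ + (t : ℂ) • δ y μ :=
  ⟨fun μ i j => (hA.smooth μ i j).add (contDiffOn_const.mul (hδ.smooth μ i j)),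
    fun y hy μ => su2.add_mem (hA.isSu2 y hy μ) (su2.smul_mem t (hδ.isSu2 y hy μ))⟩

theorem IsSmoothSu2.trace_curv (hA : IsSmoothSu2 V A) (hV : IsOpen V) (hy : y ∈ V) (μ ν : Fin 4) :
    (curv A y μ ν).trace = 0 := by
  have hpd (μ ν : Fin 4) : (pdM μ (fun z => A z ν) y).trace = 0 :=
    (isSu2_pdM hV (fun z hz => hA.isSu2 z hz ν) (hA.diffAtM hV hy ν) hy μ).2
  rw [curv, d1M_eq_pdM, Matrix.trace_add, Matrix.trace_sub, hpd, hpd, w11,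
    ((hA.isSu2 y hy μ).commutator (hA.isSu2 y hy ν)).2, sub_zero, add_zero]

theorem IsSmoothSu2.smoothOnM_elForm (hA : IsSmoothSu2 V A) (h : IsSmoothCoframe V Ψ)
    (μ ν ρ : Fin 4) : SmoothOnM V fun y => elForm Ψ y (A y) μ ν ρ := by
  have hS := h.smoothOnM_sigma
  have hd (κ μ ν : Fin 4) := (hS μ ν).pdM h.isOpen κ
  have hAS (μ ν ρ : Fin 4) := (hA.smooth μ).mul (hS ν ρ)
  have hSA (μ ν ρ : Fin 4) := (hS μ ν).mul (hA.smooth ρ)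
  exact (((hd _ _ _).sub (hd _ _ _)).add (hd _ _ _)).add
    (((hAS _ _ _).sub (hAS _ _ _)).add (hAS _ _ _)) |>.sub
    (((hSA _ _ _).sub (hSA _ _ _)).add (hSA _ _ _))

/-- The `4`-form `Tr(δ ∧ (dΣ + A ∧ Σ - Σ ∧ A))`, the first-order term of the variation of the
action up to the factor `-λ`. -/
noncomputable def firstVariation (Ψ : C2Form) (A δ : M2Form) (y : E4) : ℂ :=
  Matrix.trace (w13 (δ y) (elForm Ψ y (A y)) : Matrix (Fin 2) (Fin 2) ℂ)

/-- The `4`-form `Tr(δ ∧ δ ∧ Σ)`, the second-order term of the variation of the action up to the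
factor `-λ`. -/
noncomputable def secondVariation (Ψ : C2Form) (δ : M2Form) (y : E4) : ℂ :=
  Matrix.trace (w22 (w11 (δ y) (δ y) : Fin 4 → Fin 4 → Matrix (Fin 2) (Fin 2) ℂ) (sigma Ψ y)
    : Matrix (Fin 2) (Fin 2) ℂ)

theorem contDiffOn_firstVariation (h : IsSmoothCoframe V Ψ) (hA : IsSmoothSu2 V A)
    (hδ : IsSmoothSu2 V δ) : ContDiffOn ℝ ∞ (firstVariation Ψ A δ) V :=
  have hmul (κ μ ν ρ : Fin 4) := (hδ.smooth κ).mul (hA.smoothOnM_elForm h μ ν ρ)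
  ((((hmul _ _ _ _).sub (hmul _ _ _ _)).add (hmul _ _ _ _)).sub (hmul _ _ _ _)).contDiffOn_trace

theorem contDiffOn_secondVariation (h : IsSmoothCoframe V Ψ) (hδ : IsSmoothSu2 V δ) :
    ContDiffOn ℝ ∞ (secondVariation Ψ δ) V :=
  have hδδ (μ ν : Fin 4) : SmoothOnM V fun y => δ y μ * δ y ν - δ y ν * δ y μ :=
    ((hδ.smooth μ).mul (hδ.smooth ν)).sub ((hδ.smooth ν).mul (hδ.smooth μ))
  have hmul (μ ν ρ κ : Fin 4) := (hδδ μ ν).mul (h.smoothOnM_sigma ρ κ)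
  ((((((hmul _ _ _ _).sub (hmul _ _ _ _)).add (hmul _ _ _ _)).add (hmul _ _ _ _)).sub
    (hmul _ _ _ _)).add (hmul _ _ _ _)).contDiffOn_trace

theorem contDiffOn_traceW12_sigma (h : IsSmoothCoframe V Ψ) (hδ : IsSmoothSu2 V δ)
    (μ ν ρ : Fin 4) : ContDiffOn ℝ ∞ (fun y => traceW12 δ (sigma Ψ) y μ ν ρ) V :=
  have hmul (μ ν ρ : Fin 4) := (hδ.smooth μ).mul (h.smoothOnM_sigma ν ρ)
  (((hmul _ _ _).sub (hmul _ _ _)).add (hmul _ _ _)).contDiffOn_trace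

theorem trace_w22_covD (h : IsSmoothCoframe V Ψ) (hδ : IsSmoothSu2 V δ) (A : M2Form)
    (hy : y ∈ V) :
    Matrix.trace (w22 (covD A δ y) (sigma Ψ y) : Matrix (Fin 2) (Fin 2) ℂ)
      = d3 (traceW12 δ (sigma Ψ)) y + firstVariation Ψ A δ y := by
  have hcovD : Matrix.trace (w22 (covD A δ y) (sigma Ψ y) : Matrix (Fin 2) (Fin 2) ℂ)
      = Matrix.trace (w22 (d1M δ y) (sigma Ψ y) : Matrix (Fin 2) (Fin 2) ℂ)
        + Matrix.trace (w22 (fun μ ν => (w11 (A y) (δ y) μ ν + w11 (δ y) (A y) μ ν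
          : Matrix (Fin 2) (Fin 2) ℂ)) (sigma Ψ y) : Matrix (Fin 2) (Fin 2) ℂ) := by
    simp only [w22, covD, Matrix.add_mul, Matrix.trace_add, Matrix.trace_sub]
    ring
  have hfirst : firstVariation Ψ A δ y
      = Matrix.trace (w13 (δ y) (d2M (sigma Ψ) y) : Matrix (Fin 2) (Fin 2) ℂ)
        + Matrix.trace (w13 (δ y) (elLin (sigma Ψ y) (A y)) : Matrix (Fin 2) (Fin 2) ℂ) := by
    simp only [firstVariation, w13, elForm_eq, Matrix.mul_add, Matrix.trace_add, Matrix.trace_sub]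
    ring
  rw [hcovD, hfirst, trace_w22_d1M (hδ.diffAtM h.isOpen hy)
    (fun μ ν => (h.smoothOnM_sigma μ ν).diffAtM h.isOpen hy), trace_w22_w11, add_assoc]

variable (lam mu nu : ℝ) (a : E4 → Fin 4 → ℂ)

theorem lagrangian_sub {B : M2Form} (hA : ∀ μ ν, (curv A y μ ν).trace = 0)
    (hB : ∀ μ ν, (curv B y μ ν).trace = 0) :
    lagrangian lam mu nu Ψ a B y - lagrangian lam mu nu Ψ a A y
      = -(lam : ℂ) * (Matrix.trace (w22 (curv B y) (sigma Ψ y) : Matrix (Fin 2) (Fin 2) ℂ)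
        - Matrix.trace (w22 (curv A y) (sigma Ψ y) : Matrix (Fin 2) (Fin 2) ℂ)) := by
  simp only [lagrangian, psiFpsi, Matrix.trace_add, Matrix.trace_smul, trace_w31_dag Ψ y hA,
    trace_w31_dag Ψ y hB, smul_eq_mul]
  ring

theorem lagrangian_add_smul_sub (h : IsSmoothCoframe V Ψ) (hA : IsSmoothSu2 V A)
    (hδ : IsSmoothSu2 V δ) (t : ℝ) (hy : y ∈ V) :
    lagrangian lam mu nu Ψ a (fun z μ => A z μ + (t : ℂ) • δ z μ) y
        - lagrangian lam mu nu Ψ a A y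
      = t * (-(lam : ℂ) * firstVariation Ψ A δ y)
        + (t : ℂ) ^ 2 * (-(lam : ℂ) * secondVariation Ψ δ y)
        + t * -(lam : ℂ) * d3 (traceW12 δ (sigma Ψ)) y := by
  rw [lagrangian_sub lam mu nu a (hA.trace_curv h.isOpen hy)
    ((hA.add_real_smul hδ t).trace_curv h.isOpen hy),
    curv_add_smul (hA.diffAtM h.isOpen hy) (hδ.diffAtM h.isOpen hy), trace_w22_add_smul,
    trace_w22_covD h hδ A hy, secondVariation]
  ring

theorem actionChange_eq (h : IsSmoothCoframe V Ψ) (hA : IsSmoothSu2 V A) (hδ : IsVariation V δ)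
    (t : ℝ) :
    actionChange lam mu nu V Ψ a A (fun y μ => (t : ℂ) • δ y μ)
      = t * (∫ y in V, (orient Ψ y : ℂ) * (-(lam : ℂ) * firstVariation Ψ A δ y))
        + (t : ℂ) ^ 2 * ∫ y in V, (orient Ψ y : ℂ) * (-(lam : ℂ) * secondVariation Ψ δ y) := by
  have hδs := hδ.isSmoothSu2
  have hfirst : IsTestFunction V (firstVariation Ψ A δ) :=
    hδ.isTestFunction (contDiffOn_firstVariation h hA hδs) fun y hy => by
      simp [firstVariation, w13, hy]
  have hsecond : IsTestFunction V (secondVariation Ψ δ) :=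
    hδ.isTestFunction (contDiffOn_secondVariation h hδs) fun y hy => by
      simp [secondVariation, w22, w11, hy]
  have hexact (μ ν ρ : Fin 4) : IsTestFunction V fun y => traceW12 δ (sigma Ψ) y μ ν ρ :=
    hδ.isTestFunction (contDiffOn_traceW12_sigma h hδs μ ν ρ) fun y hy => by
      simp [traceW12, w12, hy]
  have hpoint : ∀ y ∈ V, (orient Ψ y : ℂ) * (lagrangian lam mu nu Ψ a
        (fun z μ => A z μ + (t : ℂ) • δ z μ) y - lagrangian lam mu nu Ψ a A y)
      = t * ((orient Ψ y : ℂ) * (-(lam : ℂ) * firstVariation Ψ A δ y))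
        + (t : ℂ) ^ 2 * ((orient Ψ y : ℂ) * (-(lam : ℂ) * secondVariation Ψ δ y))
        + t * -(lam : ℂ) * ((orient Ψ y : ℂ) * d3 (traceW12 δ (sigma Ψ)) y) := fun y hy => by
    rw [lagrangian_add_smul_sub lam mu nu a h hA hδs t hy]
    ring
  have ifirst := (integrableOn_orient_mul h (hfirst.const_mul (-(lam : ℂ)))).const_mul (t : ℂ)
  have isecond :=
    (integrableOn_orient_mul h (hsecond.const_mul (-(lam : ℂ)))).const_mul ((t : ℂ) ^ 2)
  have iexact := (integrableOn_orient_mul_d3 h hexact).const_mul (t * -(lam : ℂ))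
  rw [actionChange, setIntegral_congr_fun h.isOpen.measurableSet hpoint,
    integral_add (ifirst.fun_add isecond) iexact, integral_add ifirst isecond, integral_const_mul,
    integral_const_mul, integral_const_mul, setIntegral_orient_mul_d3 h hexact, mul_zero, add_zero]

theorem hasDerivAt_actionChange (h : IsSmoothCoframe V Ψ) (hA : IsSmoothSu2 V A)
    (hδ : IsVariation V δ) :
    HasDerivAt (fun t : ℝ => actionChange lam mu nu V Ψ a A (fun y μ => (t : ℂ) • δ y μ))
      (∫ y in V, (orient Ψ y : ℂ) * (-(lam : ℂ) * firstVariation Ψ A δ y)) 0 := by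
  have hquadratic (b c : ℂ) : HasDerivAt (fun t : ℝ => (t : ℂ) * b + (t : ℂ) ^ 2 * c) b 0 := by
    have hid : HasDerivAt (fun t : ℝ => (t : ℂ)) 1 0 := Complex.ofRealCLM.hasDerivAt
    simpa using (hid.mul_const b).fun_add ((hid.fun_pow 2).mul_const c)
  simpa only [actionChange_eq lam mu nu a h hA hδ] using hquadratic _ _

end Variation

section EulerLagrange

variable {V : Set E4} {Ψ : C2Form} {A : M2Form} {y : E4}

theorem isVariation_smul {φ : E4 → ℝ} (hφ : ContDiff ℝ ∞ φ) (hc : HasCompactSupport φ)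
    (hs : tsupport φ ⊆ V) {X : Fin 4 → Matrix (Fin 2) (Fin 2) ℂ} (hX : ∀ μ, IsSu2 (X μ)) :
    IsVariation V fun y μ => φ y • X μ := by
  refine ⟨fun μ c d => hφ.smul contDiff_const, fun y μ => su2.smul_mem _ (hX μ), tsupport φ, hc,
    hs, fun y hy μ => ?_⟩
  simp only [image_eq_zero_of_notMem_tsupport hy, zero_smul]

theorem trace_w13_elForm_eq_zero (h : IsSmoothCoframe V Ψ) (hA : IsSmoothSu2 V A)
    (hintegral : ∀ δ, IsVariation V δ → ∫ y in V, (orient Ψ y : ℂ) * firstVariation Ψ A δ y = 0)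
    {X : Fin 4 → Matrix (Fin 2) (Fin 2) ℂ} (hX : ∀ μ, IsSu2 (X μ)) (hy : y ∈ V) :
    Matrix.trace (w13 X (elForm Ψ y (A y)) : Matrix (Fin 2) (Fin 2) ℂ) = 0 := by
  have hconst : IsSmoothSu2 V fun _ => X := ⟨fun μ i j => contDiffOn_const, fun _ _ => hX⟩
  refine eq_zero_of_setIntegral_orient_mul (f := firstVariation Ψ A fun _ => X) h
    (contDiffOn_firstVariation h hA hconst).continuousOn (fun φ hφ hc hs => ?_) hy
  rw [← hintegral _ (isVariation_smul hφ hc hs hX)]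
  congr 1
  funext z
  simp only [firstVariation, w13, Matrix.smul_mul, Matrix.trace_add, Matrix.trace_sub,
    Matrix.trace_smul, Complex.real_smul]
  ring

theorem elForm_eq_zero_of_setIntegral (h : IsSmoothCoframe V Ψ) (hA : IsSmoothSu2 V A)
    (hintegral : ∀ δ, IsVariation V δ → ∫ y in V, (orient Ψ y : ℂ) * firstVariation Ψ A δ y = 0)
    (hy : y ∈ V) : elForm Ψ y (A y) = 0 := by
  have hsu2 := h.isSu2_elForm hy (hA.isSu2 y hy)
  have htest (κ μ ν ρ : Fin 4) : Matrix.trace (w13 (Pi.single κ (elForm Ψ y (A y) μ ν ρ))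
      (elForm Ψ y (A y)) : Matrix (Fin 2) (Fin 2) ℂ) = 0 := by
    refine trace_w13_elForm_eq_zero h hA hintegral (fun ι => ?_) hy
    rw [Pi.single_apply]
    split_ifs
    exacts [hsu2 μ ν ρ, su2.zero_mem]
  have : IsAddTorsionFree (Matrix (Fin 2) (Fin 2) ℂ) :=
    inferInstanceAs (IsAddTorsionFree (Fin 2 → Fin 2 → ℂ))
  refine eq_zero_of_antisymm (elForm_swap_left Ψ y _) (elForm_swap_right Ψ y _)
    ((hsu2 0 1 2).eq_zero_of_trace_mul_self ?_) ((hsu2 0 1 3).eq_zero_of_trace_mul_self ?_)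
    ((hsu2 0 2 3).eq_zero_of_trace_mul_self ?_) ((hsu2 1 2 3).eq_zero_of_trace_mul_self ?_)
  · simpa [w13] using htest 3 0 1 2
  · simpa [w13] using htest 2 0 1 3
  · simpa [w13] using htest 1 0 2 3
  · simpa [w13] using htest 0 1 2 3

variable {M : Type*} [TopologicalSpace M] [ChartedSpace E4 M] {P : U2Structure M}

theorem IsSU2Connection.isSmoothSu2 {A : ℕ → M2Form} (hA : IsSU2Connection P A) (i : ℕ) :
    IsSmoothSu2 (P.chart i).target (A i) :=
  ⟨fun μ c d => hA.1 i μ c d, hA.2.1 i⟩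

theorem isStationary_iff {lam : ℝ} (hlam : lam ≠ 0) (mu nu : ℝ) (a : ℕ → E4 → Fin 4 → ℂ)
    {A : ℕ → M2Form} (hA : IsSU2Connection P A) :
    IsStationary lam mu nu P a A ↔
      ∀ i, ∀ y ∈ (P.chart i).target, elForm (P.Psi i) y (A i y) = 0 := by
  have hderiv (i : ℕ) (δ : M2Form) (hδ : IsVariation (P.chart i).target δ) :=
    hasDerivAt_actionChange lam mu nu (a i) (P.isSmoothCoframe i) (hA.isSmoothSu2 i) hδ
  simp only [mul_left_comm _ (-(lam : ℂ)), integral_const_mul] at hderiv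
  refine ⟨fun hs i y => elForm_eq_zero_of_setIntegral (P.isSmoothCoframe i) (hA.isSmoothSu2 i)
    fun δ hδ => ?_, fun hEL i δ hδ => ?_⟩
  · have hzero := (hderiv i δ hδ).unique (hs i δ hδ)
    exact (mul_eq_zero.1 hzero).resolve_left (neg_ne_zero.2 (Complex.ofReal_ne_zero.2 hlam))
  · have hzero : Set.EqOn (fun y => (orient (P.Psi i) y : ℂ) * firstVariation (P.Psi i) (A i) δ y)
        (fun _ => 0) (P.chart i).target := fun y hy => by
      simp [firstVariation, hEL i y hy, w13]
    simpa only [setIntegral_congr_fun (P.chart i).open_target.measurableSet hzero, integral_zero,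
      mul_zero] using hderiv i δ hδ

end EulerLagrange

/-! ### The curvature of the anti-self-dual connection -/

section AsdCurvature

variable {X Y : Matrix (Fin 4) (Fin 4) ℝ}

theorem asd_commutator (hX : Xᵀ = -X) (hY : Yᵀ = -Y) :
    asd (X * Y - Y * X) = asd X * asd Y - asd Y * asd X := by
  have hXY : (X * Y - Y * X)ᵀ = -(X * Y - Y * X) := by
    simp only [Matrix.transpose_sub, Matrix.transpose_mul, hX, hY, neg_mul_neg, neg_sub]
  have sX := skew_apply hX
  have dX := skew_diag hX
  have sY := skew_apply hY
  have dY := skew_diag hY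
  rw [asd_eq hXY, asd_eq hX, asd_eq hY]
  apply matrix_ext_two <;>
  · simp only [Matrix.sub_apply, Matrix.mul_apply, Fin.sum_univ_two, Fin.sum_univ_four,
      Matrix.of_apply, Matrix.cons_val', Matrix.cons_val_zero, Matrix.cons_val_one,
      Matrix.cons_val_fin_one, dX, dY, sX 1 0, sX 2 0, sX 2 1, sX 3 1, sX 3 2, sY 1 0,
      sY 2 0, sY 2 1, sY 3 1, sY 3 2]
    push_cast
    ring_nf <;> simp only [Complex.I_sq] <;> ring

theorem trace_asd_mul_asd (hX : Xᵀ = -X) (hY : Yᵀ = -Y) :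
    (asd X * asd Y).trace = (1 / 4 * (X * (Y - hodge Y)).trace : ℝ) := by
  have sX := skew_apply hX
  have dX := skew_diag hX
  have sY := skew_apply hY
  have dY := skew_diag hY
  rw [asd_eq hX, asd_eq hY, Matrix.trace_fin_two, Matrix.trace]
  apply Complex.ext <;>
  simp [Matrix.mul_apply, Fin.sum_univ_two, Fin.sum_univ_four, hodge, dX, dY, sX 1 0, sX 2 0,
    sX 3 0, sX 2 1, sX 3 1, sX 3 2, sY 1 0, sY 2 0, sY 3 0, sY 2 1, sY 3 1, sY 3 2] <;> ring

end AsdCurvature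

section Kaehler

variable (Ψ : C2Form) (y : E4)

theorem det_fin_four {R : Type*} [CommRing R] (e : Matrix (Fin 4) (Fin 4) R) :
    e.det = w22 (w11 (e 0) (e 1)) (w11 (e 2) (e 3)) := by
  rw [Matrix.det_succ_row_zero]
  simp [Fin.sum_univ_succ, Matrix.det_fin_three, Fin.succAbove, w22, w11]
  ring

theorem volForm_eq_w22 : volForm Ψ y = w22 (ee Ψ y 0 1) (ee Ψ y 2 3) :=
  det_fin_four _

theorem omega_eq_ee (μ ν : Fin 4) : omega Ψ y μ ν = ee Ψ y 0 1 μ ν + ee Ψ y 2 3 μ ν := by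
  simp [omega, ee, w11, coframe, Fin.sum_univ_two]
  ring

theorem w22_omega_omega : w22 (omega Ψ y) (omega Ψ y) = 2 * volForm Ψ y := by
  simp only [volForm_eq_w22, w22, omega_eq_ee, ee, w11]
  ring

theorem sign_mul_self_eq_abs (r : ℝ) : Real.sign r * r = |r| := by
  rcases lt_trichotomy r 0 with hr | rfl | hr
  · rw [Real.sign_of_neg hr, abs_of_neg hr, neg_one_mul]
  · rw [mul_zero, abs_zero]
  · rw [Real.sign_of_pos hr, abs_of_pos hr, one_mul]

theorem sign_mul_abs_eq_self (r : ℝ) : Real.sign r * |r| = r := by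
  rcases lt_trichotomy r 0 with hr | rfl | hr
  · rw [Real.sign_of_neg hr, abs_of_neg hr, neg_one_mul, neg_neg]
  · rw [abs_zero, mul_zero]
  · rw [Real.sign_of_pos hr, abs_of_pos hr, one_mul]

theorem sign_mul_of_pos {c : ℝ} (hc : 0 < c) (r : ℝ) : Real.sign (c * r) = Real.sign r := by
  rcases lt_trichotomy r 0 with hr | rfl | hr
  · rw [Real.sign_of_neg hr, Real.sign_of_neg (mul_neg_of_pos_of_neg hc hr)]
  · rw [mul_zero]
  · rw [Real.sign_of_pos hr, Real.sign_of_pos (mul_pos hc hr)]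

theorem sign_w22_omega_omega : Real.sign (w22 (omega Ψ y) (omega Ψ y)) = orient Ψ y := by
  rw [w22_omega_omega, sign_mul_of_pos two_pos, orient]

theorem sqrt_det_metric : Real.sqrt (metric Ψ y).det = |volForm Ψ y| := by
  rw [det_metric, Real.sqrt_sq_eq_abs, volForm]

theorem volForm_eq : volForm Ψ y =
    Real.sign (w22 (omega Ψ y) (omega Ψ y)) * Real.sqrt (metric Ψ y).det := by
  rw [sign_w22_omega_omega, sqrt_det_metric, orient, sign_mul_abs_eq_self]

theorem dagPsi_eq (μ ν : Fin 4) : dagPsi Ψ y μ ν 0 0 = 2 * Complex.I * omega Ψ y μ ν := by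
  apply Complex.ext <;> simp [omega, dagPsi, dag, w11, Matrix.mul_apply, Fin.sum_univ_two] <;> ring

theorem omega_dagPsi (μ ν : Fin 4) :
    (omega Ψ y μ ν : ℂ) = 1 / (2 * Complex.I) * dagPsi Ψ y μ ν 0 0 := by
  rw [dagPsi_eq]
  field_simp

theorem trace_w22_dagPsi (σ : Fin 4 → Fin 4 → Matrix (Fin 1) (Fin 1) ℂ) :
    Matrix.trace (w22 σ (dagPsi Ψ y) : Matrix (Fin 1) (Fin 1) ℂ)
      = 2 * Complex.I * w22 (fun μ ν => σ μ ν 0 0) (fun μ ν => (omega Ψ y μ ν : ℂ)) := by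
  simp only [w22, Matrix.trace_fin_one, Matrix.add_apply, Matrix.sub_apply, Matrix.mul_apply,
    Finset.univ_unique, Fin.default_eq_zero, Finset.sum_singleton, dagPsi_eq]
  ring

theorem trace_dagPsi_sq :
    Matrix.trace (w22 (dagPsi Ψ y) (dagPsi Ψ y) : Matrix (Fin 1) (Fin 1) ℂ)
      = -8 * (volForm Ψ y : ℂ) := by
  have hsq : ((w22 (omega Ψ y) (omega Ψ y) : ℝ) : ℂ) = 2 * volForm Ψ y := by
    rw [w22_omega_omega, Complex.ofReal_mul, Complex.ofReal_ofNat]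
  simp only [w22] at hsq
  push_cast at hsq
  rw [trace_w22_dagPsi]
  simp only [dagPsi_eq, w22]
  linear_combination 4 * Complex.I ^ 2 * hsq + 8 * (volForm Ψ y : ℂ) * Complex.I_sq

theorem trace_w22_smul_one_dagPsi (f : Fin 4 → Fin 4 → ℂ) :
    Matrix.trace (w22 (fun μ ν => !![f μ ν]) (dagPsi Ψ y) : Matrix (Fin 1) (Fin 1) ℂ)
      = 2 * w22 (fun κ ι => (omega Ψ y κ ι : ℂ)) (fun κ ι => Complex.I * f κ ι) := by
  rw [trace_w22_dagPsi]
  simp only [w22, Matrix.of_apply, Matrix.cons_val', Matrix.cons_val_fin_one]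
  ring

end Kaehler

/-! ### Scalar curvature -/

section ScalarCurvature

variable {U : Set E4} {Ψ : C2Form} {y : E4}

/-- The `4`-form `¼ ε_{IJKL} R^{IJ} ∧ e^K ∧ e^L`, summed over `I < J` and `K < L`. -/
noncomputable def epsCurv (Ψ : C2Form) (y : E4) : ℝ :=
  w22 (lcCurv Ψ y 0 1) (ee Ψ y 2 3) - w22 (lcCurv Ψ y 0 2) (ee Ψ y 1 3)
    + w22 (lcCurv Ψ y 0 3) (ee Ψ y 1 2) + w22 (lcCurv Ψ y 1 2) (ee Ψ y 0 3)
    - w22 (lcCurv Ψ y 1 3) (ee Ψ y 0 2) + w22 (lcCurv Ψ y 2 3) (ee Ψ y 0 1)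

/-- The components `τ_{KL}` of a `2`-form `τ = ½ τ_{KL} e^K ∧ e^L` in the coframe of `Ψ`. -/
noncomputable def frameComponents (Ψ : C2Form) (y : E4) (τ : Fin 4 → Fin 4 → ℝ) :
    Matrix (Fin 4) (Fin 4) ℝ :=
  (coframe Ψ y)⁻¹ᵀ * Matrix.of τ * (coframe Ψ y)⁻¹

theorem frameComponents_neg (τ : Fin 4 → Fin 4 → ℝ) :
    frameComponents Ψ y (-τ) = -frameComponents Ψ y τ := by
  rw [frameComponents, ← Matrix.neg_of, Matrix.mul_neg, Matrix.neg_mul, frameComponents]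

theorem transpose_frameComponents {τ : Fin 4 → Fin 4 → ℝ} (hτ : ∀ μ ν, τ μ ν = -τ ν μ) :
    (frameComponents Ψ y τ)ᵀ = -frameComponents Ψ y τ := by
  have hskew : (Matrix.of τ)ᵀ = -Matrix.of τ := Matrix.ext fun μ ν => hτ ν μ
  simp only [frameComponents, Matrix.transpose_mul, Matrix.transpose_transpose, hskew,
    Matrix.neg_mul, Matrix.mul_neg, Matrix.mul_assoc]

theorem transpose_mul_frameComponents_mul (hdet : (coframe Ψ y).det ≠ 0)
    (τ : Fin 4 → Fin 4 → ℝ) :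
    (coframe Ψ y)ᵀ * frameComponents Ψ y τ * coframe Ψ y = Matrix.of τ := by
  have hinv : (coframe Ψ y)⁻¹ * coframe Ψ y = 1 := Matrix.nonsing_inv_mul _ hdet.isUnit
  rw [frameComponents, ← Matrix.mul_assoc, ← Matrix.mul_assoc, ← Matrix.transpose_mul, hinv,
    Matrix.transpose_one, Matrix.one_mul, Matrix.mul_assoc, hinv, Matrix.mul_one]

theorem w22_ee (hdet : (coframe Ψ y).det ≠ 0) {τ : Fin 4 → Fin 4 → ℝ}
    (hτ : ∀ μ ν, τ μ ν = -τ ν μ) :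
    w22 τ (ee Ψ y 2 3) = frameComponents Ψ y τ 0 1 * volForm Ψ y ∧
    w22 τ (ee Ψ y 1 3) = -(frameComponents Ψ y τ 0 2 * volForm Ψ y) ∧
    w22 τ (ee Ψ y 1 2) = frameComponents Ψ y τ 0 3 * volForm Ψ y ∧
    w22 τ (ee Ψ y 0 3) = frameComponents Ψ y τ 1 2 * volForm Ψ y ∧
    w22 τ (ee Ψ y 0 2) = -(frameComponents Ψ y τ 1 3 * volForm Ψ y) ∧
    w22 τ (ee Ψ y 0 1) = frameComponents Ψ y τ 2 3 * volForm Ψ y := by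
  have hframe (μ ν : Fin 4) :
      τ μ ν = ((coframe Ψ y)ᵀ * frameComponents Ψ y τ * coframe Ψ y) μ ν := by
    rw [transpose_mul_frameComponents_mul hdet, Matrix.of_apply]
  have s := skew_apply (transpose_frameComponents (Ψ := Ψ) (y := y) hτ)
  have d := skew_diag (transpose_frameComponents (Ψ := Ψ) (y := y) hτ)
  rw [volForm_eq_w22]
  refine ⟨?_, ?_, ?_, ?_, ?_, ?_⟩ <;>
  · simp only [w22, hframe, ee, w11, Matrix.mul_apply, Fin.sum_univ_four, Matrix.transpose_apply,
      d, s 1 0, s 2 0, s 3 0, s 2 1, s 3 1, s 3 2]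
    ring

theorem lcCurv_antisymm (I J μ ν : Fin 4) : lcCurv Ψ y I J μ ν = -lcCurv Ψ y I J ν μ :=
  congrFun₂ (lcCurvMatrix_swap Ψ y μ ν) I J

theorem w22_w11_comm (α β : Fin 4 → ℝ) (τ : Fin 4 → Fin 4 → ℝ) :
    w22 τ (w11 α β) = w13 α (w12 β τ) := by
  simp only [w22, w11, w13, w12]
  ring

theorem trace_mul_sub_hodge {X Y : Matrix (Fin 4) (Fin 4) ℝ} (hX : Xᵀ = -X) (hY : Yᵀ = -Y) :
    (X * (Y - hodge Y)).trace
      = 2 * (X 0 1 * Y 2 3 - X 0 2 * Y 1 3 + X 0 3 * Y 1 2 + X 1 2 * Y 0 3 - X 1 3 * Y 0 2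
          + X 2 3 * Y 0 1)
        - 2 * (X 0 1 * Y 0 1 + X 0 2 * Y 0 2 + X 0 3 * Y 0 3 + X 1 2 * Y 1 2 + X 1 3 * Y 1 3
          + X 2 3 * Y 2 3) := by
  have s := skew_apply hX
  have t := skew_apply hY
  simp [Matrix.trace, Matrix.mul_apply, Fin.sum_univ_four, hodge, skew_diag hX, skew_diag hY,
    s 1 0, s 2 0, s 3 0, s 2 1, s 3 1, s 3 2, t 1 0, t 2 0, t 3 0, t 2 1, t 3 1, t 3 2]
  ring

theorem transpose_ee (Ψ : C2Form) (y : E4) (μ ν : Fin 4) :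
    (Matrix.of fun K L => ee Ψ y K L μ ν)ᵀ = -Matrix.of fun K L => ee Ψ y K L μ ν := by
  ext K L
  simp only [Matrix.transpose_apply, Matrix.neg_apply, Matrix.of_apply, ee, w11]
  ring

theorem sigma_eq_asd (Ψ : C2Form) (y : E4) (μ ν : Fin 4) :
    sigma Ψ y μ ν = (2 : ℝ) • asd (Matrix.of fun K L => ee Ψ y K L μ ν) := by
  rw [asd_eq (transpose_ee Ψ y μ ν)]
  apply matrix_ext_two <;> apply Complex.ext <;>
  simp [sigma, dagPsi, dag, Matrix.mul_apply, Fin.sum_univ_two, ee, w11, coframe] <;> ring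

namespace IsSmoothCoframe

variable (h : IsSmoothCoframe U Ψ)
include h

theorem lcCurv_swap (hy : y ∈ U) (I J : Fin 4) : lcCurv Ψ y I J = -lcCurv Ψ y J I :=
  funext₂ fun μ ν => skew_apply (h.transpose_lcCurvMatrix hy μ ν) I J

theorem curv_asdLeviCivita (hy : y ∈ U) (μ ν : Fin 4) :
    curv (asdLeviCivita Ψ) y μ ν = asd (lcCurvMatrix Ψ y μ ν) := by
  have hd (μ : Fin 4) := (h.smoothOnM_leviCivita μ).diffAtM h.isOpen hy
  simp only [curv, d1M_eq_pdM, w11, asdLeviCivita_eq, pdM_linearMap asd (hd _), lcCurvMatrix_eq,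
    map_add, map_sub, asd_commutator (h.transpose_leviCivita hy μ) (h.transpose_leviCivita hy ν)]

theorem sum_w12_coframe_lcCurv (hy : y ∈ U) (I μ ν ρ : Fin 4) :
    ∑ J, w12 (coframe Ψ y J) (lcCurv Ψ y I J) μ ν ρ = 0 := by
  rw [← h.lcCurvMatrix_bianchi hy I μ ν ρ, lcCurvMatrix_swap Ψ y ρ μ]
  simp only [Matrix.mul_apply, Matrix.neg_apply, ← Finset.sum_add_distrib]
  refine Finset.sum_congr rfl fun J _ => ?_
  simp only [w12, lcCurvMatrix, Matrix.of_apply]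
  ring

theorem sum_w22_lcCurv_ee (hy : y ∈ U) :
    ∑ I, ∑ J, w22 (lcCurv Ψ y I J) (ee Ψ y I J) = 0 := by
  refine Finset.sum_eq_zero fun I _ => ?_
  simp only [ee, w22_w11_comm, w13, Finset.sum_add_distrib, Finset.sum_sub_distrib,
    ← Finset.mul_sum, h.sum_w12_coframe_lcCurv hy, mul_zero, sub_zero, add_zero]

theorem trace_curv_mul_sigma (hy : y ∈ U) (μ ν ρ κ : Fin 4) :
    (curv (asdLeviCivita Ψ) y μ ν * sigma Ψ y ρ κ).trace
      = (1 / 2 * (lcCurvMatrix Ψ y μ ν * (Matrix.of (fun K L => ee Ψ y K L ρ κ)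
        - hodge (Matrix.of fun K L => ee Ψ y K L ρ κ))).trace : ℝ) := by
  rw [h.curv_asdLeviCivita hy, sigma_eq_asd, Matrix.mul_smul, Matrix.trace_smul,
    trace_asd_mul_asd (h.transpose_lcCurvMatrix hy μ ν) (transpose_ee Ψ y ρ κ), Complex.real_smul,
    ← Complex.ofReal_mul]
  congr 1
  ring

theorem trace_psiFpsi (hy : y ∈ U) :
    Matrix.trace (psiFpsi Ψ (asdLeviCivita Ψ) y) = -(epsCurv Ψ y : ℂ) := by
  rw [psiFpsi, trace_w31_dag Ψ y fun μ ν => by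
    rw [h.curv_asdLeviCivita hy]; exact (isSu2_asd (h.transpose_lcCurvMatrix hy μ ν)).2]
  simp only [w22, Matrix.trace_add, Matrix.trace_sub, h.trace_curv_mul_sigma hy,
    ← Complex.ofReal_add, ← Complex.ofReal_sub]
  congr 2
  have hbianchi := h.sum_w22_lcCurv_ee hy
  have s (μ ν : Fin 4) := skew_apply (h.transpose_lcCurvMatrix hy μ ν)
  have d (μ ν : Fin 4) := skew_diag (h.transpose_lcCurvMatrix hy μ ν)
  have s' (μ ν : Fin 4) := skew_apply (transpose_ee Ψ y μ ν)
  simp only [lcCurvMatrix, Matrix.of_apply] at s d s'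
  simp only [Fin.sum_univ_four, w22, d, s _ _ 1 0, s _ _ 2 0, s _ _ 3 0, s _ _ 2 1, s _ _ 3 1,
    s _ _ 3 2, s' _ _ 1 0, s' _ _ 2 0, s' _ _ 3 0, s' _ _ 2 1, s' _ _ 3 1, s' _ _ 3 2] at hbianchi
  simp only [trace_mul_sub_hodge (h.transpose_lcCurvMatrix hy _ _) (transpose_ee Ψ y _ _)]
  simp only [epsCurv, w22, lcCurvMatrix, Matrix.of_apply]
  linear_combination (-1 / 2) * hbianchi

theorem riemannMatrix_mul_inv_metric (hy : y ∈ U) (μ ν : Fin 4) :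
    riemannMatrix (metric Ψ) μ ν y * (metric Ψ y)⁻¹
      = (coframe Ψ y)⁻¹ * lcCurvMatrix Ψ y μ ν * (coframe Ψ y)⁻¹ᵀ := by
  have hmetric : coframe Ψ y * (metric Ψ y)⁻¹ = (coframe Ψ y)⁻¹ᵀ := by
    rw [metric_eq_transpose_mul, Matrix.mul_inv_rev, ← Matrix.mul_assoc, h.coframe_mul_inv hy,
      Matrix.one_mul, Matrix.transpose_nonsing_inv]
  rw [← hmetric, ← Matrix.mul_assoc, Matrix.mul_assoc (coframe Ψ y)⁻¹,
    h.lcCurvMatrix_mul_coframe hy, ← Matrix.mul_assoc, h.inv_mul_coframe hy, Matrix.one_mul]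

theorem traceRicci_eq (hy : y ∈ U) :
    traceRicci (metric Ψ) y = ∑ I, ∑ J, frameComponents Ψ y (lcCurv Ψ y I J) I J := by
  calc traceRicci (metric Ψ) y
      = ∑ ν, ∑ ρ, (riemannMatrix (metric Ψ) ρ ν y * (metric Ψ y)⁻¹) ρ ν := by
        simp only [traceRicci, ricci, riemannMatrix, Matrix.mul_apply, Matrix.of_apply,
          Finset.mul_sum, mul_comm]
        rw [Finset.sum_comm]
        exact Finset.sum_congr rfl fun ν _ => Finset.sum_comm
    _ = ∑ ν, ∑ ρ, ∑ J, ∑ I,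
          (coframe Ψ y)⁻¹ ρ I * lcCurv Ψ y I J ρ ν * (coframe Ψ y)⁻¹ ν J := by
        refine Finset.sum_congr rfl fun ν _ => Finset.sum_congr rfl fun ρ _ => ?_
        rw [h.riemannMatrix_mul_inv_metric hy]
        simp only [Matrix.mul_apply, Finset.sum_mul, Matrix.transpose_apply, lcCurvMatrix,
          Matrix.of_apply]
    _ = ∑ I, ∑ J, ∑ ν, ∑ ρ,
          (coframe Ψ y)⁻¹ ρ I * lcCurv Ψ y I J ρ ν * (coframe Ψ y)⁻¹ ν J := by
        refine (Finset.sum_congr rfl fun ν _ => (Finset.sum_congr rfl fun ρ _ =>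
          Finset.sum_comm).trans Finset.sum_comm).trans (Finset.sum_comm.trans ?_)
        exact Finset.sum_congr rfl fun I _ =>
          (Finset.sum_congr rfl fun ν _ => Finset.sum_comm).trans Finset.sum_comm
    _ = ∑ I, ∑ J, frameComponents Ψ y (lcCurv Ψ y I J) I J := by
        simp only [frameComponents, Matrix.mul_apply, Finset.sum_mul, Matrix.transpose_apply,
          Matrix.of_apply]

theorem epsCurv_eq (hy : y ∈ U) :
    epsCurv Ψ y = 1 / 2 * (∑ I, ∑ J, frameComponents Ψ y (lcCurv Ψ y I J) I J) * volForm Ψ y := by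
  have hw (I J : Fin 4) := w22_ee (h.nondeg y hy) (lcCurv_antisymm (Ψ := Ψ) (y := y) I J)
  have hskew (I J : Fin 4) :=
    transpose_frameComponents (Ψ := Ψ) (y := y) (lcCurv_antisymm (Ψ := Ψ) (y := y) I J)
  have hdiag (I : Fin 4) : frameComponents Ψ y (lcCurv Ψ y I I) I I = 0 := skew_diag (hskew I I) I
  have hswap (I J : Fin 4) : frameComponents Ψ y (lcCurv Ψ y J I) J I
      = frameComponents Ψ y (lcCurv Ψ y I J) I J := by
    rw [h.lcCurv_swap hy J I, frameComponents_neg, Matrix.neg_apply, skew_apply (hskew I J) J I,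
      neg_neg]
  rw [epsCurv, (hw 0 1).1, (hw 0 2).2.1, (hw 0 3).2.2.1, (hw 1 2).2.2.2.1, (hw 1 3).2.2.2.2.1,
    (hw 2 3).2.2.2.2.2]
  simp only [Fin.sum_univ_four, hdiag, hswap 0 1, hswap 0 2, hswap 0 3, hswap 1 2, hswap 1 3,
    hswap 2 3]
  ring

theorem scalarCurv_mul_volForm (hy : y ∈ U) :
    scalarCurv (metric Ψ) y * volForm Ψ y = epsCurv Ψ y := by
  rw [scalarCurv, h.traceRicci_eq hy, h.epsCurv_eq hy]

theorem lagrangian_asdLeviCivita {lam mu nu : ℝ} (hlam : lam ≠ 0)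
    (hrel : 3 * lam - mu + 4 * nu = 0) (a : E4 → Fin 4 → ℂ) (hy : y ∈ U) :
    lagrangian lam mu nu Ψ a (asdLeviCivita Ψ) y
      = -(lam : ℂ) * ((volForm Ψ y : ℂ)
          * ((scalarCurv (metric Ψ) y + 2 * (mu / lam) - 6 : ℝ) : ℂ)
        - 2 * ((mu / lam : ℝ) : ℂ) * w22 (fun κ ι => (omega Ψ y κ ι : ℂ))
            (fun κ ι => Complex.I * d1 a y κ ι)) := by
  have hlam' : (lam : ℂ) ≠ 0 := Complex.ofReal_ne_zero.2 hlam
  have hrel' : 3 * (lam : ℂ) - mu + 4 * nu = 0 := by exact_mod_cast hrel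
  simp only [lagrangian, Matrix.trace_add, Matrix.trace_smul, h.trace_psiFpsi hy,
    ← h.scalarCurv_mul_volForm hy, trace_dagPsi_sq, trace_w22_smul_one_dagPsi, smul_eq_mul]
  push_cast
  field_simp
  linear_combination (-2 * (volForm Ψ y : ℂ)) * hrel'

end IsSmoothCoframe

end ScalarCurvature

/-! ### Compatible pairs `(g, ω)` and `U(2)`-structures -/

section Uniqueness

open scoped ComplexOrder in
theorem exists_unitary_of_conjTranspose_mul_self_eq {m n : Type*} [Fintype m] [DecidableEq m]
    [Fintype n] {p q : Matrix m n ℂ} {r : Matrix n m ℂ} (hqr : q * r = 1)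
    (hpq : pᴴ * p = qᴴ * q) : ∃ u ∈ Matrix.unitaryGroup m ℂ, p = u * q := by
  classical
  refine ⟨p * r, Matrix.mem_unitaryGroup_iff'.2 ?_, ?_⟩
  · calc (p * r)ᴴ * (p * r) = rᴴ * (pᴴ * p) * r := by
          simp only [Matrix.conjTranspose_mul, Matrix.mul_assoc]
      _ = (q * r)ᴴ * (q * r) := by
          simp only [hpq, Matrix.conjTranspose_mul, Matrix.mul_assoc]
      _ = 1 := by rw [hqr, Matrix.conjTranspose_one, Matrix.one_mul]
  · have hq : q * (r * q - 1) = 0 := by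
      rw [Matrix.mul_sub, ← Matrix.mul_assoc, hqr, Matrix.one_mul, Matrix.mul_one, sub_self]
    have hp : p * (r * q - 1) = 0 := by
      rwa [← Matrix.conjTranspose_mul_self_mul_eq_zero, hpq,
        Matrix.conjTranspose_mul_self_mul_eq_zero]
    rw [Matrix.mul_sub, Matrix.mul_one, ← Matrix.mul_assoc, sub_eq_zero] at hp
    exact hp.symm

/-- The components of the coframe `Ψ` at `y` as a `2 × 4` matrix, whose column `μ` is `Ψ y μ`. -/
def psiMatrix (Ψ : C2Form) (y : E4) : Matrix (Fin 2) (Fin 4) ℂ :=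
  Matrix.of fun c μ => Ψ y μ c 0

theorem conjTranspose_psiMatrix_mul_self (Ψ : C2Form) (y : E4) :
    (psiMatrix Ψ y)ᴴ * psiMatrix Ψ y = (herm Ψ y)ᵀ := by
  ext μ ν
  simp only [psiMatrix, herm, Matrix.mul_apply, Matrix.conjTranspose_apply, Matrix.of_apply,
    Matrix.transpose_apply]

theorem exists_psiMatrix_mul_eq_one {Ψ : C2Form} {y : E4} (hdet : (coframe Ψ y).det ≠ 0) :
    ∃ r : Matrix (Fin 4) (Fin 2) ℂ, psiMatrix Ψ y * r = 1 := by
  refine ⟨Matrix.of fun μ c => ((coframe Ψ y)⁻¹ μ (![0, 2] c) : ℂ), ?_⟩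
  have hcol (i j) : (psiMatrix Ψ y * Matrix.of fun μ c => ((coframe Ψ y)⁻¹ μ (![0, 2] c) : ℂ)) i j
      = toC2 (Pi.single (![0, 2] j) 1) i 0 := by
    rw [← sum_inv_coframe_smul hdet, Matrix.mul_apply, Matrix.sum_apply]
    exact Finset.sum_congr rfl fun μ _ => mul_comm _ _
  apply matrix_ext_two <;> rw [hcol] <;> simp [toC2]

theorem metric_omega_eq_iff {Ψ Φ : C2Form} {y : E4} (hΦ : (coframe Φ y).det ≠ 0) :
    (metric Ψ y = metric Φ y ∧ omega Ψ y = omega Φ y) ↔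
      ∃ u ∈ Matrix.unitaryGroup (Fin 2) ℂ, ∀ μ, Ψ y μ = u * Φ y μ := by
  rw [← herm_eq_iff]
  refine ⟨fun h => ?_, fun ⟨_, hu, h⟩ =>
    herm_eq_of_unitary (Matrix.mem_unitaryGroup_iff'.1 hu) h⟩
  obtain ⟨r, hr⟩ := exists_psiMatrix_mul_eq_one hΦ
  obtain ⟨u, hu, hΨ⟩ := exists_unitary_of_conjTranspose_mul_self_eq (p := psiMatrix Ψ y) hr
    (by rw [conjTranspose_psiMatrix_mul_self, conjTranspose_psiMatrix_mul_self, h])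
  refine ⟨u, hu, fun μ => ?_⟩
  ext c d
  rw [Subsingleton.elim d 0]
  exact (congrFun₂ hΨ c μ).trans (by simp only [psiMatrix, Matrix.mul_apply, Matrix.of_apply])

end Uniqueness

section Compatible

/-- The Kähler form `e¹ ∧ e² + e³ ∧ e⁴` of the standard coframe, as a skew matrix. -/
def stdOmega : Matrix (Fin 4) (Fin 4) ℝ :=
  !![0, 1, 0, 0; -1, 0, 0, 0; 0, 0, 0, 1; 0, 0, -1, 0]

theorem omega_eq_transpose_mul (Ψ : C2Form) (y : E4) :
    omega Ψ y = (coframe Ψ y)ᵀ * stdOmega * coframe Ψ y := by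
  ext μ ν
  rw [omega_eq_ee]
  simp [ee, w11, Matrix.mul_apply, Fin.sum_univ_four, stdOmega]
  ring

theorem stdOmega_mul_self : stdOmega * stdOmega = -1 := by
  ext i j
  fin_cases i <;> fin_cases j <;> simp [stdOmega]

theorem transpose_stdOmega : stdOmegaᵀ = -stdOmega := by
  ext i j
  fin_cases i <;> fin_cases j <;> simp [stdOmega]

theorem IsSmoothCoframe.isCompatiblePair {U : Set E4} {Ψ : C2Form} (h : IsSmoothCoframe U Ψ) :
    IsCompatiblePair U (metric Ψ) (omega Ψ) where
  smooth_g := h.smoothOnM_metric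
  smooth_om μ ν := by
    have hs := h.smoothOnM_coframe
    simp only [omega_eq_ee, ee, w11]
    exact (((hs _ _).mul (hs _ _)).sub ((hs _ _).mul (hs _ _))).add
      (((hs _ _).mul (hs _ _)).sub ((hs _ _).mul (hs _ _)))
  posDef y hy := by
    rw [metric_eq_transpose_mul, ← Matrix.conjTranspose_eq_transpose_of_trivial]
    exact Matrix.PosDef.conjTranspose_mul_self _ (Matrix.mulVec_injective_of_isUnit
      (h.isUnit_coframe hy))
  skew y _ := by
    rw [omega_eq_transpose_mul, Matrix.transpose_mul, Matrix.transpose_mul, transpose_stdOmega,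
      Matrix.transpose_transpose, Matrix.neg_mul, Matrix.mul_neg, ← Matrix.mul_assoc]
  compat y hy := by
    have hinv := h.coframe_mul_inv hy
    have hinvT : ((coframe Ψ y)ᵀ)⁻¹ * (coframe Ψ y)ᵀ = 1 := by
      rw [← Matrix.transpose_nonsing_inv, ← Matrix.transpose_mul, hinv, Matrix.transpose_one]
    rw [metric_eq_transpose_mul, omega_eq_transpose_mul, Matrix.mul_inv_rev]
    set e := coframe Ψ y
    calc eᵀ * stdOmega * e * (e⁻¹ * eᵀ⁻¹) * (eᵀ * stdOmega * e)
        = eᵀ * stdOmega * (e * e⁻¹) * (eᵀ⁻¹ * eᵀ) * stdOmega * e := by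
          simp only [Matrix.mul_assoc]
      _ = eᵀ * (stdOmega * stdOmega) * e := by
          rw [hinv, hinvT, Matrix.mul_one, Matrix.mul_one, Matrix.mul_assoc eᵀ]
      _ = -(eᵀ * e) := by
          rw [stdOmega_mul_self, Matrix.mul_neg, Matrix.mul_one, Matrix.neg_mul]

end Compatible

/-! ### Local existence of a coframe for a compatible pair -/

section Cholesky

open scoped ComplexOrder in
theorem exists_re_diag_pos {n : Type*} [Fintype n] {K G : Matrix n n ℂ} {c : ℂ}
    (hc : 0 < c) (hG : G.PosSemidef) (hK : K.IsHermitian) (hKG : K * G * K = c • K)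
    (hne : K ≠ 0) : ∃ k, 0 < (K k k).re := by
  have hpos : K.PosSemidef := by
    have hconj : K = c⁻¹ • (Kᴴ * G * K) := by rw [hK.eq, hKG, inv_smul_smul₀ hc.ne']
    rw [hconj]
    exact (hG.conjTranspose_mul_mul_same K).smul (inv_pos_of_pos hc).le
  by_contra! hdiag
  refine hne (hpos.trace_eq_zero_iff.1 (Finset.sum_eq_zero fun k _ => ?_))
  exact le_antisymm (Complex.le_def.2 ⟨hdiag k, (Complex.le_def.1 hpos.diag_nonneg).2.symm⟩)
    hpos.diag_nonneg

theorem eq_zero_of_trace_mul_eq_zero {n 𝕜 : Type*} [Fintype n] [Field 𝕜] [CharZero 𝕜]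
    {K G : Matrix n n 𝕜} {c : 𝕜} (hc : c ≠ 0) (hKG : K * G * K = c • K)
    (htrace : (G * K).trace = 0) : K = 0 := by
  classical
  have hidem : IsIdempotentElem (c⁻¹ • (G * K)) := by
    rw [IsIdempotentElem, Matrix.smul_mul, Matrix.mul_smul, Matrix.mul_assoc G,
      ← Matrix.mul_assoc K, hKG, Matrix.mul_smul, inv_smul_smul₀ hc]
  have hzero : c⁻¹ • (G * K) = 0 := by
    apply Matrix.toLin'.injective
    have htoLin : IsIdempotentElem (Matrix.toLin' (c⁻¹ • (G * K))) :=
      hidem.map Matrix.toLinAlgEquiv'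
    rw [map_zero]
    refine LinearMap.IsIdempotentElem.eq_zero_of_trace_eq_zero htoLin ?_
    rw [Matrix.trace_toLin'_eq, Matrix.trace_smul, htrace, smul_zero]
  have hGK : G * K = 0 := (smul_eq_zero.1 hzero).resolve_left (inv_ne_zero hc)
  rw [Matrix.mul_assoc, hGK, Matrix.mul_zero, eq_comm, smul_eq_zero] at hKG
  exact hKG.resolve_left hc

open scoped ComplexOrder MatrixOrder in
theorem posSemidef_map_ofReal {n : Type*} [Finite n] {g : Matrix n n ℝ} (hg : g.PosSemidef) :
    (g.map Complex.ofReal).PosSemidef := by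
  classical
  have := Fintype.ofFinite n
  obtain ⟨b, hb⟩ := CStarAlgebra.nonneg_iff_eq_star_mul_self.mp hg.nonneg
  have hmap : g.map Complex.ofReal = (b.map Complex.ofReal)ᴴ * b.map Complex.ofReal := by
    ext i j
    simp [hb, Matrix.mul_apply, Matrix.star_eq_conjTranspose]
  rw [hmap]
  exact Matrix.posSemidef_conjTranspose_mul_self _

variable {n : Type*} [Fintype n] [DecidableEq n] {𝕜 : Type*} [Field 𝕜] {K G : Matrix n n 𝕜}
  {c : 𝕜} {k : n}

/-- One step of the Cholesky decomposition: the column `k` of `K`, normalised by the pivot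
`K k k`, contributes a matrix of rank one, and `cholStep K k` is what remains of `K`. -/
def cholStep (K : Matrix n n 𝕜) (k : n) : Matrix n n 𝕜 :=
  K - (K k k)⁻¹ • (K * Matrix.single k k 1 * K)

theorem cholStep_apply (K : Matrix n n 𝕜) (k μ ν : n) :
    cholStep K k μ ν = K μ ν - (K k k)⁻¹ * (K μ k * K k ν) := by
  simp [cholStep, Matrix.mul_apply, Matrix.single_apply, ite_and]

theorem isHermitian_cholStep [StarRing 𝕜] (hK : K.IsHermitian) (k : n) :
    (cholStep K k).IsHermitian := by
  ext i j
  simp only [Matrix.conjTranspose_apply, cholStep_apply, star_sub, star_mul, star_inv₀, hK.apply]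
  ring

theorem cholStep_mul_mul_cholStep (hKG : K * G * K = c • K) (hk : K k k ≠ 0) :
    cholStep K k * G * cholStep K k = c • cholStep K k := by
  set S : Matrix n n 𝕜 := Matrix.single k k 1 with hS
  have hSKS : S * K * S = K k k • S := by simp [hS]
  have hright : K * G * (K * S * K) = c • (K * S * K) := by
    rw [← Matrix.mul_assoc, ← Matrix.mul_assoc, hKG, Matrix.smul_mul, Matrix.smul_mul]
  have hleft : K * S * K * G * K = c • (K * S * K) := by
    rw [Matrix.mul_assoc (K * S), Matrix.mul_assoc (K * S), hKG, Matrix.mul_smul]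
  have hboth : K * S * K * G * (K * S * K) = (c * K k k) • (K * S * K) := by
    calc K * S * K * G * (K * S * K) = (K * S * K * G * K) * S * K := by
          simp only [Matrix.mul_assoc]
      _ = c • (K * (S * K * S) * K) := by
          rw [hleft]
          simp only [Matrix.smul_mul, Matrix.mul_assoc]
      _ = (c * K k k) • (K * S * K) := by
          rw [hSKS]
          simp only [Matrix.mul_smul, Matrix.smul_mul, smul_smul]
  simp only [cholStep, ← hS, Matrix.sub_mul, Matrix.mul_sub, Matrix.smul_mul, Matrix.mul_smul,
    hleft, hright, hboth, hKG, smul_sub, smul_smul]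
  match_scalars <;> field_simp
  ring

theorem trace_mul_cholStep (hKG : K * G * K = c • K) (hk : K k k ≠ 0) :
    (G * cholStep K k).trace = (G * K).trace - c := by
  have hrank : (G * (K * Matrix.single k k 1 * K)).trace = c * K k k := by
    calc (G * (K * Matrix.single k k 1 * K)).trace
        = (Matrix.single k k 1 * (K * G * K)).trace := by
          rw [Matrix.trace_mul_comm, Matrix.mul_assoc, Matrix.mul_assoc K, Matrix.trace_mul_comm]
          simp only [Matrix.mul_assoc]
      _ = c * K k k := by
          rw [hKG, Matrix.mul_smul, Matrix.trace_smul, Matrix.trace_single_mul, one_smul,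
            smul_eq_mul]
  rw [cholStep, Matrix.mul_sub, Matrix.trace_sub, Matrix.mul_smul, Matrix.trace_smul, hrank,
    smul_eq_mul, mul_comm c, inv_mul_cancel_left₀ hk]

/-- The `k`-th column of `K` divided by the square root of the pivot `K k k`, which is meant to be
a positive real: the corresponding column of the Cholesky factor. -/
noncomputable def cholColumn (K : Matrix n n ℂ) (k μ : n) : ℂ :=
  K μ k / Real.sqrt (K k k).re

theorem star_cholColumn_mul {K : Matrix n n ℂ} (hK : K.IsHermitian) {k : n}
    (hk : 0 < (K k k).re) (μ ν : n) :
    star (cholColumn K k ν) * cholColumn K k μ = K μ ν - cholStep K k μ ν := by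
  have hpivot : (Real.sqrt (K k k).re : ℂ) * Real.sqrt (K k k).re = K k k := by
    rw [← Complex.ofReal_mul, Real.mul_self_sqrt hk.le]
    exact Complex.conj_eq_iff_re.1 (hK.apply k k)
  rw [cholStep_apply, sub_sub_cancel, cholColumn, cholColumn, star_div₀, hK.apply,
    Complex.star_def, Complex.conj_ofReal, div_mul_div_comm, hpivot, div_eq_inv_mul,
    mul_comm (K k ν)]

end Cholesky

section CholeskyCoframe

variable {V : Set E4}

theorem SmoothOnM.cholStep {n : Type*} [Fintype n] [DecidableEq n] {H : E4 → Matrix n n ℂ} {k : n}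
    (hH : SmoothOnM V H) (hk : ∀ y ∈ V, H y k k ≠ 0) :
    SmoothOnM V fun y => cholStep (H y) k := fun i j => by
  simp only [cholStep_apply]
  exact (hH i j).sub (((hH k k).inv hk).mul ((hH i k).mul (hH k j)))

theorem SmoothOnM.contDiffOn_cholColumn {n : Type*} {H : E4 → Matrix n n ℂ} {k : n}
    (hH : SmoothOnM V H) (hk : ∀ y ∈ V, 0 < (H y k k).re) (μ : n) :
    ContDiffOn ℝ ∞ (fun y => cholColumn (H y) k μ) V := by
  have hpivot : ContDiffOn ℝ ∞ (fun y => (H y k k).re) V :=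
    Complex.reCLM.contDiff.comp_contDiffOn (hH k k)
  have hsqrt : ContDiffOn ℝ ∞ (fun y => (Real.sqrt (H y k k).re : ℂ)) V :=
    Complex.ofRealCLM.contDiff.comp_contDiffOn (hpivot.sqrt fun y hy => (hk y hy).ne')
  simp only [cholColumn, div_eq_mul_inv]
  exact (hH μ k).mul
    (hsqrt.inv fun y hy => Complex.ofReal_ne_zero.2 (Real.sqrt_pos.2 (hk y hy)).ne')

/-- The coframe made of the first two columns of the Cholesky factor of `H`, with pivots `j` and
`k`; it has `herm (cholCoframe H j k) = H` where `H` has rank two. -/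
noncomputable def cholCoframe (H : E4 → Matrix (Fin 4) (Fin 4) ℂ) (j k : Fin 4) : C2Form :=
  fun y μ => !![cholColumn (H y) j μ; cholColumn (cholStep (H y) j) k μ]

theorem herm_cholCoframe {H : E4 → Matrix (Fin 4) (Fin 4) ℂ} {j k : Fin 4} {y : E4}
    (hH : (H y).IsHermitian) (hj : 0 < (H y j j).re) (hk : 0 < (cholStep (H y) j k k).re) :
    herm (cholCoframe H j k) y = H y - cholStep (cholStep (H y) j) k := by
  ext μ ν
  have hfirst := star_cholColumn_mul hH hj μ ν
  have hsecond := star_cholColumn_mul (isHermitian_cholStep hH j) hk μ ν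
  simp only [herm, cholCoframe, Matrix.of_apply, Matrix.mul_apply, Matrix.conjTranspose_apply,
    Fin.sum_univ_two, Matrix.cons_val', Matrix.cons_val_zero, Matrix.cons_val_one,
    Matrix.cons_val_fin_one, Matrix.sub_apply, hfirst, hsecond]
  ring

end CholeskyCoframe

section Existence

/-- The Hermitian form `g - i ω` of a compatible pair, in the convention of `herm_eq`. -/
noncomputable def hermitianForm (g om : Matrix (Fin 4) (Fin 4) ℝ) : Matrix (Fin 4) (Fin 4) ℂ :=
  g.map Complex.ofReal - Complex.I • om.map Complex.ofReal

theorem hermitianForm_apply (g om : Matrix (Fin 4) (Fin 4) ℝ) (μ ν : Fin 4) :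
    hermitianForm g om μ ν = g μ ν - Complex.I * om μ ν :=
  rfl

theorem map_ofReal_mul (X Y : Matrix (Fin 4) (Fin 4) ℝ) :
    X.map Complex.ofReal * Y.map Complex.ofReal = (X * Y).map Complex.ofReal :=
  (Matrix.map_mul (f := Complex.ofRealHom)).symm

variable {V : Set E4} {g om : E4 → Matrix (Fin 4) (Fin 4) ℝ} {y : E4}

namespace IsCompatiblePair

variable (h : IsCompatiblePair V g om)
include h

theorem isUnit_det (hy : y ∈ V) : IsUnit (g y).det :=
  (h.posDef y hy).det_pos.ne'.isUnit

theorem transpose_metric (hy : y ∈ V) : (g y)ᵀ = g y := by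
  rw [← Matrix.conjTranspose_eq_transpose_of_trivial]
  exact (h.posDef y hy).isHermitian

theorem isHermitian_hermitianForm (hy : y ∈ V) : (hermitianForm (g y) (om y)).IsHermitian := by
  ext μ ν
  rw [Matrix.conjTranspose_apply, hermitianForm_apply, hermitianForm_apply,
    ← congrFun₂ (h.transpose_metric hy) μ ν, skew_apply (h.skew y hy) μ ν]
  simp

theorem hermitianForm_diag (hy : y ∈ V) (k : Fin 4) :
    hermitianForm (g y) (om y) k k = g y k k := by
  simp [hermitianForm_apply, skew_diag (h.skew y hy)]

theorem smoothOnM_hermitianForm : SmoothOnM V fun y => hermitianForm (g y) (om y) := fun i j =>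
  (Complex.ofRealCLM.contDiff.comp_contDiffOn (h.smooth_g i j)).sub
    (contDiffOn_const.mul (Complex.ofRealCLM.contDiff.comp_contDiffOn (h.smooth_om i j)))

theorem hermitianForm_mul_inv_mul (hy : y ∈ V) :
    hermitianForm (g y) (om y) * (g y)⁻¹.map Complex.ofReal * hermitianForm (g y) (om y)
      = (2 : ℂ) • hermitianForm (g y) (om y) := by
  have hneg : (-g y).map Complex.ofReal = -(g y).map Complex.ofReal := by
    ext i j
    simp
  simp only [hermitianForm, Matrix.sub_mul, Matrix.mul_sub, Matrix.smul_mul, Matrix.mul_smul,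
    map_ofReal_mul]
  rw [h.compat y hy, Matrix.mul_nonsing_inv _ (h.isUnit_det hy), Matrix.one_mul, Matrix.one_mul,
    Matrix.mul_assoc (om y), Matrix.nonsing_inv_mul _ (h.isUnit_det hy), Matrix.mul_one, hneg]
  linear_combination (norm := module) (-Complex.I_sq) • (g y).map Complex.ofReal

theorem trace_inv_mul_omega (hy : y ∈ V) : ((g y)⁻¹ * om y).trace = 0 := by
  have hskew : ((g y)⁻¹ * om y).trace = -((g y)⁻¹ * om y).trace := by
    conv_lhs => rw [← Matrix.trace_transpose, Matrix.transpose_mul, h.skew y hy,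
      Matrix.transpose_nonsing_inv, h.transpose_metric hy, Matrix.neg_mul, Matrix.trace_neg,
      Matrix.trace_mul_comm]
  linarith

theorem trace_inv_mul_hermitianForm (hy : y ∈ V) :
    ((g y)⁻¹.map Complex.ofReal * hermitianForm (g y) (om y)).trace = 4 := by
  have hmap (X : Matrix (Fin 4) (Fin 4) ℝ) : (X.map Complex.ofReal).trace = (X.trace : ℂ) :=
    (AddMonoidHom.map_trace Complex.ofRealHom.toAddMonoidHom X).symm
  rw [hermitianForm, Matrix.mul_sub, Matrix.mul_smul, map_ofReal_mul, map_ofReal_mul,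
    Matrix.nonsing_inv_mul _ (h.isUnit_det hy), Matrix.trace_sub, Matrix.trace_smul, hmap, hmap,
    h.trace_inv_mul_omega hy]
  simp

theorem hermitianForm_diag_pos (hy : y ∈ V) (k : Fin 4) :
    0 < (hermitianForm (g y) (om y) k k).re := by
  rw [h.hermitianForm_diag hy, Complex.ofReal_re]
  exact (h.posDef y hy).diag_pos

theorem hermitianForm_diag_ne_zero (hy : y ∈ V) (k : Fin 4) :
    hermitianForm (g y) (om y) k k ≠ 0 := fun h0 =>
  (h.hermitianForm_diag_pos hy k).ne' (congrArg Complex.re h0)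

theorem cholStep_mul_inv_mul (hy : y ∈ V) (j : Fin 4) :
    cholStep (hermitianForm (g y) (om y)) j * (g y)⁻¹.map Complex.ofReal
      * cholStep (hermitianForm (g y) (om y)) j
      = (2 : ℂ) • cholStep (hermitianForm (g y) (om y)) j :=
  cholStep_mul_mul_cholStep (h.hermitianForm_mul_inv_mul hy) (h.hermitianForm_diag_ne_zero hy j)

theorem trace_inv_mul_cholStep (hy : y ∈ V) (j : Fin 4) :
    ((g y)⁻¹.map Complex.ofReal * cholStep (hermitianForm (g y) (om y)) j).trace = 2 := by
  rw [trace_mul_cholStep (h.hermitianForm_mul_inv_mul hy) (h.hermitianForm_diag_ne_zero hy j),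
    h.trace_inv_mul_hermitianForm hy]
  norm_num

open scoped ComplexOrder in
theorem exists_cholStep_diag_pos (hy : y ∈ V) (j : Fin 4) :
    ∃ k, 0 < (cholStep (hermitianForm (g y) (om y)) j k k).re := by
  refine exists_re_diag_pos two_pos (posSemidef_map_ofReal (h.posDef y hy).inv.posSemidef)
    (isHermitian_cholStep (h.isHermitian_hermitianForm hy) j) (h.cholStep_mul_inv_mul hy j)
    fun hzero => ?_
  have htrace := h.trace_inv_mul_cholStep hy j
  rw [hzero, Matrix.mul_zero, Matrix.trace_zero] at htrace
  exact two_ne_zero htrace.symm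

theorem cholStep_cholStep_eq_zero (hy : y ∈ V) {j k : Fin 4}
    (hk : cholStep (hermitianForm (g y) (om y)) j k k ≠ 0) :
    cholStep (cholStep (hermitianForm (g y) (om y)) j) k = 0 := by
  have hK := h.cholStep_mul_inv_mul hy j
  refine eq_zero_of_trace_mul_eq_zero two_ne_zero (cholStep_mul_mul_cholStep hK hk) ?_
  rw [trace_mul_cholStep hK hk, h.trace_inv_mul_cholStep hy, sub_self]

theorem exists_coframe (hV : IsOpen V) {y₀ : E4} (hy₀ : y₀ ∈ V) :
    ∃ V' : Set E4, ∃ Ψ : C2Form, IsOpen V' ∧ y₀ ∈ V' ∧ V' ⊆ V ∧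
      (∀ μ c, ContDiffOn ℝ ∞ (fun y => Ψ y μ c 0) V') ∧
      ∀ y ∈ V', (coframe Ψ y).det ≠ 0 ∧ metric Ψ y = g y ∧ omega Ψ y = om y := by
  set H : E4 → Matrix (Fin 4) (Fin 4) ℂ := fun y => hermitianForm (g y) (om y)
  have hH : SmoothOnM V H := h.smoothOnM_hermitianForm
  have hK : SmoothOnM V fun y => cholStep (H y) 0 :=
    hH.cholStep fun y hy => h.hermitianForm_diag_ne_zero hy 0
  obtain ⟨k, hk⟩ := h.exists_cholStep_diag_pos hy₀ 0
  have hpivot : ContDiffOn ℝ ∞ (fun y => (cholStep (H y) 0 k k).re) V :=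
    Complex.reCLM.contDiff.comp_contDiffOn (hK k k)
  set V' : Set E4 := V ∩ (fun y => (cholStep (H y) 0 k k).re) ⁻¹' Set.Ioi 0
  have hsub : V' ⊆ V := Set.inter_subset_left
  have hherm (y) (hy : y ∈ V') (μ ν) :
      herm (cholCoframe H 0 k) y μ ν = g y μ ν - Complex.I * om y μ ν := by
    have hpos : 0 < (cholStep (H y) 0 k k).re := hy.2
    rw [herm_cholCoframe (h.isHermitian_hermitianForm hy.1) (h.hermitianForm_diag_pos hy.1 0) hpos,
      h.cholStep_cholStep_eq_zero hy.1 fun h0 => hpos.ne' (congrArg Complex.re h0), sub_zero]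
    exact hermitianForm_apply (g y) (om y) μ ν
  have hmetric (y) (hy : y ∈ V') : metric (cholCoframe H 0 k) y = g y := by
    ext μ ν
    simp [metric_eq_re, hherm y hy]
  refine ⟨V', cholCoframe H 0 k, hpivot.continuousOn.isOpen_inter_preimage hV isOpen_Ioi,
    ⟨hy₀, hk⟩, hsub, fun μ c => ?_, fun y hy => ⟨fun hdet => ?_, hmetric y hy, ?_⟩⟩
  · fin_cases c
    · exact (hH.contDiffOn_cholColumn (fun y hy => h.hermitianForm_diag_pos hy 0) μ).mono hsub
    · exact SmoothOnM.contDiffOn_cholColumn (fun i j => (hK i j).mono hsub) (fun y hy => hy.2) μ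
  · apply (h.posDef y hy.1).det_pos.ne'
    rw [← hmetric y hy, det_metric, hdet, zero_pow two_ne_zero]
  · ext μ ν
    simp [omega_eq_im, hherm y hy]

end IsCompatiblePair

end Existence

/-! ### The action at the anti-self-dual part of the Levi-Civita connection -/

section Action

variable {M : Type*} [TopologicalSpace M]

theorem measurableSet_atlasPieces (chart : ℕ → OpenPartialHomeomorph M E4) :
    MeasurableSet {p : ℕ × E4 | p.2 ∈ (chart p.1).target ∧
      ∀ m < p.1, (chart p.1).symm p.2 ∉ (chart m).source} := by
  have hpieces : {p : ℕ × E4 | p.2 ∈ (chart p.1).target ∧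
      ∀ m < p.1, (chart p.1).symm p.2 ∉ (chart m).source}
      = ⋃ i : ℕ, ({i} : Set ℕ) ×ˢ ((chart i).target \ ⋃ m ∈ Set.Iio i, overlap chart i m) := by
    ext ⟨i, y⟩
    simp only [overlap, Set.mem_ofPred_eq, Set.mem_iUnion, Set.mem_prod, Set.mem_singleton_iff,
      Set.mem_sdiff, Set.mem_Iio]
    grind
  rw [hpieces]
  exact .iUnion fun i => (measurableSet_singleton i).prod <|
    (chart i).open_target.measurableSet.diff
      (.biUnion (Set.to_countable _) fun m _ => (isOpen_overlap chart i m).measurableSet)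

theorem atlasIntegral_congr {chart : ℕ → OpenPartialHomeomorph M E4} {f f' : ℕ → E4 → ℂ}
    (h : ∀ i, ∀ y ∈ (chart i).target, f i y = f' i y) :
    atlasIntegral chart f = atlasIntegral chart f' :=
  setIntegral_congr_fun (measurableSet_atlasPieces chart) fun p hp => h p.1 p.2 hp.1

theorem atlasIntegral_const_mul (chart : ℕ → OpenPartialHomeomorph M E4) (c : ℂ)
    (f : ℕ → E4 → ℂ) :
    (atlasIntegral chart fun i y => c * f i y) = c * atlasIntegral chart f :=
  integral_const_mul c _

theorem U2Structure.action_asdLeviCivita [ChartedSpace E4 M] (P : U2Structure M) {lam mu nu : ℝ}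
    (hlam : lam ≠ 0) (hrel : 3 * lam - mu + 4 * nu = 0) (a : ℕ → E4 → Fin 4 → ℂ) :
    action lam mu nu P a (fun i => asdLeviCivita (P.Psi i))
      = gwAction P.chart lam (mu / lam) (fun i => metric (P.Psi i))
          (fun i => omega (P.Psi i)) a := by
  rw [action, gwAction, ← atlasIntegral_const_mul]
  refine atlasIntegral_congr fun i y hy => ?_
  rw [(P.isSmoothCoframe i).lagrangian_asdLeviCivita hlam hrel (a i) hy, sign_w22_omega_omega,
    sqrt_det_metric, ← sign_mul_self_eq_abs, orient]
  push_cast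
  ring

end Action

end U2Gravity

theorem proposition2 {M : Type*} [TopologicalSpace M] [T2Space M] [SecondCountableTopology M]
    [ChartedSpace U2Gravity.E4 M] [IsManifold (𝓡 4) ∞ M]
    (P : U2Gravity.U2Structure M) (a : ℕ → U2Gravity.E4 → Fin 4 → ℂ)
    (ha : U2Gravity.IsU1Connection P a)
    (lam mu nu : ℝ) (hlam : lam ≠ 0) (hrel : 3 * lam - mu + 4 * nu = 0) :
    -- the first variation: the Euler-Lagrange expression is `dΣ + A ∧ Σ - Σ ∧ A`
    (∀ A, U2Gravity.IsSU2Connection P A →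
      ∀ i δ, U2Gravity.IsVariation (P.chart i).target δ →
        HasDerivAt
          (fun t : ℝ => U2Gravity.actionChange lam mu nu (P.chart i).target (P.Psi i) (a i) (A i)
            (fun y μ => (t : ℂ) • δ y μ))
          (∫ y in (P.chart i).target, (U2Gravity.orient (P.Psi i) y : ℂ) *
            (-(lam : ℂ) * Matrix.trace
              (U2Gravity.w13 (δ y) (U2Gravity.elForm (P.Psi i) y (A i y)) :
                Matrix (Fin 2) (Fin 2) ℂ))) 0) ∧
    -- the Euler-Lagrange equation is an algebraic equation for the values of `A`
    (∀ A, U2Gravity.IsSU2Connection P A →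
      (U2Gravity.IsStationary lam mu nu P a A ↔
        ∀ i, ∀ y ∈ (P.chart i).target, U2Gravity.elForm (P.Psi i) y (A i y) = 0)) ∧
    -- it is uniquely solved, point by point, by the anti-self-dual part of Levi-Civita
    (∀ i, ∀ y ∈ (P.chart i).target, ∀ B : Fin 4 → Matrix (Fin 2) (Fin 2) ℂ,
      (∀ μ, U2Gravity.IsSu2 (B μ)) →
      (U2Gravity.elForm (P.Psi i) y B = 0 ↔ B = U2Gravity.asdLeviCivita (P.Psi i) y)) ∧
    -- the anti-self-dual part of Levi-Civita is a connection, and is the only stationary one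
    U2Gravity.IsSU2Connection P (fun i => U2Gravity.asdLeviCivita (P.Psi i)) ∧
    (∀ A, U2Gravity.IsSU2Connection P A →
      (U2Gravity.IsStationary lam mu nu P a A ↔
        ∀ i, ∀ y ∈ (P.chart i).target, A i y = U2Gravity.asdLeviCivita (P.Psi i) y)) ∧
    -- the pair `(g, ω)`: a compatible pair of tensors on `M`, with `ω = (1/2i) Ψ†Ψ`
    (∀ i, U2Gravity.IsCompatiblePair (P.chart i).target
      (U2Gravity.metric (P.Psi i)) (U2Gravity.omega (P.Psi i))) ∧
    (∀ i j, ∀ y ∈ U2Gravity.overlap P.chart i j,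
      U2Gravity.metric (P.Psi i) y = Matrix.of (U2Gravity.pull2
        (U2Gravity.transition P.chart i j) (fun z => U2Gravity.metric (P.Psi j) z) y) ∧
      U2Gravity.omega (P.Psi i) y = Matrix.of (U2Gravity.pull2
        (U2Gravity.transition P.chart i j) (fun z => U2Gravity.omega (P.Psi j) z) y)) ∧
    (∀ i, ∀ y ∈ (P.chart i).target, ∀ μ ν,
      (U2Gravity.omega (P.Psi i) y μ ν : ℂ)
        = 1 / (2 * Complex.I) * U2Gravity.dagPsi (P.Psi i) y μ ν 0 0) ∧
    -- the volume form, the scalar curvature, and the two identities used in the substitution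
    (∀ i, ∀ y ∈ (P.chart i).target,
      U2Gravity.volForm (P.Psi i) y
        = Real.sign (U2Gravity.w22 (U2Gravity.omega (P.Psi i) y) (U2Gravity.omega (P.Psi i) y))
          * Real.sqrt (U2Gravity.metric (P.Psi i) y).det ∧
      U2Gravity.scalarCurv (U2Gravity.metric (P.Psi i)) y * U2Gravity.volForm (P.Psi i) y
        = U2Gravity.w22 (U2Gravity.lcCurv (P.Psi i) y 0 1) (U2Gravity.ee (P.Psi i) y 2 3)
          - U2Gravity.w22 (U2Gravity.lcCurv (P.Psi i) y 0 2) (U2Gravity.ee (P.Psi i) y 1 3)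
          + U2Gravity.w22 (U2Gravity.lcCurv (P.Psi i) y 0 3) (U2Gravity.ee (P.Psi i) y 1 2)
          + U2Gravity.w22 (U2Gravity.lcCurv (P.Psi i) y 1 2) (U2Gravity.ee (P.Psi i) y 0 3)
          - U2Gravity.w22 (U2Gravity.lcCurv (P.Psi i) y 1 3) (U2Gravity.ee (P.Psi i) y 0 2)
          + U2Gravity.w22 (U2Gravity.lcCurv (P.Psi i) y 2 3) (U2Gravity.ee (P.Psi i) y 0 1) ∧
      Matrix.trace
          (U2Gravity.psiFpsi (P.Psi i) (U2Gravity.asdLeviCivita (P.Psi i)) y)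
        = -((U2Gravity.scalarCurv (U2Gravity.metric (P.Psi i)) y
            * U2Gravity.volForm (P.Psi i) y : ℝ) : ℂ) ∧
      Matrix.trace (U2Gravity.w22 (U2Gravity.dagPsi (P.Psi i) y) (U2Gravity.dagPsi (P.Psi i) y) :
          Matrix (Fin 1) (Fin 1) ℂ)
        = -8 * (U2Gravity.volForm (P.Psi i) y : ℂ) ∧
      -- the Lagrangian at `A = 𝐰`, as a `4`-form
      U2Gravity.lagrangian lam mu nu (P.Psi i) (a i) (U2Gravity.asdLeviCivita (P.Psi i)) y
        = -(lam : ℂ) *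
          ((U2Gravity.volForm (P.Psi i) y : ℂ)
            * ((U2Gravity.scalarCurv (U2Gravity.metric (P.Psi i)) y + 2 * (mu / lam) - 6 : ℝ) : ℂ)
          - 2 * ((mu / lam : ℝ) : ℂ) * U2Gravity.w22
              (fun κ ι => (U2Gravity.omega (P.Psi i) y κ ι : ℂ))
              (fun κ ι => Complex.I * U2Gravity.d1 (a i) y κ ι))) ∧
    -- the action at `A = 𝐰` is the functional of `(g, ω, a)`
    U2Gravity.action lam mu nu P a (fun i => U2Gravity.asdLeviCivita (P.Psi i))
      = U2Gravity.gwAction P.chart lam (mu / lam) (fun i => U2Gravity.metric (P.Psi i))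
          (fun i => U2Gravity.omega (P.Psi i)) a ∧
    -- `U(2)`-structures are the same as compatible pairs
    (∀ (Ψ Φ : U2Gravity.C2Form) (y : U2Gravity.E4),
      (U2Gravity.coframe Ψ y).det ≠ 0 → (U2Gravity.coframe Φ y).det ≠ 0 →
      ((U2Gravity.metric Ψ y = U2Gravity.metric Φ y ∧ U2Gravity.omega Ψ y = U2Gravity.omega Φ y) ↔
        ∃ u ∈ Matrix.unitaryGroup (Fin 2) ℂ, ∀ μ, Ψ y μ = u * Φ y μ)) ∧
    (∀ (V : Set U2Gravity.E4) (g om : U2Gravity.E4 → Matrix (Fin 4) (Fin 4) ℝ), IsOpen V →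
      U2Gravity.IsCompatiblePair V g om → ∀ y₀ ∈ V, ∃ V' : Set U2Gravity.E4, ∃ Ψ : U2Gravity.C2Form,
        IsOpen V' ∧ y₀ ∈ V' ∧ V' ⊆ V ∧
        (∀ μ c, ContDiffOn ℝ ∞ (fun y => Ψ y μ c 0) V') ∧
        ∀ y ∈ V', (U2Gravity.coframe Ψ y).det ≠ 0 ∧
          U2Gravity.metric Ψ y = g y ∧ U2Gravity.omega Ψ y = om y) := by
  have hstationary A (hA : U2Gravity.IsSU2Connection P A) :=
    U2Gravity.isStationary_iff hlam mu nu a hA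
  refine ⟨fun A hA i δ hδ => U2Gravity.hasDerivAt_actionChange lam mu nu (a i)
      (P.isSmoothCoframe i) (hA.isSmoothSu2 i) hδ,
    hstationary,
    fun i y hy B hB => (P.isSmoothCoframe i).elForm_eq_zero_iff hy hB,
    P.isSU2Connection_asdLeviCivita,
    fun A hA => (hstationary A hA).trans (forall_congr' fun i => forall₂_congr fun y hy =>
      (P.isSmoothCoframe i).elForm_eq_zero_iff hy (hA.2.1 i y hy)),
    fun i => (P.isSmoothCoframe i).isCompatiblePair,
    fun i j y hy => P.metric_omega_overlap hy,
    fun i y _ μ ν => U2Gravity.omega_dagPsi _ y μ ν,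
    fun i y hy => ⟨U2Gravity.volForm_eq _ y, (P.isSmoothCoframe i).scalarCurv_mul_volForm hy, ?_,
      U2Gravity.trace_dagPsi_sq _ y,
      (P.isSmoothCoframe i).lagrangian_asdLeviCivita hlam hrel (a i) hy⟩,
    P.action_asdLeviCivita hlam hrel a,
    fun Ψ Φ y _ hΦ => U2Gravity.metric_omega_eq_iff hΦ,
    fun V g om hV h y₀ hy₀ => h.exists_coframe hV hy₀⟩
  rw [(P.isSmoothCoframe i).scalarCurv_mul_volForm hy]
  exact (P.isSmoothCoframe i).trace_psiFpsi hy
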